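/- Let $M$ be a smooth finite-dimensional manifold (Hausdorff, second countable, without boundary) and let $\pi:A\to M$ be a smooth affine bundle of rank $n$. A *Jacobi structure* on a manifold $N$ is a pair $(\Lambda,E)$ of a smooth bivector field and a smooth vector field with $[\Lambda,\Lambda]=-2E\wedge\Lambda$ and $[E,\Lambda]=0$, where the sign of the Schouten bracket is such that it is a graded Lie bracket, i.e. $[\Lambda,\Lambda](df,dg,dh)=2\big(\Lambda(df,d(\Lambda(dg,dh)))+\text{cyclic}\big)$. Its *Jacobi bracket* is $\{f,g\}_{(\Lambda,E)}=\Lambda(df,dg)+fE(g)-gE(f)$. A *Poisson structure* is a smooth bivector field $\Lambda$ with $[\Lambda,\Lambda]=0$, and its bracket is $\{f,g\}_\Lambda=\Lambda(df,dg)$. A Jacobi structure on $A$ (or its bracket) is *affine* if the bracket of any two affine functions is an affine function, where an affine function is a smooth function on $A$ that is affine on every fibre $A_p$. Let $A^+=\bigcup_{p\in M}\mathrm{Aff}(A_p,\mathbb R)$ be the vector bundle of affine functionals and $\hat A=(A^+)^*$ its dual bundle, with Liouville vector field $\Delta_{\hat A}$. The bundle $A$ is included in $\hat A$ by sending a point of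 $A_p$ to the evaluation at it. An affine function $a:A\to\mathbb R$ corresponds to the linear function $\bar a:\hat A\to\mathbb R$, $\bar a(\psi_p)=\psi_p(a|_{A_p})$, and $\iota_{\tilde 1}=\bar 1$ corresponds to the constant function $1$. A Poisson structure $\bar\Lambda$ on $\hat A$ is *homogeneous* (linear) if $\mathcal L_{\Delta_{\hat A}}\bar\Lambda=-\bar\Lambda$. 1. If $n>0$, there is a one-to-one correspondence between affine Jacobi brackets $\{\cdot,\cdot\}_{(\Lambda_A,E_A)}$ on $A$ and homogeneous Poisson brackets $\{\cdot,\cdot\}_{\bar\Lambda_{\hat A}}$ on $\hat A$, uniquely determined by $$\{a,b\}_{(\Lambda_A,E_A)}=\big(\{\bar a,\bar b\}_{\bar\Lambda_{\hat A}}\big)_{|A}\qquad\text{for all affine functions } a,b:A\to\mathbb R.$$ Moreover, let $E_{\hat A}$ be the hamiltonian vector field of $\iota_{\tilde 1}$ with respect to $\bar\Lambda_{\hat A}$, i.e. $E_{\hat A}(f)=\bar\Lambda_{\hat A}(d\iota_{\tilde 1},df)$. Then $(\bar\Lambda_{\hat A}-\Delta_{\hat A}\wedge E_{\hat A},\,E_{\hat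 A})$ is a Jacobi structure on $\hat A$ whose tensors are tangent to $A$ along $A$, and $(\Lambda_A,E_A)$ is its restriction to $A$. 2. If $n=0$, every (affine) Jacobi structure $(\Lambda_A,E_A)$ on $A$ induces a unique Jacobi structure $(\Lambda,E)$ on $M$ that is related to it by the bijection $\pi:A\to M$. Let $t$ be the coordinate on $\mathbb R\setminus\{0\}$, and call a Poisson tensor $\bar\Lambda$ on $M\times(\mathbb R\setminus\{0\})$ *linear* if for all $f,g\in C^\infty(M)$ there is $h\in C^\infty(M)$ with $\bar\Lambda(d(tf),d(tg))=th$. Then there is a one-to-one correspondence between affine Jacobi brackets $\{\cdot,\cdot\}_{(\Lambda_A,E_A)}$ on $A$ and linear Poisson tensors $\bar\Lambda$ on $M\times(\mathbb R\setminus\{0\})$, uniquely determined by $$\bar\Lambda(d(tf),d(tg))=t\,\{f,g\}_{(\Lambda,E)}\qquad\text{for all } f,g\in C^\infty(M),$$ and this linear Poisson tensor is $$\bar\Lambda=\frac1t\,\Lambda+\frac{\partial}{\partial t}\wedge E.$$ -/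

import Mathlib

open Set Bundle Module
open scoped Manifold ContDiff Topology

noncomputable section

/-! ### Affine bundles -/

section AffineBundles

variable {M : Type*} [TopologicalSpace M]
  (F : Type*) [NormedAddCommGroup F] [NormedSpace ℝ F]
  {V : M → Type*} [∀ x, AddCommGroup (V x)] [∀ x, Module ℝ (V x)]
  (E : M → Type*) [∀ x, AddTorsor (V x) (E x)]

/-- A locally trivial bundle `E` over `M` whose fibre `E x` is an affine space modelled on the
vector space `V x` is an affine bundle if its trivializations are affine isomorphisms on the
fibres. The trivializations then pass from one to another by affine transformations of `F`, and
their linear parts make `V` a vector bundle. The rank is `finrank ℝ F`. -/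
class IsAffineBundle [TopologicalSpace (TotalSpace F E)] [∀ x, TopologicalSpace (E x)]
    [FiberBundle F E] : Prop where
  affine : ∀ (e : Trivialization F (π F E)) [MemTrivializationAtlas e], ∀ x ∈ e.baseSet,
    ∃ φ : E x ≃ᵃ[ℝ] F, ∀ p : E x, (e ⟨x, p⟩).2 = φ p

/-- A smooth affine bundle: the changes of trivialization are smooth. -/
class IsSmoothAffineBundle {EM : Type*} [NormedAddCommGroup EM] [NormedSpace ℝ EM]
    {H : Type*} [TopologicalSpace H] (I : ModelWithCorners ℝ EM H) [ChartedSpace H M]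
    [TopologicalSpace (TotalSpace F E)] [∀ x, TopologicalSpace (E x)]
    [FiberBundle F E] : Prop extends IsAffineBundle F E where
  smooth : ∀ (e e' : Trivialization F (π F E)) [MemTrivializationAtlas e]
    [MemTrivializationAtlas e'],
    ContMDiffOn (I.prod 𝓘(ℝ, F)) 𝓘(ℝ, F) ∞
      (fun q : M × F => (e' (e.toOpenPartialHomeomorph.symm q)).2)
      ((e.baseSet ∩ e'.baseSet) ×ˢ univ)

/-- The affine isomorphism from the fibre over `x` to `F` given by a trivialization `e` (when `x`
is outside the base set of `e`, the preferred trivialization at `x` is used instead). -/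
def fibreAff [TopologicalSpace (TotalSpace F E)] [∀ x, TopologicalSpace (E x)]
    [FiberBundle F E] [h : IsAffineBundle F E] (e : Trivialization F (π F E))
    [MemTrivializationAtlas e] (x : M) : E x ≃ᵃ[ℝ] F :=
  open Classical in
  if hx : x ∈ e.baseSet then (h.affine e x hx).choose
  else (h.affine (trivializationAt F E x) x (mem_baseSet_trivializationAt F E x)).choose

theorem fibreAff_apply [TopologicalSpace (TotalSpace F E)] [∀ x, TopologicalSpace (E x)]
    [FiberBundle F E] [h : IsAffineBundle F E] (e : Trivialization F (π F E))
    [MemTrivializationAtlas e] {x : M} (hx : x ∈ e.baseSet) (p : E x) :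
    fibreAff F E e x p = (e ⟨x, p⟩).2 := by
  unfold fibreAff
  rw [dif_pos hx]
  exact ((h.affine e x hx).choose_spec p).symm

/-- For a finite-dimensional vector space `F`, the dual of the space of affine functions on an
affine space `P` is identified, through an affine isomorphism `φ : P ≃ F`, with `ℝ × F`: the pair
`(t, v)` is the functional `a ↦ t * b 0 + b.linear v`, where `b = a ∘ φ⁻¹`. -/
def hullCoord [FiniteDimensional ℝ F] {W P : Type*} [AddCommGroup W] [Module ℝ W]
    [AddTorsor W P] (φ : P ≃ᵃ[ℝ] F) : Dual ℝ (P →ᵃ[ℝ] ℝ) ≃ₗ[ℝ] ℝ × F where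
  toFun ψ := (ψ (AffineMap.const ℝ P 1),
    (evalEquiv ℝ F).symm
      { toFun := fun ℓ => ψ (ℓ.toAffineMap.comp φ.toAffineMap)
        map_add' := fun ℓ ℓ' => by rw [← map_add]; rfl
        map_smul' := fun c ℓ => by rw [RingHom.id_apply, ← map_smul]; rfl })
  invFun y :=
    { toFun := fun a => y.1 * a (φ.symm 0) + (a.comp φ.symm.toAffineMap).linear y.2
      map_add' := fun a b => by
        simp only [AffineMap.coe_add, Pi.add_apply, AffineMap.comp_linear, AffineMap.add_linear,
          LinearMap.comp_apply, LinearMap.add_apply]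
        ring
      map_smul' := fun c a => by
        simp only [AffineMap.coe_smul, Pi.smul_apply, AffineMap.comp_linear,
          AffineMap.smul_linear, LinearMap.comp_apply, LinearMap.smul_apply, smul_eq_mul,
          RingHom.id_apply]
        ring }
  map_add' ψ ψ' := by
    refine Prod.ext rfl ?_
    rw [Prod.snd_add, ← map_add]
    rfl
  map_smul' c ψ := by
    refine Prod.ext rfl ?_
    rw [RingHom.id_apply, Prod.smul_snd, ← map_smul]
    rfl
  left_inv ψ := by
    ext a
    have key : a = (a (φ.symm 0)) • AffineMap.const ℝ P (1 : ℝ) +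
        ((a.comp φ.symm.toAffineMap).linear.toAffineMap.comp φ.toAffineMap) := by
      ext p
      have := congrFun (AffineMap.decomp (a.comp φ.symm.toAffineMap)) (φ p)
      simp at this
      simp [this]
      ring
    conv_rhs => rw [key, map_add, map_smul]
    simp only [LinearMap.coe_mk, AddHom.coe_mk, smul_eq_mul]
    rw [mul_comm]
    congr 1
    exact Module.apply_evalEquiv_symm_apply (R := ℝ) (M := F) _ _
  right_inv y := by
    refine Prod.ext (by simp) ?_
    change (evalEquiv ℝ F).symm _ = _
    rw [LinearEquiv.symm_apply_eq]
    ext ℓ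
    simp

theorem hullCoord_comp_symm [FiniteDimensional ℝ F] {W P : Type*} [AddCommGroup W] [Module ℝ W]
    [AddTorsor W P] (φ φ' : P ≃ᵃ[ℝ] F) (y : ℝ × F) :
    hullCoord F φ' ((hullCoord F φ).symm y) =
      (y.1, y.1 • φ' (φ.symm 0) + (φ' (φ.symm y.2) - φ' (φ.symm 0))) := by
  refine Prod.ext (by simp [hullCoord]) ?_
  change (evalEquiv ℝ F).symm _ = _
  rw [LinearEquiv.symm_apply_eq]
  ext ℓ
  have : φ' (φ.symm y.2) - φ' (φ.symm 0) = φ'.linear (φ.symm.linear y.2) := by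
    have h1 := (φ.symm.trans φ').toAffineMap.linearMap_vsub y.2 0
    simpa using h1.symm
  rw [this]
  simp [hullCoord]

/-! ### The vector hull -/

/-- The fibres of the vector hull of an affine bundle: the dual space of the vector space of
affine functions on the fibre `E x`. -/
@[nolint unusedArguments]
def Hull (_F : Type*) (E : M → Type*) [∀ x, AddTorsor (V x) (E x)] (x : M) : Type _ :=
  Dual ℝ (E x →ᵃ[ℝ] ℝ)

instance (x : M) : AddCommGroup (Hull F E x) :=
  inferInstanceAs (AddCommGroup (Dual ℝ (E x →ᵃ[ℝ] ℝ)))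

instance (x : M) : Module ℝ (Hull F E x) :=
  inferInstanceAs (Module ℝ (Dual ℝ (E x →ᵃ[ℝ] ℝ)))

/-- An element of the hull is a functional on affine functions. -/
def Hull.eval {F : Type*} {E : M → Type*} [∀ x, AddTorsor (V x) (E x)] {x : M}
    (ψ : Hull F E x) (a : E x →ᵃ[ℝ] ℝ) : ℝ :=
  (show Dual ℝ (E x →ᵃ[ℝ] ℝ) from ψ) a

variable [FiniteDimensional ℝ F]
  [TopologicalSpace (TotalSpace F E)] [∀ x, TopologicalSpace (E x)]
  [FiberBundle F E] [IsAffineBundle F E]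

/-- The linear coordinates on the fibre of the hull induced by a trivialization of the affine
bundle. -/
def hullFibre (e : Trivialization F (π F E)) [MemTrivializationAtlas e] (x : M) :
    Hull F E x ≃ₗ[ℝ] ℝ × F :=
  hullCoord F (fibreAff F E e x)

instance (x : M) : TopologicalSpace (Hull F E x) :=
  TopologicalSpace.induced (hullFibre F E (trivializationAt F E x) x) inferInstance

/-- The local trivialization of the hull induced by a trivialization of the affine bundle. -/
def hullPretriv (e : Trivialization F (π F E)) [MemTrivializationAtlas e] :
    Pretrivialization (ℝ × F) (π (ℝ × F) (Hull F E)) where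
  toFun ψ := (ψ.1, hullFibre F E e ψ.1 ψ.2)
  invFun q := ⟨q.1, (hullFibre F E e q.1).symm q.2⟩
  source := π (ℝ × F) (Hull F E) ⁻¹' e.baseSet
  target := e.baseSet ×ˢ univ
  map_source' ψ hψ := ⟨hψ, mem_univ _⟩
  map_target' q hq := hq.1
  left_inv' ψ _ := by simp
  right_inv' q _ := by simp
  open_target := e.open_baseSet.prod isOpen_univ
  baseSet := e.baseSet
  open_baseSet := e.open_baseSet
  source_eq := rfl
  target_eq := rfl
  proj_toFun _ _ := rfl

theorem hullPretriv_symm (e : Trivialization F (π F E)) [MemTrivializationAtlas e] {x : M}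
    (hx : x ∈ e.baseSet) (y : ℝ × F) :
    (hullPretriv F E e).symm x y = (hullFibre F E e x).symm y := by
  have h : x ∈ (hullPretriv F E e).baseSet := hx
  apply (hullFibre F E e x).injective
  have := (hullPretriv F E e).apply_mk_symm h y
  rw [LinearEquiv.apply_symm_apply]
  exact congrArg Prod.snd this

theorem continuousOn_hullChange (e e' : Trivialization F (π F E)) [MemTrivializationAtlas e]
    [MemTrivializationAtlas e'] :
    ContinuousOn (fun x => LinearMap.toContinuousLinearMap
      ((hullFibre F E e' x).toLinearMap ∘ₗ (hullFibre F E e x).symm.toLinearMap))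
      (e.baseSet ∩ e'.baseSet) := by
  rw [continuousOn_clm_apply]
  intro y
  have hg : ∀ v : F, ContinuousOn (fun x => fibreAff F E e' x ((fibreAff F E e x).symm v))
      (e.baseSet ∩ e'.baseSet) := by
    intro v
    have hc : ContinuousOn (fun x => (e' (e.toOpenPartialHomeomorph.symm (x, v))).2)
        (e.baseSet ∩ e'.baseSet) := by
      have h1 : ContinuousOn (fun x : M => e.toOpenPartialHomeomorph.symm (x, v))
          (e.baseSet ∩ e'.baseSet) :=
        e.toOpenPartialHomeomorph.symm.continuousOn.comp
          (by fun_prop) (fun x hx => by simpa [e.target_eq] using hx.1)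
      refine continuous_snd.comp_continuousOn (e'.continuousOn.comp h1 ?_)
      intro x hx
      rw [e'.mem_source]
      have := e.proj_symm_apply (x := (x, v)) (by simpa [e.target_eq] using hx.1)
      exact this ▸ hx.2
    refine hc.congr fun x hx => ?_
    have h2 : e.toOpenPartialHomeomorph.symm (x, v) = ⟨x, (fibreAff F E e x).symm v⟩ := by
      have hs : (⟨x, (fibreAff F E e x).symm v⟩ : TotalSpace F E) ∈ e.source := by
        rw [e.mem_source]; exact hx.1
      have h3 : e ⟨x, (fibreAff F E e x).symm v⟩ = (x, v) := by
        refine Prod.ext (e.coe_fst' hx.1) ?_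
        rw [← fibreAff_apply F E e hx.1]
        simp
      rw [← h3]
      exact e.toOpenPartialHomeomorph.left_inv hs
    simp only
    rw [h2, fibreAff_apply F E e' hx.2]
  have : ∀ x, (LinearMap.toContinuousLinearMap
      ((hullFibre F E e' x).toLinearMap ∘ₗ (hullFibre F E e x).symm.toLinearMap)) y =
      (y.1, y.1 • fibreAff F E e' x ((fibreAff F E e x).symm 0) +
        (fibreAff F E e' x ((fibreAff F E e x).symm y.2) -
          fibreAff F E e' x ((fibreAff F E e x).symm 0))) :=
    fun x => hullCoord_comp_symm F _ _ y
  simp only [this]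
  exact continuousOn_const.prodMk
    (((hg 0).const_smul y.1).add ((hg y.2).sub (hg 0)))

/-- The vector hull is a vector bundle with model fibre `ℝ × F`, trivialized by the coordinates
that the trivializations of the affine bundle induce. -/
def hullPrebundle : VectorPrebundle ℝ (ℝ × F) (Hull F E) where
  pretrivializationAtlas := {q | ∃ (e : Trivialization F (π F E)) (_ : MemTrivializationAtlas e),
    q = hullPretriv F E e}
  pretrivialization_linear' := by
    rintro _ ⟨e, _, rfl⟩
    exact ⟨fun x _ => (hullFibre F E e x).toLinearMap.isLinear⟩
  pretrivializationAt x := hullPretriv F E (trivializationAt F E x)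
  mem_base_pretrivializationAt x := mem_baseSet_trivializationAt F E x
  pretrivialization_mem_atlas x := ⟨trivializationAt F E x, inferInstance, rfl⟩
  exists_coordChange := by
    rintro _ ⟨e, _, rfl⟩ _ ⟨e', _, rfl⟩
    refine ⟨_, continuousOn_hullChange F E e e', fun x hx y => ?_⟩
    rw [hullPretriv_symm F E e hx.1]
    rfl
  totalSpaceMk_isInducing x := by
    have h : Topology.IsInducing (hullFibre F E (trivializationAt F E x) x) := ⟨rfl⟩
    exact (Topology.isInducing_const_prod (x := x)).2 h

instance : TopologicalSpace (TotalSpace (ℝ × F) (Hull F E)) :=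
  (hullPrebundle F E).totalSpaceTopology

instance : FiberBundle (ℝ × F) (Hull F E) :=
  (hullPrebundle F E).toFiberBundle

instance : VectorBundle ℝ (ℝ × F) (Hull F E) :=
  (hullPrebundle F E).toVectorBundle

end AffineBundles

/-! ### Vector fields, bivector fields, Jacobi and Poisson structures -/

section Tensors

variable {EN : Type*} [NormedAddCommGroup EN] [NormedSpace ℝ EN]
  {HN : Type*} [TopologicalSpace HN] (I : ModelWithCorners ℝ EN HN)
  {N : Type*} [TopologicalSpace N] [ChartedSpace HN N]

/-- The cotangent space at `x` (the manifolds considered are finite dimensional). -/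
abbrev Cotangent (x : N) : Type _ := Dual ℝ (TangentSpace I x)

/-- The differential at `x` of a real function. -/
def dif (f : N → ℝ) (x : N) : Cotangent I x := (mvfderiv I f x).toLinearMap

/-- Bivectors at `x`: elements of `⋀² TₓN`, viewed as alternating bilinear forms on the cotangent
space. -/
abbrev Bivector (x : N) : Type _ := Cotangent I x [⋀^Fin 2]→ₗ[ℝ] ℝ

/-- The wedge product `u ∧ v`, with `(u ∧ v)(α, β) = α(u) β(v) - α(v) β(u)`. -/
def wedge {x : N} (u v : TangentSpace I x) : Bivector I x :=
  (Matrix.detRowAlternating (n := Fin 2) (R := ℝ)).compLinearMap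
    (LinearMap.pi ![Dual.eval ℝ (TangentSpace I x) u, Dual.eval ℝ (TangentSpace I x) v])

/-- `#Λ(α)`: the tangent vector such that `β(#Λ(α)) = Λ(α, β)` for all covectors `β`. -/
def sharp [FiniteDimensional ℝ EN] {x : N} (Λ : Bivector I x) (α : Cotangent I x) :
    TangentSpace I x :=
  haveI : FiniteDimensional ℝ (TangentSpace I x) := inferInstanceAs (FiniteDimensional ℝ EN)
  (evalEquiv ℝ (TangentSpace I x)).symm
    { toFun := fun β => Λ ![α, β]
      map_add' := fun β β' => by
        have hu : ∀ γ : Cotangent I x, Function.update ![α, 0] 1 γ = ![α, γ] := fun γ => by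
          ext i : 1
          fin_cases i <;> rfl
        have h := Λ.map_update_add ![α, 0] 1 β β'
        simp only [hu] at h
        exact h
      map_smul' := fun c β => by
        have hu : ∀ γ : Cotangent I x, Function.update ![α, 0] 1 γ = ![α, γ] := fun γ => by
          ext i : 1
          fin_cases i <;> rfl
        have h := Λ.map_update_smul ![α, 0] 1 c β
        simp only [hu] at h
        exact h }

variable {I} in
/-- `X(f)`, for a vector field `X` and a function `f`. -/
def lieFun (X : ∀ x : N, TangentSpace I x) (f : N → ℝ) : N → ℝ :=
  fun x => dif I f x (X x)

variable {I} in
/-- `Λ(df, dg)`, for a bivector field `Λ` and functions `f`, `g`. For a Poisson structure this is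
the Poisson bracket of `f` and `g`. -/
def pairing (Λ : ∀ x : N, Bivector I x) (f g : N → ℝ) : N → ℝ :=
  fun x => Λ x ![dif I f x, dif I g x]

variable {I} in
/-- The Lie derivative `[X, Λ] = £_X Λ` of a bivector field, evaluated on `(df, dg)`. -/
def lieBivector (X : ∀ x : N, TangentSpace I x) (Λ : ∀ x : N, Bivector I x) (f g : N → ℝ) :
    N → ℝ :=
  lieFun X (pairing Λ f g) - pairing Λ (lieFun X f) g - pairing Λ f (lieFun X g)

variable {I} in
/-- The Schouten bracket `[Λ, Λ']` of two bivector fields, evaluated on `(df, dg, dh)`, with the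
sign for which the Schouten bracket is a graded Lie bracket; in particular
`[Λ, Λ](df, dg, dh) = 2 (Λ(df, dΛ(dg, dh)) + cyclic permutations)`. -/
def schouten (Λ Λ' : ∀ x : N, Bivector I x) (f g h : N → ℝ) : N → ℝ :=
  pairing Λ f (pairing Λ' g h) + pairing Λ' f (pairing Λ g h) +
  (pairing Λ g (pairing Λ' h f) + pairing Λ' g (pairing Λ h f)) +
  (pairing Λ h (pairing Λ' f g) + pairing Λ' h (pairing Λ f g))

variable {I} in
/-- The trivector field `X ∧ Λ`, evaluated on `(df, dg, dh)`. -/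
def wedgeVB (X : ∀ x : N, TangentSpace I x) (Λ : ∀ x : N, Bivector I x) (f g h : N → ℝ) :
    N → ℝ :=
  lieFun X f * pairing Λ g h + lieFun X g * pairing Λ h f + lieFun X h * pairing Λ f g

/-- Smooth real functions. -/
abbrev SmoothFun (f : N → ℝ) : Prop := ContMDiff I 𝓘(ℝ, ℝ) ∞ f

/-- Smooth vector fields: those that map smooth functions to smooth functions. -/
def SmoothVectorField (X : ∀ x : N, TangentSpace I x) : Prop :=
  ∀ f, SmoothFun I f → SmoothFun I (lieFun X f)

/-- Smooth bivector fields: those that map differentials of smooth functions to smooth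
functions. -/
def SmoothBivectorField (Λ : ∀ x : N, Bivector I x) : Prop :=
  ∀ f g, SmoothFun I f → SmoothFun I g → SmoothFun I (pairing Λ f g)

variable (N)

/-- A Jacobi structure: a bivector field `Λ` and a vector field `E` with `[Λ, Λ] = -2 E ∧ Λ` and
`[E, Λ] = 0`. A trivector or bivector field is determined by its values on the differentials of
smooth functions. -/
@[ext]
structure JacobiStructure where
  Λ : ∀ x : N, Bivector I x
  E : ∀ x : N, TangentSpace I x
  smoothΛ : SmoothBivectorField I Λ
  smoothE : SmoothVectorField I E
  schouten_self : ∀ f g h : N → ℝ, SmoothFun I f → SmoothFun I g → SmoothFun I h →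
    schouten Λ Λ f g h = (-2 : ℝ) • wedgeVB E Λ f g h
  lie_E : ∀ f g : N → ℝ, SmoothFun I f → SmoothFun I g → lieBivector E Λ f g = 0

/-- A Poisson structure: a bivector field `Λ` with `[Λ, Λ] = 0`. -/
@[ext]
structure PoissonStructure where
  Λ : ∀ x : N, Bivector I x
  smoothΛ : SmoothBivectorField I Λ
  schouten_self : ∀ f g h : N → ℝ, SmoothFun I f → SmoothFun I g → SmoothFun I h →
    schouten Λ Λ f g h = 0

variable {I N}

/-- The Jacobi bracket `{f, g} = Λ(df, dg) + f E(g) - g E(f)`. -/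
def JacobiStructure.bracket (J : JacobiStructure I N) (f g : N → ℝ) : N → ℝ :=
  pairing J.Λ f g + f * lieFun J.E g - g * lieFun J.E f

/-- The Poisson bracket `{f, g} = Λ(df, dg)`. -/
def PoissonStructure.bracket (P : PoissonStructure I N) (f g : N → ℝ) : N → ℝ :=
  pairing P.Λ f g

/-- A bivector field `Λ` is homogeneous with respect to a vector field `X` if `£_X Λ = -Λ`. -/
def IsHomogeneous (X : ∀ x : N, TangentSpace I x) (Λ : ∀ x : N, Bivector I x) : Prop :=
  ∀ f g : N → ℝ, SmoothFun I f → SmoothFun I g → lieBivector X Λ f g = -pairing Λ f g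

variable {EN' : Type*} [NormedAddCommGroup EN'] [NormedSpace ℝ EN']
  {HN' : Type*} [TopologicalSpace HN'] {I' : ModelWithCorners ℝ EN' HN'}
  {N' : Type*} [TopologicalSpace N'] [ChartedSpace HN' N']

variable (I I') in
/-- The image of a bivector at `x` under the tangent map of `φ` at `x`. -/
def pushBivector (φ : N → N') (x : N) (Λ : Bivector I x) : Bivector I' (φ x) :=
  Λ.compLinearMap (mfderiv I I' φ x).toLinearMap.dualMap

/-- `J` and `K` are related by `φ`: the tangent map of `φ` sends the tensors of `J` at `x` to those
of `K` at `φ x`, for all `x`. When `φ` is the inclusion of a submanifold, this says that the tensors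
of `K` are tangent to the submanifold and that `J` is their restriction to it. -/
def IsRelated (φ : N → N') (J : JacobiStructure I N) (K : JacobiStructure I' N') : Prop :=
  ∀ x, K.E (φ x) = mfderiv I I' φ x (J.E x) ∧ K.Λ (φ x) = pushBivector I I' φ x (J.Λ x)

end Tensors

/-! ### Affine Jacobi structures and homogeneous Poisson structures -/

section Affine

variable {EM : Type*} [NormedAddCommGroup EM] [NormedSpace ℝ EM]
  {H : Type*} [TopologicalSpace H] (I : ModelWithCorners ℝ EM H)
  {M : Type*} [TopologicalSpace M] [ChartedSpace H M]
  (F : Type*) [NormedAddCommGroup F] [NormedSpace ℝ F]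
  {V : M → Type*} [∀ x, AddCommGroup (V x)] [∀ x, Module ℝ (V x)]
  (E : M → Type*) [∀ x, AddTorsor (V x) (E x)]
  [TopologicalSpace (TotalSpace F E)] [∀ x, TopologicalSpace (E x)] [FiberBundle F E]

/-- The (smooth) affine functions on an affine bundle, given by their restrictions to the
fibres. -/
structure AffineFunction where
  onFibre : ∀ x, E x →ᵃ[ℝ] ℝ
  smooth : SmoothFun (I.prod 𝓘(ℝ, F)) fun p : TotalSpace F E => onFibre p.1 p.2

variable {I F E}

/-- An affine function, as a function on the total space. -/
def AffineFunction.fn (a : AffineFunction I F E) (p : TotalSpace F E) : ℝ := a.onFibre p.1 p.2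

/-- The linear function on the vector hull that corresponds to an affine function. -/
def AffineFunction.bar (a : AffineFunction I F E) (ψ : TotalSpace (ℝ × F) (Hull F E)) : ℝ :=
  ψ.2.eval (a.onFibre ψ.1)

/-- A Jacobi structure is affine if the bracket of affine functions is an affine function. -/
def IsAffineJacobi (J : JacobiStructure (I.prod 𝓘(ℝ, F)) (TotalSpace F E)) : Prop :=
  ∀ a b : AffineFunction I F E, ∃ c : AffineFunction I F E, J.bracket a.fn b.fn = c.fn

variable (I F E) in
/-- The affine Jacobi structures on an affine bundle. -/
abbrev AffineJacobi : Type _ :=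
  {J : JacobiStructure (I.prod 𝓘(ℝ, F)) (TotalSpace F E) // IsAffineJacobi J}

variable (F E)

/-- The inclusion of an affine bundle into its vector hull: a point of the fibre is sent to the
evaluation of affine functions at it. -/
def inclHull (p : TotalSpace F E) : TotalSpace (ℝ × F) (Hull F E) :=
  ⟨p.1, show Dual ℝ (E p.1 →ᵃ[ℝ] ℝ) from
    { toFun := fun a => a p.2
      map_add' := fun _ _ => rfl
      map_smul' := fun _ _ => rfl }⟩

/-- The linear function on the vector hull that corresponds to the constant function `1`. -/
def iotaOne (ψ : TotalSpace (ℝ × F) (Hull F E)) : ℝ :=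
  ψ.2.eval (AffineMap.const ℝ (E ψ.1) 1)

variable [FiniteDimensional ℝ F] [IsAffineBundle F E]

variable (I) in
/-- The Liouville vector field of the vector hull, whose value at `ψ` is the velocity at `s = 1` of
the curve `s ↦ s • ψ`. -/
def liouville (ψ : TotalSpace (ℝ × F) (Hull F E)) : TangentSpace (I.prod 𝓘(ℝ, ℝ × F)) ψ :=
  mfderiv 𝓘(ℝ, ℝ) (I.prod 𝓘(ℝ, ℝ × F))
    (fun s : ℝ => (⟨ψ.1, s • ψ.2⟩ : TotalSpace (ℝ × F) (Hull F E))) 1 (1 : ℝ)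

variable (I) in
/-- The Poisson structures on the vector hull that are homogeneous with respect to the Liouville
vector field. -/
abbrev HomogeneousPoisson : Type _ :=
  {P : PoissonStructure (I.prod 𝓘(ℝ, ℝ × F)) (TotalSpace (ℝ × F) (Hull F E)) //
    IsHomogeneous (liouville I F E) P.Λ}

variable {F E}

variable [FiniteDimensional ℝ EM]

/-- The hamiltonian vector field of `iotaOne` with respect to a bivector field on the hull. -/
def hamOne (Λ : ∀ ψ : TotalSpace (ℝ × F) (Hull F E), Bivector (I.prod 𝓘(ℝ, ℝ × F)) ψ)
    (ψ : TotalSpace (ℝ × F) (Hull F E)) : TangentSpace (I.prod 𝓘(ℝ, ℝ × F)) ψ :=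
  sharp _ (Λ ψ) (dif _ (iotaOne F E) ψ)

end Affine

/-! ### Linear Poisson tensors on `M × (ℝ ∖ {0})` -/

section RankZero

/-- The open submanifold `ℝ ∖ {0}` of `ℝ`. -/
def NonzeroReal : TopologicalSpace.Opens ℝ := ⟨{0}ᶜ, isOpen_compl_singleton⟩

variable {EM : Type*} [NormedAddCommGroup EM] [NormedSpace ℝ EM]
  {H : Type*} [TopologicalSpace H] (I : ModelWithCorners ℝ EM H)
  {M : Type*} [TopologicalSpace M] [ChartedSpace H M]

/-- The coordinate `t` on `M × (ℝ ∖ {0})`. -/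
def tCoord (q : M × NonzeroReal) : ℝ := (q.2 : ℝ)

/-- The function `t f` on `M × (ℝ ∖ {0})`, for a function `f` on `M`. -/
def tMul (f : M → ℝ) (q : M × NonzeroReal) : ℝ := tCoord q * f q.1

/-- The vector field `∂/∂t` on `M × (ℝ ∖ {0})`. -/
def partialT (q : M × NonzeroReal) : TangentSpace (I.prod 𝓘(ℝ, ℝ)) q :=
  mfderiv 𝓘(ℝ, ℝ) (I.prod 𝓘(ℝ, ℝ)) (fun s : NonzeroReal => (q.1, s)) q.2 (1 : ℝ)

/-- A vector field on `M`, as a vector field on `M × (ℝ ∖ {0})`. -/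
def liftVectorField (X : ∀ x : M, TangentSpace I x) (q : M × NonzeroReal) :
    TangentSpace (I.prod 𝓘(ℝ, ℝ)) q :=
  mfderiv I (I.prod 𝓘(ℝ, ℝ)) (fun x : M => (x, q.2)) q.1 (X q.1)

/-- A bivector field on `M`, as a bivector field on `M × (ℝ ∖ {0})`. -/
def liftBivectorField (Λ : ∀ x : M, Bivector I x) (q : M × NonzeroReal) :
    Bivector (I.prod 𝓘(ℝ, ℝ)) q :=
  pushBivector I (I.prod 𝓘(ℝ, ℝ)) (fun x : M => (x, q.2)) q.1 (Λ q.1)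

variable {I} in
/-- A bivector field `P` on `M × (ℝ ∖ {0})` is linear (homogeneous) if, for all smooth functions
`f`, `g` on `M`, `P(d(tf), d(tg)) = t h` for a smooth function `h` on `M`. -/
def IsLinearBivector (P : ∀ q : M × NonzeroReal, Bivector (I.prod 𝓘(ℝ, ℝ)) q) : Prop :=
  ∀ f g : M → ℝ, SmoothFun I f → SmoothFun I g →
    ∃ h : M → ℝ, SmoothFun I h ∧ pairing P (tMul f) (tMul g) = tMul h

variable (M) in
/-- The linear Poisson tensors on `M × (ℝ ∖ {0})`. -/
abbrev LinearPoisson : Type _ :=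
  {P : PoissonStructure (I.prod 𝓘(ℝ, ℝ)) (M × NonzeroReal) // IsLinearBivector P.Λ}

end RankZero

end

/-!
Where `ι = iotaOne` does not vanish, that is on a dense open set of the hull, every covector is the
differential of a linear function `ā`. So a Poisson tensor there is determined by the brackets of
linear functions, and so is the validity of the Jacobi identity. If `Λ` is a homogeneous Poisson
tensor and `E` the hamiltonian vector field of `ι`, then `(Λ - Δ ∧ E, E)` is a Jacobi structure and
its bracket agrees with that of `Λ` on linear functions. Its tensors annihilate `ι` where `ι = 1`,
so they are tangent to `A` and restrict to an affine Jacobi structure.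

Conversely, an affine Jacobi structure `(Λ_A, E_A)` prescribes `t⁻¹ (Λ_A + Δ ∧ E_A)` on the image
of `A` under the homothety of ratio `t ≠ 0`. For this tensor, the bracket of `ā + f ∘ π` and
`b̄ + g ∘ π` is `c̄ + (ρ(a) g - ρ(b) f) ∘ π`, where `c = {a, b}` and the function
`ρ(a) f = Λ_A(da, df) + a E_A(f)` comes from the base. This expression is smooth across `ι = 0`, and
since the functions `ā + f ∘ π` contain coordinates, the tensor extends. The term `t⁻¹ Λ_A(df, dg)`
is missing because in positive rank the bracket of two functions on the base is zero; in rank zero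
it survives, and the hull has to be replaced by `M × (ℝ ∖ {0})`.
-/

noncomputable section

/-! ### Alternating bilinear forms -/

section AlternatingForms

variable {W W' : Type*} [AddCommGroup W] [Module ℝ W] [AddCommGroup W'] [Module ℝ W']

/-- An alternating form of degree two as a bilinear map. It makes the linearity of `Λ ![α, β]` in
each of the two arguments available to `map_add` and its companions. -/
def altBilin (Λ : W [⋀^Fin 2]→ₗ[ℝ] ℝ) : W →ₗ[ℝ] W →ₗ[ℝ] ℝ :=
  LinearMap.mk₂ ℝ (fun α β => Λ ![α, β])
    (fun α α' β => Λ.map_vecCons_add ![β] α α')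
    (fun c α β => Λ.map_vecCons_smul ![β] c α)
    (fun α β β' => (Λ.curryLeft α).map_vecCons_add ![] β β')
    (fun c α β => (Λ.curryLeft α).map_vecCons_smul ![] c β)

theorem altBilin_apply (Λ : W [⋀^Fin 2]→ₗ[ℝ] ℝ) (α β : W) : altBilin Λ α β = Λ ![α, β] := rfl

theorem altBilin_self (Λ : W [⋀^Fin 2]→ₗ[ℝ] ℝ) (α : W) : altBilin Λ α α = 0 :=
  Λ.map_eq_zero_of_eq ![α, α] (i := 0) (j := 1) rfl (by decide)

theorem altBilin_swap (Λ : W [⋀^Fin 2]→ₗ[ℝ] ℝ) (α β : W) :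
    altBilin Λ α β = -altBilin Λ β α :=
  (LinearMap.IsAlt.neg (B := altBilin Λ) (altBilin_self Λ) β α).symm

theorem altBilin_injective : Function.Injective (altBilin (W := W)) := by
  intro Λ Λ' h
  ext v
  have hv : v = ![v 0, v 1] := by
    ext i : 1
    fin_cases i <;> rfl
  rw [hv]
  exact LinearMap.congr_fun₂ h (v 0) (v 1)

theorem altBilin_compLinearMap (Λ : W [⋀^Fin 2]→ₗ[ℝ] ℝ) (L : W' →ₗ[ℝ] W) (α β : W') :
    altBilin (Λ.compLinearMap L) α β = altBilin Λ (L α) (L β) := by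
  rw [altBilin_apply, altBilin_apply, AlternatingMap.compLinearMap_apply]
  congr 1
  ext i : 1
  fin_cases i <;> rfl

end AlternatingForms

/-! ### Calculus with vector fields and bivector fields -/

section Calculus

variable {EN : Type*} [NormedAddCommGroup EN] [NormedSpace ℝ EN]
  {HN : Type*} [TopologicalSpace HN] {I : ModelWithCorners ℝ EN HN}
  {N : Type*} [TopologicalSpace N] [ChartedSpace HN N]

theorem altBilin_wedge {x : N} (u v : TangentSpace I x) (α β : Cotangent I x) :
    altBilin (wedge I u v) α β = α u * β v - α v * β u := by
  rw [altBilin_apply]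
  simp only [wedge, AlternatingMap.compLinearMap_apply]
  refine (Matrix.det_fin_two _).trans ?_
  simp

theorem apply_sharp [FiniteDimensional ℝ EN] {x : N} (Λ : Bivector I x) (α β : Cotangent I x) :
    β (sharp I Λ α) = altBilin Λ α β := by
  have : FiniteDimensional ℝ (TangentSpace I x) := inferInstanceAs (FiniteDimensional ℝ EN)
  exact apply_evalEquiv_symm_apply (R := ℝ) (M := TangentSpace I x) β _

theorem pairing_apply (Λ : ∀ x : N, Bivector I x) (f g : N → ℝ) (x : N) :
    pairing Λ f g x = altBilin (Λ x) (dif I f x) (dif I g x) := rfl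

theorem lieFun_apply (X : ∀ x : N, TangentSpace I x) (f : N → ℝ) (x : N) :
    lieFun X f x = dif I f x (X x) := rfl

theorem lieFun_sharp [FiniteDimensional ℝ EN] (Λ : ∀ x : N, Bivector I x) (f g : N → ℝ) :
    lieFun (fun x => sharp I (Λ x) (dif I f x)) g = pairing Λ f g := by
  ext x
  rw [lieFun_apply, apply_sharp, pairing_apply]

theorem pairing_swap (Λ : ∀ x : N, Bivector I x) (f g : N → ℝ) :
    pairing Λ f g = -pairing Λ g f := by
  ext x
  exact altBilin_swap _ _ _

theorem pairing_self (Λ : ∀ x : N, Bivector I x) (f : N → ℝ) : pairing Λ f f = 0 := by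
  ext x
  exact altBilin_self _ _

theorem SmoothFun.mdifferentiableAt {f : N → ℝ} (hf : SmoothFun I f) (x : N) :
    MDifferentiableAt I 𝓘(ℝ, ℝ) f x :=
  (hf x).mdifferentiableAt (by simp)

theorem dif_add {f g : N → ℝ} {x : N} (hf : MDifferentiableAt I 𝓘(ℝ, ℝ) f x)
    (hg : MDifferentiableAt I 𝓘(ℝ, ℝ) g x) : dif I (f + g) x = dif I f x + dif I g x := by
  rw [dif, mvfderiv_add hf hg]; rfl

theorem dif_sub {f g : N → ℝ} {x : N} (hf : MDifferentiableAt I 𝓘(ℝ, ℝ) f x)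
    (hg : MDifferentiableAt I 𝓘(ℝ, ℝ) g x) : dif I (f - g) x = dif I f x - dif I g x := by
  rw [dif, mvfderiv_sub hf hg]; rfl

theorem dif_neg_fun (f : N → ℝ) (x : N) : dif I (-f) x = -dif I f x := by
  rw [dif, mvfderiv_neg]; rfl

theorem dif_mul {f g : N → ℝ} {x : N} (hf : MDifferentiableAt I 𝓘(ℝ, ℝ) f x)
    (hg : MDifferentiableAt I 𝓘(ℝ, ℝ) g x) :
    dif I (f * g) x = f x • dif I g x + g x • dif I f x := by
  rw [dif, mvfderiv_mul hf hg]; rfl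

theorem dif_const (c : ℝ) (x : N) : dif I (fun _ : N => c) x = 0 := by
  rw [dif, mvfderiv_const]; rfl

theorem dif_smul (c : ℝ) {f : N → ℝ} {x : N} (hf : MDifferentiableAt I 𝓘(ℝ, ℝ) f x) :
    dif I (c • f) x = c • dif I f x := by
  have h := dif_mul (I := I) (f := fun _ => c) mdifferentiableAt_const hf
  rw [dif_const, smul_zero, add_zero] at h
  exact h

theorem dif_congr {f g : N → ℝ} {x : N} (h : f =ᶠ[𝓝 x] g) : dif I f x = dif I g x := by
  ext v
  simp only [dif, mvfderiv, h.mfderiv_eq]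
  rfl

variable {EN' : Type*} [NormedAddCommGroup EN'] [NormedSpace ℝ EN']
  {HN' : Type*} [TopologicalSpace HN'] {I' : ModelWithCorners ℝ EN' HN'}
  {N' : Type*} [TopologicalSpace N'] [ChartedSpace HN' N']

theorem dif_comp {φ : N → N'} {f : N' → ℝ} {x : N} (hf : MDifferentiableAt I' 𝓘(ℝ, ℝ) f (φ x))
    (hφ : MDifferentiableAt I I' φ x) :
    dif I (f ∘ φ) x = (dif I' f (φ x)).comp (mfderiv I I' φ x).toLinearMap := by
  rw [dif, mvfderiv_comp x hf hφ]; rfl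

theorem dif_comp_apply {φ : N → N'} {f : N' → ℝ} {x : N}
    (hf : MDifferentiableAt I' 𝓘(ℝ, ℝ) f (φ x)) (hφ : MDifferentiableAt I I' φ x)
    (v : TangentSpace I x) : dif I (f ∘ φ) x v = dif I' f (φ x) (mfderiv I I' φ x v) := by
  rw [dif_comp hf hφ]; rfl

section Leibniz

variable (X : ∀ x : N, TangentSpace I x) (Λ : ∀ x : N, Bivector I x) {f g h : N → ℝ}

theorem lieFun_add (hf : SmoothFun I f) (hg : SmoothFun I g) :
    lieFun X (f + g) = lieFun X f + lieFun X g := by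
  ext x
  simp only [Pi.add_apply, lieFun_apply, dif_add (hf.mdifferentiableAt x) (hg.mdifferentiableAt x),
    LinearMap.add_apply]

theorem lieFun_sub (hf : SmoothFun I f) (hg : SmoothFun I g) :
    lieFun X (f - g) = lieFun X f - lieFun X g := by
  ext x
  simp only [Pi.sub_apply, lieFun_apply, dif_sub (hf.mdifferentiableAt x) (hg.mdifferentiableAt x),
    LinearMap.sub_apply]

theorem lieFun_neg (f : N → ℝ) : lieFun X (-f) = -lieFun X f := by
  ext x
  simp only [Pi.neg_apply, lieFun_apply, dif_neg_fun, LinearMap.neg_apply]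

theorem lieFun_mul (hf : SmoothFun I f) (hg : SmoothFun I g) :
    lieFun X (f * g) = f * lieFun X g + g * lieFun X f := by
  ext x
  simp only [Pi.add_apply, Pi.mul_apply, lieFun_apply,
    dif_mul (hf.mdifferentiableAt x) (hg.mdifferentiableAt x),
    LinearMap.add_apply, LinearMap.smul_apply, smul_eq_mul]

theorem lieFun_const (c : ℝ) : lieFun X (fun _ => c) = 0 := by
  ext x
  rw [lieFun_apply, dif_const]; rfl

theorem pairing_add_right (f : N → ℝ) (hg : SmoothFun I g) (hh : SmoothFun I h) :
    pairing Λ f (g + h) = pairing Λ f g + pairing Λ f h := by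
  ext x
  simp only [Pi.add_apply, pairing_apply,
    dif_add (hg.mdifferentiableAt x) (hh.mdifferentiableAt x), map_add]

theorem pairing_sub_right (f : N → ℝ) (hg : SmoothFun I g) (hh : SmoothFun I h) :
    pairing Λ f (g - h) = pairing Λ f g - pairing Λ f h := by
  ext x
  simp only [Pi.sub_apply, pairing_apply,
    dif_sub (hg.mdifferentiableAt x) (hh.mdifferentiableAt x), map_sub]

theorem pairing_neg_right (f g : N → ℝ) : pairing Λ f (-g) = -pairing Λ f g := by
  ext x
  simp only [Pi.neg_apply, pairing_apply, dif_neg_fun, map_neg]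

theorem pairing_mul_right (f : N → ℝ) (hg : SmoothFun I g) (hh : SmoothFun I h) :
    pairing Λ f (g * h) = g * pairing Λ f h + h * pairing Λ f g := by
  ext x
  simp only [Pi.add_apply, Pi.mul_apply, pairing_apply,
    dif_mul (hg.mdifferentiableAt x) (hh.mdifferentiableAt x), map_add, map_smul, smul_eq_mul]

theorem pairing_mul_left (hf : SmoothFun I f) (hg : SmoothFun I g) (h : N → ℝ) :
    pairing Λ (f * g) h = f * pairing Λ g h + g * pairing Λ f h := by
  rw [pairing_swap, pairing_mul_right Λ h hf hg, pairing_swap Λ h f, pairing_swap Λ h g]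
  ring

theorem pairing_const_right (f : N → ℝ) (c : ℝ) : pairing Λ f (fun _ => c) = 0 := by
  ext x
  rw [pairing_apply, dif_const, map_zero]; rfl

end Leibniz

theorem schouten_self_eq (Λ : ∀ x : N, Bivector I x) (f g h : N → ℝ) :
    schouten Λ Λ f g h = (2 : ℝ) • (pairing Λ f (pairing Λ g h) + pairing Λ g (pairing Λ h f) +
      pairing Λ h (pairing Λ f g)) := by
  ext x
  simp only [schouten, Pi.add_apply, Pi.smul_apply, smul_eq_mul]
  ring

end Calculus

/-! ### Jacobi and Poisson brackets -/

section Brackets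

variable {EN : Type*} [NormedAddCommGroup EN] [NormedSpace ℝ EN]
  {HN : Type*} [TopologicalSpace HN] {I : ModelWithCorners ℝ EN HN}
  {N : Type*} [TopologicalSpace N] [ChartedSpace HN N]

namespace JacobiStructure

variable (J : JacobiStructure I N) {f g h : N → ℝ}

theorem bracket_eq (f g : N → ℝ) :
    J.bracket f g = pairing J.Λ f g + f * lieFun J.E g - g * lieFun J.E f := rfl

theorem smooth_bracket (hf : SmoothFun I f) (hg : SmoothFun I g) : SmoothFun I (J.bracket f g) :=
  ((J.smoothΛ f g hf hg).add (hf.mul (J.smoothE g hg))).sub (hg.mul (J.smoothE f hf))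

theorem cyclic_pairing (hf : SmoothFun I f) (hg : SmoothFun I g) (hh : SmoothFun I h) :
    pairing J.Λ f (pairing J.Λ g h) + pairing J.Λ g (pairing J.Λ h f) +
      pairing J.Λ h (pairing J.Λ f g) = -wedgeVB J.E J.Λ f g h := by
  have key := J.schouten_self f g h hf hg hh
  rw [schouten_self_eq, neg_smul, ← smul_neg] at key
  exact smul_right_injective _ two_ne_zero key

theorem pairing_bracket (f : N → ℝ) (hg : SmoothFun I g) (hh : SmoothFun I h) :
    pairing J.Λ f (J.bracket g h) = pairing J.Λ f (pairing J.Λ g h) +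
      (g * pairing J.Λ f (lieFun J.E h) + lieFun J.E h * pairing J.Λ f g) -
      (h * pairing J.Λ f (lieFun J.E g) + lieFun J.E g * pairing J.Λ f h) := by
  have hgh := J.smoothΛ g h hg hh
  have hEg := J.smoothE g hg
  have hEh := J.smoothE h hh
  rw [bracket, pairing_sub_right _ _ (hgh.add (hg.mul hEh)) (hh.mul hEg),
    pairing_add_right _ _ hgh (hg.mul hEh), pairing_mul_right _ _ hg hEh,
    pairing_mul_right _ _ hh hEg]

theorem lieFun_bracket (hg : SmoothFun I g) (hh : SmoothFun I h) :
    lieFun J.E (J.bracket g h) = J.bracket (lieFun J.E g) h + J.bracket g (lieFun J.E h) := by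
  have hgh := J.smoothΛ g h hg hh
  have hEg := J.smoothE g hg
  have hEh := J.smoothE h hh
  have hE := J.lie_E g h hg hh
  rw [lieBivector] at hE
  simp only [bracket]
  rw [lieFun_sub _ (hgh.add (hg.mul hEh)) (hh.mul hEg), lieFun_add _ hgh (hg.mul hEh),
    lieFun_mul _ hg hEh, lieFun_mul _ hh hEg]
  linear_combination hE

theorem jacobi (hf : SmoothFun I f) (hg : SmoothFun I g) (hh : SmoothFun I h) :
    J.bracket f (J.bracket g h) + J.bracket g (J.bracket h f) + J.bracket h (J.bracket f g) =
      0 := by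
  have h_cyclic := J.cyclic_pairing hf hg hh
  rw [J.bracket_eq f, J.pairing_bracket f hg hh, J.lieFun_bracket hg hh,
    J.bracket_eq g (J.bracket _ _), J.pairing_bracket g hh hf, J.lieFun_bracket hh hf,
    J.bracket_eq h (J.bracket _ _), J.pairing_bracket h hf hg, J.lieFun_bracket hf hg]
  simp only [bracket, wedgeVB, pairing_swap J.Λ (lieFun J.E _)] at h_cyclic ⊢
  rw [pairing_swap J.Λ g f, pairing_swap J.Λ h g, pairing_swap J.Λ f h] at *
  linear_combination h_cyclic

end JacobiStructure

theorem PoissonStructure.jacobi (P : PoissonStructure I N) {f g h : N → ℝ}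
    (hf : SmoothFun I f) (hg : SmoothFun I g) (hh : SmoothFun I h) :
    pairing P.Λ f (pairing P.Λ g h) + pairing P.Λ g (pairing P.Λ h f) +
      pairing P.Λ h (pairing P.Λ f g) = 0 := by
  have key := P.schouten_self f g h hf hg hh
  rw [schouten_self_eq] at key
  exact (smul_eq_zero.1 key).resolve_left two_ne_zero

theorem PoissonStructure.pairing_pairing_left (P : PoissonStructure I N) {f g h : N → ℝ}
    (hf : SmoothFun I f) (hg : SmoothFun I g) (hh : SmoothFun I h) :
    pairing P.Λ f (pairing P.Λ g h) =
      pairing P.Λ (pairing P.Λ f g) h + pairing P.Λ g (pairing P.Λ f h) := by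
  have hJ := P.jacobi hf hg hh
  rw [pairing_swap P.Λ h f, pairing_swap P.Λ h (pairing P.Λ f g), pairing_neg_right] at hJ
  linear_combination hJ

end Brackets

/-! ### The Jacobi structure of a homogeneous Poisson structure -/

section HomogeneousPoissonJacobi

variable {EN : Type*} [NormedAddCommGroup EN] [NormedSpace ℝ EN]
  {HN : Type*} [TopologicalSpace HN] {I : ModelWithCorners ℝ EN HN}
  {N : Type*} [TopologicalSpace N] [ChartedSpace HN N]
  {X Y Z : ∀ x : N, TangentSpace I x} {Λ Λ' : ∀ x : N, Bivector I x} {f g h ι : N → ℝ}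

theorem pairing_sub (Λ Λ' : ∀ x : N, Bivector I x) (f g : N → ℝ) :
    pairing (fun x => Λ x - Λ' x) f g = pairing Λ f g - pairing Λ' f g := rfl

theorem pairing_wedge (X Y : ∀ x : N, TangentSpace I x) (f g : N → ℝ) :
    pairing (fun x => wedge I (X x) (Y x)) f g =
      lieFun X f * lieFun Y g - lieFun Y f * lieFun X g := by
  ext x
  exact altBilin_wedge (X x) (Y x) _ _

theorem SmoothBivectorField.wedge (hX : SmoothVectorField I X) (hY : SmoothVectorField I Y) :
    SmoothBivectorField I fun x => _root_.wedge I (X x) (Y x) := fun f g hf hg => by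
  rw [pairing_wedge]
  exact ((hX f hf).mul (hY g hg)).sub ((hY f hf).mul (hX g hg))

theorem SmoothBivectorField.sub (hΛ : SmoothBivectorField I Λ) (hΛ' : SmoothBivectorField I Λ') :
    SmoothBivectorField I fun x => Λ x - Λ' x :=
  fun f g hf hg => (hΛ f g hf hg).sub (hΛ' f g hf hg)

theorem lieBivector_sub (X : ∀ x : N, TangentSpace I x) (hΛ : SmoothBivectorField I Λ)
    (hΛ' : SmoothBivectorField I Λ') (hf : SmoothFun I f) (hg : SmoothFun I g) :
    lieBivector X (fun x => Λ x - Λ' x) f g = lieBivector X Λ f g - lieBivector X Λ' f g := by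
  simp only [lieBivector, pairing_sub, lieFun_sub X (hΛ f g hf hg) (hΛ' f g hf hg)]
  ring

theorem lieBivector_wedge_eq_zero (hY : SmoothVectorField I Y) (hZ : SmoothVectorField I Z)
    (hXY : ∀ f, SmoothFun I f → lieFun X (lieFun Y f) = lieFun Y (lieFun X f))
    (hXZ : ∀ f, SmoothFun I f → lieFun X (lieFun Z f) = lieFun Z (lieFun X f))
    (hf : SmoothFun I f) (hg : SmoothFun I g) :
    lieBivector X (fun x => wedge I (Y x) (Z x)) f g = 0 := by
  simp only [lieBivector, pairing_wedge]
  rw [lieFun_sub X ((hY f hf).mul (hZ g hg)) ((hZ f hf).mul (hY g hg)),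
    lieFun_mul X (hY f hf) (hZ g hg), lieFun_mul X (hZ f hf) (hY g hg),
    hXY f hf, hXY g hg, hXZ f hf, hXZ g hg]
  ring

theorem schouten_sub_self (hΛ : SmoothBivectorField I Λ) (hΛ' : SmoothBivectorField I Λ')
    (hf : SmoothFun I f) (hg : SmoothFun I g) (hh : SmoothFun I h) :
    schouten (fun x => Λ x - Λ' x) (fun x => Λ x - Λ' x) f g h =
      schouten Λ Λ f g h - (2 : ℝ) • schouten Λ Λ' f g h + schouten Λ' Λ' f g h := by
  have expand : ∀ {f g h}, SmoothFun I g → SmoothFun I h →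
      pairing (fun x => Λ x - Λ' x) f (pairing (fun x => Λ x - Λ' x) g h) =
        pairing Λ f (pairing Λ g h) - pairing Λ f (pairing Λ' g h) -
          (pairing Λ' f (pairing Λ g h) - pairing Λ' f (pairing Λ' g h)) :=
    fun {f g h} hg hh => by
      rw [pairing_sub, pairing_sub, pairing_sub_right Λ f (hΛ g h hg hh) (hΛ' g h hg hh),
        pairing_sub_right Λ' f (hΛ g h hg hh) (hΛ' g h hg hh)]
  simp only [schouten, expand hg hh, expand hh hf, expand hf hg, two_smul]
  ring

theorem schouten_wedge (Λ : ∀ x : N, Bivector I x) (hX : SmoothVectorField I X)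
    (hY : SmoothVectorField I Y) (hf : SmoothFun I f) (hg : SmoothFun I g) (hh : SmoothFun I h) :
    schouten Λ (fun x => wedge I (X x) (Y x)) f g h =
      lieFun X f * lieBivector Y Λ g h + lieFun X g * lieBivector Y Λ h f +
        lieFun X h * lieBivector Y Λ f g -
      (lieFun Y f * lieBivector X Λ g h + lieFun Y g * lieBivector X Λ h f +
        lieFun Y h * lieBivector X Λ f g) := by
  have expand : ∀ {f g h}, SmoothFun I g → SmoothFun I h →
      pairing Λ f (lieFun X g * lieFun Y h - lieFun Y g * lieFun X h) =
        lieFun X g * pairing Λ f (lieFun Y h) + lieFun Y h * pairing Λ f (lieFun X g) -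
          (lieFun Y g * pairing Λ f (lieFun X h) + lieFun X h * pairing Λ f (lieFun Y g)) :=
    fun {f g h} hg hh => by
      rw [pairing_sub_right Λ f ((hX g hg).mul (hY h hh)) ((hY g hg).mul (hX h hh)),
        pairing_mul_right Λ f (hX g hg) (hY h hh), pairing_mul_right Λ f (hY g hg) (hX h hh)]
  simp only [schouten, pairing_wedge, expand hg hh, expand hh hf, expand hf hg, lieBivector,
    pairing_swap Λ (lieFun X _), pairing_swap Λ (lieFun Y _)]
  ring

theorem schouten_wedge_self_eq_zero (hX : SmoothVectorField I X) (hY : SmoothVectorField I Y)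
    (hXY : ∀ f, SmoothFun I f → lieFun X (lieFun Y f) = lieFun Y (lieFun X f))
    (hf : SmoothFun I f) (hg : SmoothFun I g) (hh : SmoothFun I h) :
    schouten (fun x => wedge I (X x) (Y x)) (fun x => wedge I (X x) (Y x)) f g h = 0 := by
  have lieX : ∀ {f g}, SmoothFun I f → SmoothFun I g →
      lieBivector X (fun x => wedge I (X x) (Y x)) f g = 0 :=
    lieBivector_wedge_eq_zero hX hY (fun _ _ => rfl) hXY
  have lieY : ∀ {f g}, SmoothFun I f → SmoothFun I g →
      lieBivector Y (fun x => wedge I (X x) (Y x)) f g = 0 :=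
    lieBivector_wedge_eq_zero hX hY (fun f hf => (hXY f hf).symm) (fun _ _ => rfl)
  rw [schouten_wedge _ hX hY hf hg hh]
  simp only [lieX hg hh, lieX hh hf, lieX hf hg, lieY hg hh, lieY hh hf, lieY hf hg, mul_zero,
    add_zero, sub_zero]

theorem lieFun_pairing_of_isHomogeneous (hΛ : IsHomogeneous X Λ) (hι : SmoothFun I ι)
    (hXι : lieFun X ι = ι) (hf : SmoothFun I f) :
    lieFun X (pairing Λ ι f) = pairing Λ ι (lieFun X f) := by
  have h := hΛ ι f hι hf
  rw [lieBivector, hXι] at h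
  linear_combination h

theorem schouten_sub_wedge_self (P : PoissonStructure I N) (hX : SmoothVectorField I X)
    (hY : SmoothVectorField I Y) (hXP : IsHomogeneous X P.Λ)
    (hYP : ∀ f g, SmoothFun I f → SmoothFun I g → lieBivector Y P.Λ f g = 0)
    (hXY : ∀ f, SmoothFun I f → lieFun X (lieFun Y f) = lieFun Y (lieFun X f))
    (hf : SmoothFun I f) (hg : SmoothFun I g) (hh : SmoothFun I h) :
    schouten (fun x => P.Λ x - wedge I (X x) (Y x)) (fun x => P.Λ x - wedge I (X x) (Y x)) f g h =
      (-2 : ℝ) • wedgeVB Y (fun x => P.Λ x - wedge I (X x) (Y x)) f g h := by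
  rw [schouten_sub_self P.smoothΛ (.wedge hX hY) hf hg hh, P.schouten_self f g h hf hg hh,
    schouten_wedge P.Λ hX hY hf hg hh, schouten_wedge_self_eq_zero hX hY hXY hf hg hh,
    hYP f g hf hg, hYP g h hg hh, hYP h f hh hf, hXP f g hf hg, hXP g h hg hh, hXP h f hh hf]
  simp only [wedgeVB, pairing_sub, pairing_wedge, neg_smul, two_smul]
  ring

variable [FiniteDimensional ℝ EN]

/-- If `Λ` is a Poisson structure, homogeneous with respect to `X`, and `E` is the hamiltonian
vector field of a function `ι` with `X(ι) = ι`, then `(Λ - X ∧ E, E)` is a Jacobi structure. -/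
def PoissonStructure.toJacobi (P : PoissonStructure I N) (X : ∀ x : N, TangentSpace I x)
    (hX : SmoothVectorField I X) (hP : IsHomogeneous X P.Λ) (ι : N → ℝ) (hι : SmoothFun I ι)
    (hXι : lieFun X ι = ι) : JacobiStructure I N :=
  have hE : SmoothVectorField I fun x => sharp I (P.Λ x) (dif I ι x) := fun f hf => by
    rw [lieFun_sharp]
    exact P.smoothΛ ι f hι hf
  have hXE : ∀ f, SmoothFun I f →
      lieFun X (lieFun (fun x => sharp I (P.Λ x) (dif I ι x)) f) =
        lieFun (fun x => sharp I (P.Λ x) (dif I ι x)) (lieFun X f) := fun f hf => by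
    simp only [lieFun_sharp]
    exact lieFun_pairing_of_isHomogeneous hP hι hXι hf
  have hEP : ∀ f g, SmoothFun I f → SmoothFun I g →
      lieBivector (fun x => sharp I (P.Λ x) (dif I ι x)) P.Λ f g = 0 := fun f g hf hg => by
    rw [lieBivector, lieFun_sharp, lieFun_sharp, lieFun_sharp,
      P.pairing_pairing_left hι hf hg]
    ring
  { Λ := fun x => P.Λ x - wedge I (X x) (sharp I (P.Λ x) (dif I ι x))
    E := fun x => sharp I (P.Λ x) (dif I ι x)
    smoothΛ := .sub P.smoothΛ (.wedge hX hE)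
    smoothE := hE
    schouten_self := fun _ _ _ => schouten_sub_wedge_self P hX hE hP hEP hXE
    lie_E := fun f g hf hg => by
      rw [lieBivector_sub _ P.smoothΛ (.wedge hX hE) hf hg, hEP f g hf hg,
        lieBivector_wedge_eq_zero hX hE (fun f hf => (hXE f hf).symm) (fun _ _ => rfl) hf hg,
        sub_zero] }

end HomogeneousPoissonJacobi

/-! ### Coordinate functions and tensoriality -/

section Coordinates

variable {EN : Type*} [NormedAddCommGroup EN] [NormedSpace ℝ EN]
  {HN : Type*} [TopologicalSpace HN] {I : ModelWithCorners ℝ EN HN}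
  {N : Type*} [TopologicalSpace N] [ChartedSpace HN N]

variable (I) in
/-- A set of smooth functions contains coordinates if, near every point, every linear coordinate
of the preferred chart agrees with a function of the set. It is enough to know a tensor field on
the differentials of the functions of such a set. -/
structure ContainsCoordinates (S : Set (N → ℝ)) : Prop where
  smooth : ∀ f ∈ S, SmoothFun I f
  exists_coord : ∀ (p : N) (c : Dual ℝ EN), ∃ g ∈ S, g =ᶠ[𝓝 p] fun q => c (extChartAt I p q)

theorem ContainsCoordinates.mono {S T : Set (N → ℝ)} (hS : ContainsCoordinates I S)
    (hST : S ⊆ T) (hT : ∀ f ∈ T, SmoothFun I f) : ContainsCoordinates I T :=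
  ⟨hT, fun p c => let ⟨g, hg, h⟩ := hS.exists_coord p c; ⟨g, hST hg, h⟩⟩

theorem SmoothBivectorField.smooth_hamiltonian [FiniteDimensional ℝ EN] {Λ : ∀ x : N, Bivector I x}
    (hΛ : SmoothBivectorField I Λ) {f : N → ℝ} (hf : SmoothFun I f) :
    SmoothVectorField I (fun x => sharp I (Λ x) (dif I f x)) :=
  fun g hg => by
    rw [lieFun_sharp]
    exact hΛ f g hf hg

theorem mfderiv_of_eventuallyEq_extChartAt [I.Boundaryless] {p : N} {φ : N → EN}
    (hφ : MDifferentiableAt I 𝓘(ℝ, EN) φ p) (hφp : φ =ᶠ[𝓝 p] extChartAt I p) :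
    mfderiv I 𝓘(ℝ, EN) φ p = ContinuousLinearMap.id ℝ EN := by
  have h_written : writtenInExtChartAt I 𝓘(ℝ, EN) p φ =ᶠ[𝓝 (extChartAt I p p)] id := by
    have h_symm := (continuousAt_extChartAt_symm (I := I) p).tendsto
    rw [extChartAt_to_inv] at h_symm
    filter_upwards [h_symm.eventually hφp, extChartAt_target_mem_nhds (I := I) p] with y hy hy'
    exact hy.trans ((extChartAt I p).right_inv hy')
  rw [hφ.mfderiv, I.range_eq_univ, fderivWithin_univ, h_written.fderiv_eq, fderiv_id]

theorem dif_eventuallyEq_fderiv_comp_mfderiv [I.Boundaryless] {p : N} {φ : N → EN}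
    (hφ : ContMDiff I 𝓘(ℝ, EN) ∞ φ) (hφp : φ =ᶠ[𝓝 p] extChartAt I p) {f : N → ℝ}
    (hf : SmoothFun I f) :
    ∃ H : EN → ℝ, ContDiffAt ℝ ∞ H (φ p) ∧ ∀ᶠ q in 𝓝 p, ∀ v : TangentSpace I q,
      dif I f q v = fderiv ℝ H (φ q) (mfderiv I 𝓘(ℝ, EN) φ q v) := by
  have hH : ContDiffAt ℝ ∞ (f ∘ (extChartAt I p).symm) (φ p) := by
    have h := (contMDiffAt_iff.1 (hf p)).2
    rw [I.range_eq_univ, ← hφp.eq_of_nhds] at h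
    exact contDiffWithinAt_univ.1 h
  have hfφ : f =ᶠ[𝓝 p] (f ∘ (extChartAt I p).symm) ∘ φ := by
    filter_upwards [hφp, extChartAt_source_mem_nhds (I := I) p] with q hq hq'
    simp only [Function.comp_apply, hq, (extChartAt I p).left_inv hq']
  have hH_diff : ∀ᶠ y in 𝓝 (φ p), DifferentiableAt ℝ (f ∘ (extChartAt I p).symm) y := by
    filter_upwards [(hH.of_le (m := 1) (by simp)).eventually (by simp)] with y hy
    exact hy.differentiableAt (by simp)
  refine ⟨_, hH, ?_⟩
  filter_upwards [hfφ.eventuallyEq_nhds, (hφ p).continuousAt.eventually hH_diff] with q hq hq' v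
  rw [dif_congr hq, dif_comp_apply hq'.mdifferentiableAt ((hφ q).mdifferentiableAt (by simp))]
  simp only [dif, mvfderiv, mfderiv_eq_fderiv]
  rfl

theorem schouten_self_cyclic (Λ : ∀ x : N, Bivector I x) (f g h : N → ℝ) :
    schouten Λ Λ f g h = schouten Λ Λ g h f := by
  rw [schouten_self_eq, schouten_self_eq]
  congr 1
  ring

theorem wedgeVB_congr {X : ∀ x : N, TangentSpace I x} {Λ : ∀ x : N, Bivector I x}
    {f f' g g' h h' : N → ℝ} {p : N} (hf : dif I f p = dif I f' p) (hg : dif I g p = dif I g' p)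
    (hh : dif I h p = dif I h' p) : wedgeVB X Λ f g h p = wedgeVB X Λ f' g' h' p := by
  simp only [wedgeVB, Pi.add_apply, Pi.mul_apply, lieFun_apply, pairing_apply, hf, hg, hh]

theorem lieBivector_swap {X : ∀ x : N, TangentSpace I x} {Λ : ∀ x : N, Bivector I x}
    (f g : N → ℝ) : lieBivector X Λ f g = -lieBivector X Λ g f := by
  simp only [lieBivector, pairing_swap Λ f, pairing_swap Λ (lieFun X f), lieFun_neg]
  ring

variable [FiniteDimensional ℝ EN] {S : Set (N → ℝ)}

theorem ContainsCoordinates.exists_smooth_chart (hS : ContainsCoordinates I S) (p : N) :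
    ∃ φ : N → EN, ContMDiff I 𝓘(ℝ, EN) ∞ φ ∧ φ =ᶠ[𝓝 p] extChartAt I p ∧
      ∀ i, (finBasis ℝ EN).coord i ∘ φ ∈ S := by
  choose x hxS hx using fun i => hS.exists_coord p ((finBasis ℝ EN).coord i)
  refine ⟨fun q => ∑ i, x i q • finBasis ℝ EN i,
    contMDiff_finsetSum fun i _ => (hS.smooth _ (hxS i)).smul contMDiff_const, ?_, fun i => ?_⟩
  · filter_upwards [Filter.eventually_all.2 hx] with q hq
    simp only [hq, Basis.coord_apply, Basis.sum_repr]
  · convert hxS i using 1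
    ext q
    simp [Finsupp.single_apply]

theorem dif_dual_comp {φ : N → EN} {q : N} (hφ : MDifferentiableAt I 𝓘(ℝ, EN) φ q) (c : Dual ℝ EN)
    (v : TangentSpace I q) : dif I (c ∘ φ) q v = c (mfderiv I 𝓘(ℝ, EN) φ q v) := by
  have hc : DifferentiableAt ℝ c (φ q) := c.toContinuousLinearMap.differentiableAt
  have hdc : fderiv ℝ c (φ q) = c.toContinuousLinearMap := c.toContinuousLinearMap.fderiv
  rw [dif_comp_apply hc.mdifferentiableAt hφ]
  simp only [dif, mvfderiv, mfderiv_eq_fderiv, hdc]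
  rfl

omit [FiniteDimensional ℝ EN] in
theorem dif_clm_apply_of_eq_zero {φ B : N → EN} {p : N} {G : EN → EN →L[ℝ] ℝ}
    (hG : DifferentiableAt ℝ G (φ p)) (hφ : MDifferentiableAt I 𝓘(ℝ, EN) φ p)
    (hB : MDifferentiableAt I 𝓘(ℝ, EN) B p) (hGp : G (φ p) = 0) (v : TangentSpace I p) :
    dif I (fun q => G (φ q) (B q)) p v =
      fderiv ℝ G (φ p) (mfderiv I 𝓘(ℝ, EN) φ p v) (B p) := by
  have hG' : HasFDerivAt (fun y : EN × EN => G y.1)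
      ((fderiv ℝ G (φ p)).comp (.fst ℝ EN EN)) (φ p, B p) :=
    HasFDerivAt.comp (φ p, B p) hG.hasFDerivAt hasFDerivAt_fst
  have hGB : HasFDerivAt (fun y : EN × EN => G y.1 y.2)
      (((fderiv ℝ G (φ p)).comp (.fst ℝ EN EN)).flip (B p)) (φ p, B p) := by
    have h := hG'.clm_apply (hasFDerivAt_snd (p := (φ p, B p)))
    simpa only [hGp, ContinuousLinearMap.zero_comp, zero_add] using h
  have h := HasMFDerivAt.comp (I' := 𝓘(ℝ, EN × EN)) (I'' := 𝓘(ℝ, ℝ)) p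
    (f := fun q => (φ q, B q)) hGB.hasMFDerivAt
    ⟨hφ.continuousAt.prodMk hB.continuousAt, hφ.hasMFDerivAt.2.prodMk hB.hasMFDerivAt.2⟩
  exact congrArg (fun L : EN →L[ℝ] ℝ => L v) h.mfderiv

theorem contMDiff_mfderiv_apply {φ : N → EN} (hφ : ContMDiff I 𝓘(ℝ, EN) ∞ φ)
    {X : ∀ x : N, TangentSpace I x}
    (hX : ∀ i, SmoothFun I (lieFun X ((finBasis ℝ EN).coord i ∘ φ))) :
    ContMDiff I 𝓘(ℝ, EN) ∞ fun q => (mfderiv I 𝓘(ℝ, EN) φ q (X q) : EN) := by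
  have h : ∀ q, (mfderiv I 𝓘(ℝ, EN) φ q (X q) : EN) =
      ∑ i, lieFun X ((finBasis ℝ EN).coord i ∘ φ) q • finBasis ℝ EN i := fun q => by
    simp only [lieFun_apply, dif_dual_comp ((hφ q).mdifferentiableAt (by simp))]
    exact ((finBasis ℝ EN).sum_repr _).symm
  simp only [h]
  exact contMDiff_finsetSum fun i _ => (hX i).smul contMDiff_const

variable [I.Boundaryless]

theorem ContainsCoordinates.dif_eq (hS : ContainsCoordinates I S) {p : N} {g : N → ℝ}
    {c : Dual ℝ EN} (hg : g =ᶠ[𝓝 p] fun q => c (extChartAt I p q)) : dif I g p = c := by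
  obtain ⟨φ, hφ, hφp, -⟩ := hS.exists_smooth_chart p
  have hφ' := (hφ p).mdifferentiableAt (n := ∞) (by simp)
  have hgφ : g =ᶠ[𝓝 p] c ∘ φ := by
    filter_upwards [hg, hφp] with q hq hq'
    rw [hq, Function.comp_apply, hq']
  ext v
  rw [dif_congr hgφ, dif_dual_comp hφ', mfderiv_of_eventuallyEq_extChartAt hφ' hφp]
  rfl

theorem ContainsCoordinates.exists_dif_eq (hS : ContainsCoordinates I S) (p : N)
    (c : Cotangent I p) : ∃ g ∈ S, dif I g p = c := by
  obtain ⟨g, hgS, hg⟩ := hS.exists_coord p c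
  exact ⟨g, hgS, hS.dif_eq hg⟩

theorem ContainsCoordinates.smoothVectorField (hS : ContainsCoordinates I S)
    {X : ∀ x : N, TangentSpace I x} (hX : ∀ f ∈ S, SmoothFun I (lieFun X f)) :
    SmoothVectorField I X := fun f hf p => by
  obtain ⟨φ, hφ, hφp, hφS⟩ := hS.exists_smooth_chart p
  obtain ⟨H, hH, hfH⟩ := dif_eventuallyEq_fderiv_comp_mfderiv hφ hφp hf
  have hH' : ContMDiffAt I 𝓘(ℝ, EN →L[ℝ] ℝ) ∞ (fun q => fderiv ℝ H (φ q)) p :=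
    (hH.fderiv_right (m := ∞) (by simp)).contMDiffAt.comp p (hφ p)
  refine (hH'.clm_apply (contMDiff_mfderiv_apply hφ fun i => hX _ (hφS i)).contMDiffAt)
    |>.congr_of_eventuallyEq ?_
  filter_upwards [hfH] with q hq using hq (X q)

theorem ContainsCoordinates.smoothBivectorField (hS : ContainsCoordinates I S)
    {Λ : ∀ x : N, Bivector I x} (hΛ : ∀ f ∈ S, ∀ g ∈ S, SmoothFun I (pairing Λ f g)) :
    SmoothBivectorField I Λ := by
  have h_left : ∀ f ∈ S, ∀ g, SmoothFun I g → SmoothFun I (pairing Λ f g) := fun f hf g hg => by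
    rw [← lieFun_sharp]
    exact hS.smoothVectorField (fun g hg => by rw [lieFun_sharp]; exact hΛ f hf g hg) g hg
  intro f g hf hg
  rw [← lieFun_sharp]
  refine hS.smoothVectorField (fun g hg => ?_) g hg
  rw [lieFun_sharp, pairing_swap]
  exact (h_left g hg f hf).neg

section Tensoriality

variable {X Y : ∀ x : N, TangentSpace I x} {Λ : ∀ x : N, Bivector I x} {f f' g g' h h' : N → ℝ}
  {p : N}

/-- At a critical point of `f`, `X(Yf)` is the Hessian of `f` evaluated on `(X, Y)`, which is
symmetric. -/
theorem ContainsCoordinates.lieFun_comm_of_dif_eq_zero (hS : ContainsCoordinates I S)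
    (hX : SmoothVectorField I X) (hY : SmoothVectorField I Y) (hf : SmoothFun I f)
    (hfp : dif I f p = 0) : lieFun X (lieFun Y f) p = lieFun Y (lieFun X f) p := by
  obtain ⟨φ, hφ, hφp, hφS⟩ := hS.exists_smooth_chart p
  have hφ_diff := (hφ p).mdifferentiableAt (n := ∞) (by simp)
  obtain ⟨H, hH, hfH⟩ := dif_eventuallyEq_fderiv_comp_mfderiv hφ hφp hf
  have hH' : DifferentiableAt ℝ (fderiv ℝ H) (φ p) :=
    (hH.fderiv_right (m := ∞) (by simp)).differentiableAt (by simp)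
  have hHp : fderiv ℝ H (φ p) = 0 := by
    ext v
    have hv := hfH.self_of_nhds v
    rw [hfp, mfderiv_of_eventuallyEq_extChartAt hφ_diff hφp] at hv
    exact hv.symm
  have hessian : ∀ {X Y : ∀ x : N, TangentSpace I x}, SmoothVectorField I Y →
      lieFun X (lieFun Y f) p = fderiv ℝ (fderiv ℝ H) (φ p) (mfderiv I 𝓘(ℝ, EN) φ p (X p))
        (mfderiv I 𝓘(ℝ, EN) φ p (Y p)) := fun {X Y} hY => by
    have hYφ := contMDiff_mfderiv_apply hφ fun i => hY _ (hS.smooth _ (hφS i))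
    have h_eq : lieFun Y f =ᶠ[𝓝 p]
        fun q => fderiv ℝ H (φ q) (mfderiv I 𝓘(ℝ, EN) φ q (Y q)) := by
      filter_upwards [hfH] with q hq using hq (Y q)
    rw [lieFun_apply, dif_congr h_eq]
    exact dif_clm_apply_of_eq_zero hH' hφ_diff ((hYφ p).mdifferentiableAt (by simp)) hHp (X p)
  have hsymm : IsSymmSndFDerivAt ℝ H (φ p) :=
    hH.isSymmSndFDerivAt (by simpa using ENat.LEInfty.out)
  rw [hessian hY, hessian hX]
  exact hsymm.eq _ _

theorem ContainsCoordinates.commutator_congr (hS : ContainsCoordinates I S)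
    (hX : SmoothVectorField I X) (hY : SmoothVectorField I Y) (hf : SmoothFun I f)
    (hg : SmoothFun I g) (hfg : dif I f p = dif I g p) :
    lieFun X (lieFun Y f) p - lieFun Y (lieFun X f) p =
      lieFun X (lieFun Y g) p - lieFun Y (lieFun X g) p := by
  have h := hS.lieFun_comm_of_dif_eq_zero hX hY (hf.sub hg) (p := p)
    (by rw [← sub_eq_zero.2 hfg]; exact dif_sub (hf.mdifferentiableAt p) (hg.mdifferentiableAt p))
  change lieFun X (lieFun Y (f - g)) p = lieFun Y (lieFun X (f - g)) p at h
  rw [lieFun_sub _ hf hg, lieFun_sub _ hf hg, lieFun_sub _ (hY f hf) (hY g hg),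
    lieFun_sub _ (hX f hf) (hX g hg), Pi.sub_apply, Pi.sub_apply] at h
  linarith

variable {E : ∀ x : N, TangentSpace I x}

theorem ContainsCoordinates.lieBivector_congr (hS : ContainsCoordinates I S)
    (hΛ : SmoothBivectorField I Λ) (hE : SmoothVectorField I E)
    (hf : SmoothFun I f) (hf' : SmoothFun I f') (hg : SmoothFun I g) (hg' : SmoothFun I g')
    (hff' : dif I f p = dif I f' p) (hgg' : dif I g p = dif I g' p) :
    lieBivector E Λ f g p = lieBivector E Λ f' g' p := by
  have congr_right : ∀ {f g g' : N → ℝ}, SmoothFun I f → SmoothFun I g → SmoothFun I g' →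
      dif I g p = dif I g' p → lieBivector E Λ f g p = lieBivector E Λ f g' p := by
    intro f g g' hf hg hg' hgg'
    have h := hS.commutator_congr hE (hΛ.smooth_hamiltonian hf) hg hg' hgg'
    simp only [lieFun_sharp] at h
    simp only [lieBivector, Pi.sub_apply]
    rw [pairing_apply _ (lieFun E f), pairing_apply _ (lieFun E f), hgg']
    linarith
  rw [congr_right hf hg hg' hgg', lieBivector_swap f g', lieBivector_swap f' g', Pi.neg_apply,
    Pi.neg_apply, congr_right hg' hf hf' hff']

theorem ContainsCoordinates.schouten_congr (hS : ContainsCoordinates I S)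
    (hΛ : SmoothBivectorField I Λ)
    (hf : SmoothFun I f) (hf' : SmoothFun I f') (hg : SmoothFun I g) (hg' : SmoothFun I g')
    (hh : SmoothFun I h) (hh' : SmoothFun I h') (hff' : dif I f p = dif I f' p)
    (hgg' : dif I g p = dif I g' p) (hhh' : dif I h p = dif I h' p) :
    schouten Λ Λ f g h p = schouten Λ Λ f' g' h' p := by
  have congr_last : ∀ {f g h h' : N → ℝ}, SmoothFun I f → SmoothFun I g → SmoothFun I h →
      SmoothFun I h' → dif I h p = dif I h' p →
      schouten Λ Λ f g h p = schouten Λ Λ f g h' p := by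
    intro f g h h' hf hg hh hh' hhh'
    have hfg :=
      hS.commutator_congr (hΛ.smooth_hamiltonian hf) (hΛ.smooth_hamiltonian hg) hh hh' hhh'
    simp only [lieFun_sharp] at hfg
    rw [schouten_self_eq, schouten_self_eq, pairing_swap Λ h f, pairing_swap Λ h' f,
      pairing_neg_right, pairing_neg_right]
    simp only [Pi.smul_apply, Pi.add_apply, Pi.neg_apply]
    rw [pairing_apply Λ h, pairing_apply Λ h', hhh']
    congr 1
    linarith
  rw [congr_last hf hg hh hh' hhh', schouten_self_cyclic, congr_last hg hh' hf hf' hff',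
    schouten_self_cyclic, congr_last hh' hf' hg hg' hgg', schouten_self_cyclic]

end Tensoriality

end Coordinates

/-! ### Related tensors -/

section Related

variable {EN : Type*} [NormedAddCommGroup EN] [NormedSpace ℝ EN]
  {HN : Type*} [TopologicalSpace HN] {I : ModelWithCorners ℝ EN HN}
  {N : Type*} [TopologicalSpace N] [ChartedSpace HN N]
  {EN' : Type*} [NormedAddCommGroup EN'] [NormedSpace ℝ EN']
  {HN' : Type*} [TopologicalSpace HN'] {I' : ModelWithCorners ℝ EN' HN'}
  {N' : Type*} [TopologicalSpace N'] [ChartedSpace HN' N']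

/-- The vector fields `X` and `X'` are `φ`-related. -/
def RelatedVectorFields (φ : N → N') (X : ∀ x : N, TangentSpace I x)
    (X' : ∀ x : N', TangentSpace I' x) : Prop :=
  ∀ x, X' (φ x) = mfderiv I I' φ x (X x)

/-- The bivector fields `Λ` and `Λ'` are `φ`-related. -/
def RelatedBivectorFields (φ : N → N') (Λ : ∀ x : N, Bivector I x)
    (Λ' : ∀ x : N', Bivector I' x) : Prop :=
  ∀ x, Λ' (φ x) = pushBivector I I' φ x (Λ x)

theorem altBilin_pushBivector (φ : N → N') (x : N) (Λ : Bivector I x)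
    (α β : Cotangent I' (φ x)) :
    altBilin (pushBivector I I' φ x Λ) α β =
      altBilin Λ (α.comp (mfderiv I I' φ x).toLinearMap)
        (β.comp (mfderiv I I' φ x).toLinearMap) :=
  altBilin_compLinearMap _ _ _ _

variable {φ : N → N'} {X : ∀ x : N, TangentSpace I x} {X' : ∀ x : N', TangentSpace I' x}
  {Λ : ∀ x : N, Bivector I x} {Λ' : ∀ x : N', Bivector I' x} {f g k : N' → ℝ}

theorem IsRelated.vectorFields {J : JacobiStructure I N} {K : JacobiStructure I' N'}
    (h : IsRelated φ J K) : RelatedVectorFields φ J.E K.E :=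
  fun x => (h x).1

theorem IsRelated.bivectorFields {J : JacobiStructure I N} {K : JacobiStructure I' N'}
    (h : IsRelated φ J K) : RelatedBivectorFields φ J.Λ K.Λ :=
  fun x => (h x).2

theorem RelatedVectorFields.lieFun_comp (hX : RelatedVectorFields φ X X')
    (hφ : ContMDiff I I' ∞ φ) (hf : SmoothFun I' f) : lieFun X (f ∘ φ) = lieFun X' f ∘ φ := by
  ext x
  rw [lieFun_apply, dif_comp_apply (hf.mdifferentiableAt _) ((hφ x).mdifferentiableAt (by simp)),
    Function.comp_apply, lieFun_apply, hX]

namespace RelatedBivectorFields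

theorem pairing_comp (hΛ : RelatedBivectorFields φ Λ Λ') (hφ : ContMDiff I I' ∞ φ)
    (hf : SmoothFun I' f) (hg : SmoothFun I' g) :
    pairing Λ (f ∘ φ) (g ∘ φ) = pairing Λ' f g ∘ φ := by
  ext x
  have hx := (hφ x).mdifferentiableAt (n := ∞) (by simp)
  rw [pairing_apply, dif_comp (hf.mdifferentiableAt _) hx, dif_comp (hg.mdifferentiableAt _) hx,
    Function.comp_apply, pairing_apply, hΛ, altBilin_pushBivector]

theorem schouten_comp (hΛ : RelatedBivectorFields φ Λ Λ') (hφ : ContMDiff I I' ∞ φ)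
    (hΛ' : SmoothBivectorField I' Λ') (hf : SmoothFun I' f) (hg : SmoothFun I' g)
    (hk : SmoothFun I' k) :
    schouten Λ Λ (f ∘ φ) (g ∘ φ) (k ∘ φ) = schouten Λ' Λ' f g k ∘ φ := by
  simp only [schouten, hΛ.pairing_comp hφ hg hk, hΛ.pairing_comp hφ hk hf,
    hΛ.pairing_comp hφ hf hg, hΛ.pairing_comp hφ hf (hΛ' _ _ hg hk),
    hΛ.pairing_comp hφ hg (hΛ' _ _ hk hf), hΛ.pairing_comp hφ hk (hΛ' _ _ hf hg)]
  rfl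

theorem wedgeVB_comp (hΛ : RelatedBivectorFields φ Λ Λ') (hX : RelatedVectorFields φ X X')
    (hφ : ContMDiff I I' ∞ φ) (hf : SmoothFun I' f) (hg : SmoothFun I' g) (hk : SmoothFun I' k) :
    wedgeVB X Λ (f ∘ φ) (g ∘ φ) (k ∘ φ) = wedgeVB X' Λ' f g k ∘ φ := by
  simp only [wedgeVB, hΛ.pairing_comp hφ hg hk, hΛ.pairing_comp hφ hk hf,
    hΛ.pairing_comp hφ hf hg, hX.lieFun_comp hφ hf, hX.lieFun_comp hφ hg, hX.lieFun_comp hφ hk]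
  rfl

theorem lieBivector_comp (hΛ : RelatedBivectorFields φ Λ Λ') (hX : RelatedVectorFields φ X X')
    (hφ : ContMDiff I I' ∞ φ) (hΛ' : SmoothBivectorField I' Λ') (hX' : SmoothVectorField I' X')
    (hf : SmoothFun I' f) (hg : SmoothFun I' g) :
    lieBivector X Λ (f ∘ φ) (g ∘ φ) = lieBivector X' Λ' f g ∘ φ := by
  simp only [lieBivector, hΛ.pairing_comp hφ hf hg, hX.lieFun_comp hφ hf, hX.lieFun_comp hφ hg,
    hX.lieFun_comp hφ (hΛ' _ _ hf hg), hΛ.pairing_comp hφ (hX' f hf) hg,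
    hΛ.pairing_comp hφ hf (hX' g hg)]
  rfl

end RelatedBivectorFields

theorem IsRelated.bracket_comp {J : JacobiStructure I N} {K : JacobiStructure I' N'}
    (h : IsRelated φ J K) (hφ : ContMDiff I I' ∞ φ) (hf : SmoothFun I' f)
    (hg : SmoothFun I' g) : J.bracket (f ∘ φ) (g ∘ φ) = K.bracket f g ∘ φ := by
  rw [J.bracket_eq, h.bivectorFields.pairing_comp hφ hf hg, h.vectorFields.lieFun_comp hφ hf,
    h.vectorFields.lieFun_comp hφ hg]
  rfl

section Pullback

variable (I I') in
/-- The restrictions along `φ` of the smooth functions. If they contain coordinates, then `φ` is an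
immersion, and tensor fields related to smooth ones by `φ` are smooth. -/
def pullbackFunctions (φ : N → N') : Set (N → ℝ) :=
  (· ∘ φ) '' {g | SmoothFun I' g}

variable [I.Boundaryless] [FiniteDimensional ℝ EN]

theorem RelatedVectorFields.smooth (hX : RelatedVectorFields φ X X')
    (hS : ContainsCoordinates I (pullbackFunctions I' φ)) (hφ : ContMDiff I I' ∞ φ)
    (hX' : SmoothVectorField I' X') : SmoothVectorField I X :=
  hS.smoothVectorField <| by
    rintro _ ⟨f, hf, rfl⟩
    rw [hX.lieFun_comp hφ hf]
    exact (hX' f hf).comp hφ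

namespace RelatedBivectorFields

theorem smooth (hΛ : RelatedBivectorFields φ Λ Λ')
    (hS : ContainsCoordinates I (pullbackFunctions I' φ)) (hφ : ContMDiff I I' ∞ φ)
    (hΛ' : SmoothBivectorField I' Λ') : SmoothBivectorField I Λ :=
  hS.smoothBivectorField <| by
    rintro _ ⟨f, hf, rfl⟩ _ ⟨g, hg, rfl⟩
    rw [hΛ.pairing_comp hφ hf hg]
    exact (hΛ' f g hf hg).comp hφ

theorem schouten_self_eq_wedgeVB (hΛ : RelatedBivectorFields φ Λ Λ')
    (hX : RelatedVectorFields φ X X') (hS : ContainsCoordinates I (pullbackFunctions I' φ))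
    (hφ : ContMDiff I I' ∞ φ) (hΛ' : SmoothBivectorField I' Λ') {c : ℝ}
    (h : ∀ f g k, SmoothFun I' f → SmoothFun I' g → SmoothFun I' k →
      schouten Λ' Λ' f g k = c • wedgeVB X' Λ' f g k)
    {f g k : N → ℝ} (hf : SmoothFun I f) (hg : SmoothFun I g) (hk : SmoothFun I k) :
    schouten Λ Λ f g k = c • wedgeVB X Λ f g k := by
  ext p
  obtain ⟨_, ⟨f', hf', rfl⟩, hff'⟩ := hS.exists_dif_eq p (dif I f p)
  obtain ⟨_, ⟨g', hg', rfl⟩, hgg'⟩ := hS.exists_dif_eq p (dif I g p)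
  obtain ⟨_, ⟨k', hk', rfl⟩, hkk'⟩ := hS.exists_dif_eq p (dif I k p)
  rw [Pi.smul_apply, hS.schouten_congr (hΛ.smooth hS hφ hΛ') hf (hf'.comp hφ) hg (hg'.comp hφ) hk
      (hk'.comp hφ) hff'.symm hgg'.symm hkk'.symm, wedgeVB_congr hff'.symm hgg'.symm hkk'.symm,
    hΛ.schouten_comp hφ hΛ' hf' hg' hk', hΛ.wedgeVB_comp hX hφ hf' hg' hk', h f' g' k' hf' hg' hk']
  rfl

theorem lieBivector_eq_zero (hΛ : RelatedBivectorFields φ Λ Λ') (hX : RelatedVectorFields φ X X')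
    (hS : ContainsCoordinates I (pullbackFunctions I' φ)) (hφ : ContMDiff I I' ∞ φ)
    (hΛ' : SmoothBivectorField I' Λ') (hX' : SmoothVectorField I' X')
    (h : ∀ f g, SmoothFun I' f → SmoothFun I' g → lieBivector X' Λ' f g = 0)
    {f g : N → ℝ} (hf : SmoothFun I f) (hg : SmoothFun I g) : lieBivector X Λ f g = 0 := by
  ext p
  obtain ⟨_, ⟨f', hf', rfl⟩, hff'⟩ := hS.exists_dif_eq p (dif I f p)
  obtain ⟨_, ⟨g', hg', rfl⟩, hgg'⟩ := hS.exists_dif_eq p (dif I g p)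
  rw [hS.lieBivector_congr (hΛ.smooth hS hφ hΛ') (hX.smooth hS hφ hX') hf (hf'.comp hφ) hg
      (hg'.comp hφ) hff'.symm hgg'.symm,
    hΛ.lieBivector_comp hX hφ hΛ' hX' hf' hg', h f' g' hf' hg']
  rfl

end RelatedBivectorFields

/-- The Jacobi structure formed by tensor fields that are related to those of a Jacobi structure
`K` by an immersion. -/
def JacobiStructure.ofRelated (hS : ContainsCoordinates I (pullbackFunctions I' φ))
    (hφ : ContMDiff I I' ∞ φ) (K : JacobiStructure I' N') (hX : RelatedVectorFields φ X K.E)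
    (hΛ : RelatedBivectorFields φ Λ K.Λ) : JacobiStructure I N where
  Λ := Λ
  E := X
  smoothΛ := hΛ.smooth hS hφ K.smoothΛ
  smoothE := hX.smooth hS hφ K.smoothE
  schouten_self _ _ _ := hΛ.schouten_self_eq_wedgeVB hX hS hφ K.smoothΛ K.schouten_self
  lie_E _ _ := hΛ.lieBivector_eq_zero hX hS hφ K.smoothΛ K.smoothE K.lie_E

end Pullback

end Related

/-! ### Hulls -/

section TangentBivectors

variable {W W' : Type*} [AddCommGroup W] [Module ℝ W] [AddCommGroup W'] [Module ℝ W']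

theorem exists_eq_add_smul_of_comp_eq {L : W →ₗ[ℝ] W'} {θ : Dual ℝ W'}
    (hθ : LinearMap.ker θ ≤ LinearMap.range L) {α β : Dual ℝ W'} (h : α ∘ₗ L = β ∘ₗ L) :
    ∃ k : ℝ, α = β + k • θ := by
  have hker : ⨅ _ : Unit, LinearMap.ker θ ≤ LinearMap.ker (α - β) := by
    rw [iInf_const]
    intro v hv
    obtain ⟨w, rfl⟩ := hθ hv
    exact sub_eq_zero.2 (LinearMap.congr_fun h w)
  have hspan := mem_span_of_iInf_ker_le_ker hker
  rw [range_const, Submodule.mem_span_singleton] at hspan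
  obtain ⟨k, hk⟩ := hspan
  exact ⟨k, by rw [hk, add_sub_cancel]⟩

theorem exists_eq_compLinearMap_dualMap {L : W →ₗ[ℝ] W'} (hL : Function.Injective L)
    {θ : Dual ℝ W'} (hθ : LinearMap.ker θ ≤ LinearMap.range L)
    {Λ : Dual ℝ W' [⋀^Fin 2]→ₗ[ℝ] ℝ} (hΛ : ∀ β, altBilin Λ θ β = 0) :
    ∃ Λ₀ : Dual ℝ W [⋀^Fin 2]→ₗ[ℝ] ℝ, Λ = Λ₀.compLinearMap L.dualMap := by
  obtain ⟨R, hR⟩ := L.exists_leftInverse_of_injective (LinearMap.ker_eq_bot.2 hL)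
  have hdecomp : ∀ α : Dual ℝ W', ∃ k : ℝ, α = R.dualMap (L.dualMap α) + k • θ := fun α =>
    exists_eq_add_smul_of_comp_eq hθ <| by
      ext w
      exact congrArg (fun w => α (L w)) (LinearMap.congr_fun hR w).symm
  refine ⟨Λ.compLinearMap R.dualMap, altBilin_injective (LinearMap.ext₂ fun α β => ?_)⟩
  obtain ⟨k, hk⟩ := hdecomp α
  obtain ⟨l, hl⟩ := hdecomp β
  rw [altBilin_compLinearMap, altBilin_compLinearMap]
  conv_lhs => rw [hk, hl]
  simp only [map_add, map_smul, LinearMap.add_apply, LinearMap.smul_apply, hΛ,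
    altBilin_swap Λ _ θ, neg_zero, smul_zero, add_zero]

end TangentBivectors

section Hulls

variable {EN : Type*} [NormedAddCommGroup EN] [NormedSpace ℝ EN]
  {HN : Type*} [TopologicalSpace HN] (I : ModelWithCorners ℝ EN HN)
  {N : Type*} [TopologicalSpace N] [ChartedSpace HN N]
  {EN' : Type*} [NormedAddCommGroup EN'] [NormedSpace ℝ EN']
  {HN' : Type*} [TopologicalSpace HN'] (I' : ModelWithCorners ℝ EN' HN')
  {N' : Type*} [TopologicalSpace N'] [ChartedSpace HN' N'] {S : Type*}

/-- The situation common to the vector hull of an affine bundle and to the product `M × (ℝ ∖ {0})`: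
`N` is the hypersurface `bar one = 1` of a manifold `N'` with a Liouville vector field `Δ`, and the
functions `fn a` on `N` are the restrictions of the homogeneous functions `bar a` on `N'`. -/
structure IsHull (φ : N → N') (Δ : ∀ x : N', TangentSpace I' x) (one : S) (fn : S → N → ℝ)
    (bar : S → N' → ℝ) : Prop where
  smooth_incl : ContMDiff I I' ∞ φ
  smooth_bar : ∀ a, SmoothFun I' (bar a)
  smooth_liouville : SmoothVectorField I' Δ
  lie_bar : ∀ a, lieFun Δ (bar a) = bar a
  bar_comp : ∀ a, bar a ∘ φ = fn a
  fn_one : fn one = 1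
  ext_bar : ∀ a b, fn a = fn b → bar a = bar b
  exists_add : ∀ a b, ∃ c, fn c = fn a + fn b ∧ bar c = bar a + bar b
  coords : ContainsCoordinates I (range fn)
  coords' : ContainsCoordinates I' {f : N' → ℝ | SmoothFun I' f}
  dense : Dense {y | bar one y ≠ 0}
  span : ∀ y, bar one y ≠ 0 → ∀ c : Cotangent I' y, ∃ a, dif I' (bar a) y = c
  finrank_eq : finrank ℝ EN' = finrank ℝ EN + 1

variable {I I'}

/-- A Jacobi structure whose bracket preserves the space of the functions `fn a`, as an affine
Jacobi bracket does with the affine functions. -/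
def IsAffineFor (fn : S → N → ℝ) (J : JacobiStructure I N) : Prop :=
  ∀ a b, ∃ c, J.bracket (fn a) (fn b) = fn c

/-- A bivector field whose bracket preserves the space of the functions `bar a`, as a homogeneous
Poisson tensor does with the linear functions. -/
def IsLinearFor (bar : S → N' → ℝ) (Λ : ∀ x : N', Bivector I' x) : Prop :=
  ∀ a b, ∃ c, pairing Λ (bar a) (bar b) = bar c

/-- A bivector field whose bracket of `bar a` and `bar b` is the function corresponding to the
Jacobi bracket of `fn a` and `fn b`. -/
def IsLinearization (fn : S → N → ℝ) (bar : S → N' → ℝ) (J : JacobiStructure I N)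
    (Λ : ∀ x : N', Bivector I' x) : Prop :=
  ∀ a b, ∃ c, pairing Λ (bar a) (bar b) = bar c ∧ fn c = J.bracket (fn a) (fn b)

variable {φ : N → N'} {Δ : ∀ x : N', TangentSpace I' x} {one : S} {fn : S → N → ℝ}
  {bar : S → N' → ℝ}

theorem IsLinearization.isLinearFor {J : JacobiStructure I N} {Λ : ∀ x : N', Bivector I' x}
    (hJ : IsLinearization fn bar J Λ) : IsLinearFor bar Λ :=
  fun a b => (hJ a b).imp fun _ hc => hc.1

namespace IsHull

theorem smooth_fn (h : IsHull I I' φ Δ one fn bar) (a : S) : SmoothFun I (fn a) :=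
  h.coords.smooth _ (mem_range_self a)

theorem coords_pullback (h : IsHull I I' φ Δ one fn bar) :
    ContainsCoordinates I (pullbackFunctions I' φ) :=
  h.coords.mono (by rintro _ ⟨a, rfl⟩; exact ⟨bar a, h.smooth_bar a, h.bar_comp a⟩)
    (by rintro _ ⟨f, hf, rfl⟩; exact ContMDiff.comp hf h.smooth_incl)

theorem bar_one_incl (h : IsHull I I' φ Δ one fn bar) (x : N) : bar one (φ x) = 1 :=
  congrFun ((h.bar_comp one).trans h.fn_one) x

theorem eq_of_eq_on (h : IsHull I I' φ Δ one fn bar) {f g : N' → ℝ}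
    (hf : SmoothFun I' f) (hg : SmoothFun I' g)
    (hfg : ∀ y, bar one y ≠ 0 → f y = g y) : f = g :=
  Continuous.ext_on h.dense hf.continuous hg.continuous hfg

theorem bar_add_add_eq (h : IsHull I I' φ Δ one fn bar) {a b c d : S}
    (hfn : fn a + fn b + fn c = fn d) : bar a + bar b + bar c = bar d := by
  obtain ⟨s, hs, hs'⟩ := h.exists_add a b
  obtain ⟨t, ht, ht'⟩ := h.exists_add s c
  rw [← hs', ← ht']
  exact h.ext_bar t d (by rw [ht, hs, hfn])

theorem cyclic_pairing_bar (h : IsHull I I' φ Δ one fn bar) {J : JacobiStructure I N}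
    {Λ : ∀ x : N', Bivector I' x} (hJ : IsLinearization fn bar J Λ) (a b c : S) :
    pairing Λ (bar a) (pairing Λ (bar b) (bar c)) + pairing Λ (bar b) (pairing Λ (bar c) (bar a)) +
      pairing Λ (bar c) (pairing Λ (bar a) (bar b)) = 0 := by
  obtain ⟨ab, hab, hab'⟩ := hJ a b
  obtain ⟨bc, hbc, hbc'⟩ := hJ b c
  obtain ⟨ca, hca, hca'⟩ := hJ c a
  obtain ⟨abc, habc, habc'⟩ := hJ a bc
  obtain ⟨bca, hbca, hbca'⟩ := hJ b ca
  obtain ⟨cab, hcab, hcab'⟩ := hJ c ab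
  -- The index `zero` of the zero function comes from the bracket of `bar one` with itself.
  obtain ⟨zero, hzero, hzero'⟩ := hJ one one
  rw [pairing_self] at hzero
  rw [hbc, hca, hab, habc, hbca, hcab, hzero]
  refine h.bar_add_add_eq ?_
  rw [habc', hbca', hcab', hab', hbc', hca', J.jacobi (h.smooth_fn a) (h.smooth_fn b)
    (h.smooth_fn c), ← h.bar_comp, ← hzero]
  rfl

section Determination

variable [I'.Boundaryless] [FiniteDimensional ℝ EN']

theorem bivector_ext (h : IsHull I I' φ Δ one fn bar)
    {Λ Λ' : ∀ x : N', Bivector I' x} (hΛ : SmoothBivectorField I' Λ)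
    (hΛ' : SmoothBivectorField I' Λ')
    (hb : ∀ a b, pairing Λ (bar a) (bar b) = pairing Λ' (bar a) (bar b)) : Λ = Λ' := by
  have heq : ∀ f g, SmoothFun I' f → SmoothFun I' g → pairing Λ f g = pairing Λ' f g := by
    intro f g hf hg
    refine h.eq_of_eq_on (hΛ f g hf hg) (hΛ' f g hf hg) fun y hy => ?_
    obtain ⟨a, ha⟩ := h.span y hy (dif I' f y)
    obtain ⟨b, hb'⟩ := h.span y hy (dif I' g y)
    rw [pairing_apply, pairing_apply, ← ha, ← hb', ← pairing_apply, ← pairing_apply, hb]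
  ext1 y
  refine altBilin_injective (LinearMap.ext₂ fun α β => ?_)
  obtain ⟨f, hf, rfl⟩ := h.coords'.exists_dif_eq y α
  obtain ⟨g, hg, rfl⟩ := h.coords'.exists_dif_eq y β
  exact congrFun (heq f g hf hg) y

theorem isHomogeneous (h : IsHull I I' φ Δ one fn bar)
    {Λ : ∀ x : N', Bivector I' x} (hΛ : SmoothBivectorField I' Λ)
    (hlin : IsLinearFor bar Λ) : IsHomogeneous Δ Λ := by
  intro f g hf hg
  have hs : SmoothFun I' (lieBivector Δ Λ f g) :=
    ((h.smooth_liouville _ (hΛ f g hf hg)).sub (hΛ _ _ (h.smooth_liouville f hf) hg)).sub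
      (hΛ _ _ hf (h.smooth_liouville g hg))
  refine h.eq_of_eq_on hs (hΛ f g hf hg).neg fun y hy => ?_
  obtain ⟨a, ha⟩ := h.span y hy (dif I' f y)
  obtain ⟨b, hb⟩ := h.span y hy (dif I' g y)
  obtain ⟨c, hc⟩ := hlin a b
  have hbar : lieBivector Δ Λ (bar a) (bar b) = -pairing Λ (bar a) (bar b) := by
    rw [lieBivector, h.lie_bar, h.lie_bar, hc, h.lie_bar]
    ring
  rw [h.coords'.lieBivector_congr hΛ h.smooth_liouville hf (h.smooth_bar a) hg (h.smooth_bar b)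
    ha.symm hb.symm, hbar, Pi.neg_apply, Pi.neg_apply, pairing_apply, pairing_apply, ha, hb]

/-- The Poisson structure given by a smooth linearization of a Jacobi structure. -/
def toPoisson (h : IsHull I I' φ Δ one fn bar) {J : JacobiStructure I N}
    {Λ : ∀ x : N', Bivector I' x} (hΛ : SmoothBivectorField I' Λ)
    (hJ : IsLinearization fn bar J Λ) : PoissonStructure I' N' where
  Λ := Λ
  smoothΛ := hΛ
  schouten_self f g k hf hg hk := by
    have hcyc : SmoothFun I' (pairing Λ f (pairing Λ g k) + pairing Λ g (pairing Λ k f) +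
        pairing Λ k (pairing Λ f g)) :=
      ((hΛ _ _ hf (hΛ _ _ hg hk)).add (hΛ _ _ hg (hΛ _ _ hk hf))).add (hΛ _ _ hk (hΛ _ _ hf hg))
    have hs : SmoothFun I' (schouten Λ Λ f g k) := by
      rw [schouten_self_eq]
      exact (contMDiff_const (c := (2 : ℝ))).mul hcyc
    refine h.eq_of_eq_on hs contMDiff_const fun y hy => ?_
    obtain ⟨a, ha⟩ := h.span y hy (dif I' f y)
    obtain ⟨b, hb⟩ := h.span y hy (dif I' g y)
    obtain ⟨c, hc⟩ := h.span y hy (dif I' k y)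
    rw [h.coords'.schouten_congr hΛ hf (h.smooth_bar a) hg (h.smooth_bar b) hk (h.smooth_bar c)
      ha.symm hb.symm hc.symm, schouten_self_eq, h.cyclic_pairing_bar hJ, smul_zero]

theorem poisson_ext (h : IsHull I I' φ Δ one fn bar) {P P' : PoissonStructure I' N'}
    (hP : IsLinearFor bar P.Λ) (hP' : IsLinearFor bar P'.Λ)
    (hb : ∀ a b, P.bracket (bar a) (bar b) ∘ φ = P'.bracket (bar a) (bar b) ∘ φ) : P = P' := by
  refine PoissonStructure.ext (h.bivector_ext P.smoothΛ P'.smoothΛ fun a b => ?_)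
  obtain ⟨c, hc⟩ := hP a b
  obtain ⟨c', hc'⟩ := hP' a b
  have hcc' := hb a b
  rw [PoissonStructure.bracket, PoissonStructure.bracket, hc, hc', h.bar_comp, h.bar_comp] at hcc'
  rw [hc, hc', h.ext_bar c c' hcc']

/-- The Jacobi structure on `N'` induced by a linear Poisson structure. -/
def hullJacobi (h : IsHull I I' φ Δ one fn bar) (P : PoissonStructure I' N')
    (hP : IsLinearFor bar P.Λ) : JacobiStructure I' N' :=
  P.toJacobi Δ h.smooth_liouville (h.isHomogeneous P.smoothΛ hP) (bar one) (h.smooth_bar one)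
    (h.lie_bar one)

theorem bracket_hullJacobi (h : IsHull I I' φ Δ one fn bar) (P : PoissonStructure I' N')
    (hP : IsLinearFor bar P.Λ) (a b : S) :
    (h.hullJacobi P hP).bracket (bar a) (bar b) = P.bracket (bar a) (bar b) := by
  have hwedge := pairing_wedge Δ (h.hullJacobi P hP).E (bar a) (bar b)
  have hΛ : pairing (h.hullJacobi P hP).Λ (bar a) (bar b) =
      P.bracket (bar a) (bar b) - pairing (fun x => wedge I' (Δ x) ((h.hullJacobi P hP).E x))
        (bar a) (bar b) := rfl
  rw [JacobiStructure.bracket_eq, hΛ, hwedge, h.lie_bar, h.lie_bar]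
  ring

end Determination

section Restriction

theorem dif_one_mfderiv (h : IsHull I I' φ Δ one fn bar) (x : N) (v : TangentSpace I x) :
    dif I' (bar one) (φ x) (mfderiv I I' φ x v) = 0 := by
  rw [← dif_comp_apply ((h.smooth_bar one).mdifferentiableAt _)
    ((h.smooth_incl x).mdifferentiableAt (by simp)), h.bar_comp, h.fn_one]
  exact LinearMap.congr_fun (dif_const 1 x) v

theorem dif_one_liouville (h : IsHull I I' φ Δ one fn bar) (x : N) :
    dif I' (bar one) (φ x) (Δ (φ x)) = 1 := by
  rw [← lieFun_apply, h.lie_bar, h.bar_one_incl]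

variable [I.Boundaryless] [FiniteDimensional ℝ EN]

theorem mfderiv_injective (h : IsHull I I' φ Δ one fn bar) (x : N) :
    Function.Injective (mfderiv I I' φ x) := by
  rw [injective_iff_map_eq_zero]
  intro v hv
  refine (forall_dual_apply_eq_zero_iff ℝ v).1 fun c => ?_
  obtain ⟨_, ⟨a, rfl⟩, rfl⟩ := h.coords.exists_dif_eq x c
  rw [← h.bar_comp, dif_comp_apply ((h.smooth_bar a).mdifferentiableAt _)
    ((h.smooth_incl x).mdifferentiableAt (by simp)), hv, map_zero]

theorem jacobi_ext (h : IsHull I I' φ Δ one fn bar) {J J' : JacobiStructure I N}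
    (hJ : ∀ a b, J.bracket (fn a) (fn b) = J'.bracket (fn a) (fn b)) : J = J' := by
  have hone : ∀ (K : JacobiStructure I N) (a : S),
      K.bracket (fn one) (fn a) = lieFun K.E (fn a) := fun K a => by
    have hE : lieFun K.E 1 = 0 := lieFun_const _ 1
    have hΛ : pairing K.Λ (fn a) 1 = 0 := pairing_const_right _ _ 1
    rw [K.bracket_eq, h.fn_one, hE, pairing_swap, hΛ]
    ring
  have hE : ∀ a, lieFun J.E (fn a) = lieFun J'.E (fn a) := fun a => by
    rw [← hone, ← hone, hJ]
  have hΛ : ∀ a b, pairing J.Λ (fn a) (fn b) = pairing J'.Λ (fn a) (fn b) := fun a b => by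
    have hab := hJ a b
    rw [J.bracket_eq, J'.bracket_eq, hE a, hE b] at hab
    linear_combination hab
  apply JacobiStructure.ext
  · ext1 x
    refine altBilin_injective (LinearMap.ext₂ fun α β => ?_)
    obtain ⟨_, ⟨a, rfl⟩, rfl⟩ := h.coords.exists_dif_eq x α
    obtain ⟨_, ⟨b, rfl⟩, rfl⟩ := h.coords.exists_dif_eq x β
    exact congrFun (hΛ a b) x
  · ext1 x
    rw [← sub_eq_zero]
    refine (forall_dual_apply_eq_zero_iff ℝ _).1 fun c => ?_
    obtain ⟨_, ⟨a, rfl⟩, rfl⟩ := h.coords.exists_dif_eq x c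
    rw [map_sub, sub_eq_zero]
    exact congrFun (hE a) x

variable [FiniteDimensional ℝ EN']

theorem range_mfderiv (h : IsHull I I' φ Δ one fn bar) (x : N) :
    LinearMap.range (mfderiv I I' φ x).toLinearMap = LinearMap.ker (dif I' (bar one) (φ x)) := by
  have : FiniteDimensional ℝ (TangentSpace I x) := inferInstanceAs (FiniteDimensional ℝ EN)
  have : FiniteDimensional ℝ (TangentSpace I' (φ x)) := inferInstanceAs (FiniteDimensional ℝ EN')
  refine Submodule.eq_of_le_of_finrank_le ?_ ?_
  · rintro _ ⟨v, rfl⟩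
    exact h.dif_one_mfderiv x v
  · have hrange := LinearMap.finrank_range_of_inj (f := (mfderiv I I' φ x).toLinearMap)
      (h.mfderiv_injective x)
    have hne : dif I' (bar one) (φ x) ≠ 0 := fun h0 => by
      simpa [h0] using h.dif_one_liouville x
    have hker := Module.Dual.finrank_ker_add_one_of_ne_zero hne
    have hdim : finrank ℝ (TangentSpace I' (φ x)) = finrank ℝ (TangentSpace I x) + 1 :=
      h.finrank_eq
    omega

variable [I'.Boundaryless] (h : IsHull I I' φ Δ one fn bar) (P : PoissonStructure I' N')
  (hP : IsLinearFor bar P.Λ)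

theorem exists_relatedVectorFields_hullJacobi :
    ∃ E : ∀ x : N, TangentSpace I x, RelatedVectorFields φ E (h.hullJacobi P hP).E := by
  have htangent : ∀ x, dif I' (bar one) (φ x) ((h.hullJacobi P hP).E (φ x)) = 0 := fun x =>
    (apply_sharp _ _ _).trans (altBilin_self _ _)
  choose E hE using fun x => (h.range_mfderiv x).ge (htangent x)
  exact ⟨E, fun x => (hE x).symm⟩

theorem exists_relatedBivectorFields_hullJacobi :
    ∃ Λ : ∀ x : N, Bivector I x, RelatedBivectorFields φ Λ (h.hullJacobi P hP).Λ := by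
  have htangent : ∀ x β,
      altBilin ((h.hullJacobi P hP).Λ (φ x)) (dif I' (bar one) (φ x)) β = 0 := by
    intro x β
    change altBilin (P.Λ (φ x) - wedge I' (Δ (φ x)) (sharp I' (P.Λ (φ x)) _)) _ β = 0
    rw [altBilin_apply, AlternatingMap.sub_apply, ← altBilin_apply, ← altBilin_apply,
      altBilin_wedge, apply_sharp, apply_sharp, altBilin_self, h.dif_one_liouville]
    ring
  choose Λ hΛ using fun x =>
    exists_eq_compLinearMap_dualMap (h.mfderiv_injective x) (h.range_mfderiv x).ge (htangent x)
  exact ⟨Λ, hΛ⟩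

/-- The restriction to `N` of the Jacobi structure on `N'` induced by a linear Poisson
structure. -/
def restrict : JacobiStructure I N :=
  JacobiStructure.ofRelated h.coords_pullback h.smooth_incl (h.hullJacobi P hP)
    (h.exists_relatedVectorFields_hullJacobi P hP).choose_spec
    (h.exists_relatedBivectorFields_hullJacobi P hP).choose_spec

theorem isRelated_restrict : IsRelated φ (h.restrict P hP) (h.hullJacobi P hP) := fun x =>
  ⟨(h.exists_relatedVectorFields_hullJacobi P hP).choose_spec x,
    (h.exists_relatedBivectorFields_hullJacobi P hP).choose_spec x⟩

theorem bracket_restrict (a b : S) :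
    (h.restrict P hP).bracket (fn a) (fn b) = P.bracket (bar a) (bar b) ∘ φ := by
  rw [← h.bracket_hullJacobi P hP, ← h.bar_comp, ← h.bar_comp]
  exact (h.isRelated_restrict P hP).bracket_comp h.smooth_incl (h.smooth_bar a) (h.smooth_bar b)

theorem isAffineFor_restrict : IsAffineFor fn (h.restrict P hP) := fun a b => by
  obtain ⟨c, hc⟩ := hP a b
  exact ⟨c, by rw [h.bracket_restrict, PoissonStructure.bracket, hc, h.bar_comp]⟩

end Restriction

section Correspondence

variable [I.Boundaryless] [FiniteDimensional ℝ EN] [I'.Boundaryless] [FiniteDimensional ℝ EN']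
  (h : IsHull I I' φ Δ one fn bar)

theorem eq_restrict_iff {J : JacobiStructure I N} {P : PoissonStructure I' N'}
    (hP : IsLinearFor bar P.Λ) :
    J = h.restrict P hP ↔
      ∀ a b x, J.bracket (fn a) (fn b) x = P.bracket (bar a) (bar b) (φ x) := by
  constructor
  · rintro rfl a b x
    exact congrFun (h.bracket_restrict P hP a b) x
  · exact fun hJ => h.jacobi_ext fun a b =>
      (funext (hJ a b)).trans (h.bracket_restrict P hP a b).symm

theorem restrict_bijective
    (hex : ∀ J : JacobiStructure I N, IsAffineFor fn J → ∃ Λ : ∀ y : N', Bivector I' y,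
      SmoothBivectorField I' Λ ∧ IsLinearization fn bar J Λ) :
    Function.Bijective fun P : {P : PoissonStructure I' N' // IsLinearFor bar P.Λ} =>
      (⟨h.restrict P.1 P.2, h.isAffineFor_restrict P.1 P.2⟩ :
        {J : JacobiStructure I N // IsAffineFor fn J}) := by
  constructor
  · intro P P' hPP'
    refine Subtype.ext (h.poisson_ext P.2 P'.2 fun a b => ?_)
    rw [← h.bracket_restrict P.1 P.2, ← h.bracket_restrict P'.1 P'.2]
    exact congrArg (fun J => J.1.bracket (fn a) (fn b)) hPP'
  · intro ⟨J, hJ⟩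
    obtain ⟨Λ, hΛ, hlin⟩ := hex J hJ
    refine ⟨⟨h.toPoisson hΛ hlin, hlin.isLinearFor⟩,
      Subtype.ext ((h.eq_restrict_iff _).2 fun a b x => ?_).symm⟩
    obtain ⟨c, hc, hc'⟩ := hlin a b
    rw [← hc', ← h.bar_comp]
    exact (congrFun hc (φ x)).symm

/-- The correspondence between Jacobi structures on `N` and linear Poisson structures on `N'`,
provided that every Jacobi structure of the class considered has a linearization. -/
def linearizationEquiv
    (hex : ∀ J : JacobiStructure I N, IsAffineFor fn J → ∃ Λ : ∀ y : N', Bivector I' y,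
      SmoothBivectorField I' Λ ∧ IsLinearization fn bar J Λ) :
    {J : JacobiStructure I N // IsAffineFor fn J} ≃
      {P : PoissonStructure I' N' // IsLinearFor bar P.Λ} :=
  (Equiv.ofBijective _ (h.restrict_bijective hex)).symm

variable {hex : ∀ J : JacobiStructure I N, IsAffineFor fn J → ∃ Λ : ∀ y : N', Bivector I' y,
      SmoothBivectorField I' Λ ∧ IsLinearization fn bar J Λ}

theorem restrict_linearizationEquiv (J : {J : JacobiStructure I N // IsAffineFor fn J}) :
    h.restrict (h.linearizationEquiv hex J).1 (h.linearizationEquiv hex J).2 = J.1 :=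
  congrArg Subtype.val ((Equiv.ofBijective _ (h.restrict_bijective hex)).apply_symm_apply J)

theorem eq_linearizationEquiv_iff (J : {J : JacobiStructure I N // IsAffineFor fn J})
    (P : {P : PoissonStructure I' N' // IsLinearFor bar P.Λ}) :
    P = h.linearizationEquiv hex J ↔
      ∀ a b x, J.1.bracket (fn a) (fn b) x = P.1.bracket (bar a) (bar b) (φ x) := by
  rw [linearizationEquiv, Equiv.eq_symm_apply, ← h.eq_restrict_iff P.2, Subtype.ext_iff, eq_comm]
  rfl

theorem isRelated_linearizationEquiv (J : {J : JacobiStructure I N // IsAffineFor fn J}) :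
    IsRelated φ J.1
      (h.hullJacobi (h.linearizationEquiv hex J).1 (h.linearizationEquiv hex J).2) := by
  have hrel := h.isRelated_restrict (h.linearizationEquiv hex J).1 (h.linearizationEquiv hex J).2
  rwa [h.restrict_linearizationEquiv] at hrel

end Correspondence

end IsHull

end Hulls

/-! ### Elements of the hull -/

section HullEval

variable {M : Type*} {F : Type*} {V : M → Type*} [∀ x, AddCommGroup (V x)] [∀ x, Module ℝ (V x)]
  {A : M → Type*} [∀ x, AddTorsor (V x) (A x)]

theorem Hull.eval_smul {x : M} (s : ℝ) (ψ : Hull F A x) (a : A x →ᵃ[ℝ] ℝ) :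
    (s • ψ).eval a = s * ψ.eval a := rfl

theorem Hull.eval_add_right {x : M} (ψ : Hull F A x) (a b : A x →ᵃ[ℝ] ℝ) :
    ψ.eval (a + b) = ψ.eval a + ψ.eval b := LinearMap.map_add _ _ _

theorem Hull.eval_smul_right {x : M} (ψ : Hull F A x) (c : ℝ) (a : A x →ᵃ[ℝ] ℝ) :
    ψ.eval (c • a) = c * ψ.eval a := LinearMap.map_smul _ _ _

end HullEval

/-! ### Smooth functions and maps on affine bundles and their hulls -/

theorem eventually_mem_baseSet {M F : Type*} [TopologicalSpace M] [TopologicalSpace F]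
    {A : M → Type*} [TopologicalSpace (TotalSpace F A)] [∀ x, TopologicalSpace (A x)]
    [FiberBundle F A] (x : M) : ∀ᶠ y in 𝓝 x, y ∈ (trivializationAt F A x).baseSet :=
  (trivializationAt F A x).open_baseSet.mem_nhds (mem_baseSet_trivializationAt F A x)

section BundleCalculus

variable {EM : Type*} [NormedAddCommGroup EM] [NormedSpace ℝ EM]
  {M : Type*} [TopologicalSpace M] [ChartedSpace EM M]
  {F : Type*} [NormedAddCommGroup F] [NormedSpace ℝ F]
  {V : M → Type*} [∀ x, AddCommGroup (V x)] [∀ x, Module ℝ (V x)]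
  {A : M → Type*} [∀ x, AddTorsor (V x) (A x)]
  [TopologicalSpace (TotalSpace F A)] [∀ x, TopologicalSpace (A x)]
  [FiberBundle F A]

section Trivializations

variable [IsAffineBundle F A]

theorem trivialization_symm_apply (e : Trivialization F (π F A)) [MemTrivializationAtlas e] {x : M}
    (hx : x ∈ e.baseSet) (v : F) :
    e.toOpenPartialHomeomorph.symm (x, v) = ⟨x, (fibreAff F A e x).symm v⟩ := by
  have hs : (⟨x, (fibreAff F A e x).symm v⟩ : TotalSpace F A) ∈ e.source := by
    rw [e.mem_source]; exact hx
  have hv : e ⟨x, (fibreAff F A e x).symm v⟩ = (x, v) := by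
    refine Prod.ext (e.coe_fst' hx) ?_
    rw [← fibreAff_apply F A e hx, AffineEquiv.apply_symm_apply]
  rw [← hv]
  exact e.toOpenPartialHomeomorph.left_inv hs

/-- The affine function `p ↦ c (1, p)` on a fibre, where the fibre is identified with the affine
hyperplane `{1} × F` of `ℝ × F` by a trivialization. -/
def trivializedAffineMap (e : Trivialization F (π F A)) [MemTrivializationAtlas e] (x : M)
    (c : Dual ℝ (ℝ × F)) : A x →ᵃ[ℝ] ℝ :=
  (c ∘ₗ LinearMap.inr ℝ ℝ F).toAffineMap.comp (fibreAff F A e x).toAffineMap +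
    AffineMap.const ℝ (A x) (c (1, 0))

theorem trivializedAffineMap_apply (e : Trivialization F (π F A)) [MemTrivializationAtlas e]
    (x : M) (c : Dual ℝ (ℝ × F)) (p : A x) :
    trivializedAffineMap e x c p = c (1, fibreAff F A e x p) := by
  change c (0, _) + c (1, 0) = _
  rw [← map_add]
  simp

variable [FiniteDimensional ℝ F]

theorem trivializationAt_hull_apply (x : M) (ψ : TotalSpace (ℝ × F) (Hull F A)) :
    trivializationAt (ℝ × F) (Hull F A) x ψ =
      (ψ.1, hullFibre F A (trivializationAt F A x) ψ.1 ψ.2) := rfl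

theorem Hull.eval_eq (e : Trivialization F (π F A)) [MemTrivializationAtlas e] {x : M}
    (ψ : Hull F A x) (a : A x →ᵃ[ℝ] ℝ) :
    ψ.eval a = a ((fibreAff F A e x).symm (hullFibre F A e x ψ).2) +
      ((hullFibre F A e x ψ).1 - 1) * a ((fibreAff F A e x).symm 0) := by
  have hψ : ψ.eval a = Hull.eval ((hullFibre F A e x).symm (hullFibre F A e x ψ)) a := by
    rw [LinearEquiv.symm_apply_apply]
  have heval : Hull.eval ((hullFibre F A e x).symm (hullFibre F A e x ψ)) a =
      (hullFibre F A e x ψ).1 * a ((fibreAff F A e x).symm 0) +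
        (a.comp (fibreAff F A e x).symm.toAffineMap).linear (hullFibre F A e x ψ).2 := rfl
  have hdecomp := congrFun (AffineMap.decomp (a.comp (fibreAff F A e x).symm.toAffineMap))
    (hullFibre F A e x ψ).2
  simp only [Pi.add_apply, AffineMap.coe_comp, Function.comp_apply,
    AffineEquiv.coe_toAffineMap] at hdecomp
  rw [hψ, heval, hdecomp]
  ring

theorem Hull.eval_trivializedAffineMap (e : Trivialization F (π F A)) [MemTrivializationAtlas e]
    {x : M} (ψ : Hull F A x) (c : Dual ℝ (ℝ × F)) :
    ψ.eval (trivializedAffineMap e x c) = c (hullFibre F A e x ψ) := by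
  rw [Hull.eval_eq e, trivializedAffineMap_apply, trivializedAffineMap_apply,
    AffineEquiv.apply_symm_apply, AffineEquiv.apply_symm_apply, ← smul_eq_mul, ← map_smul,
    ← map_add]
  congr 1
  ext <;> simp

theorem hullFibre_fst (e : Trivialization F (π F A)) [MemTrivializationAtlas e] {x : M}
    (ψ : Hull F A x) : (hullFibre F A e x ψ).1 = ψ.eval (AffineMap.const ℝ (A x) 1) := rfl

theorem hullFibre_inclHull (e : Trivialization F (π F A)) [MemTrivializationAtlas e]
    (p : TotalSpace F A) :
    hullFibre F A e p.1 (inclHull F A p).2 = (1, fibreAff F A e p.1 p.2) := by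
  refine Prod.ext rfl ?_
  change (evalEquiv ℝ F).symm _ = _
  rw [LinearEquiv.symm_apply_eq]
  rfl

end Trivializations

section Smoothness

variable [IsSmoothAffineBundle F A 𝓘(ℝ, EM)]
  {EX : Type*} [NormedAddCommGroup EX] [NormedSpace ℝ EX]
  {HX : Type*} [TopologicalSpace HX] {IX : ModelWithCorners ℝ EX HX}
  {X : Type*} [TopologicalSpace X] [ChartedSpace HX X]

theorem contMDiffOn_fibreAff_change (x x' : M) :
    ContMDiffOn (𝓘(ℝ, EM).prod 𝓘(ℝ, F)) 𝓘(ℝ, F) ∞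
      (fun q : M × F => fibreAff F A (trivializationAt F A x') q.1
        ((fibreAff F A (trivializationAt F A x) q.1).symm q.2))
      (((trivializationAt F A x).baseSet ∩ (trivializationAt F A x').baseSet) ×ˢ univ) := by
  refine (‹IsSmoothAffineBundle F A 𝓘(ℝ, EM)›.smooth (trivializationAt F A x)
    (trivializationAt F A x')).congr fun q hq => ?_
  rw [show q = (q.1, q.2) from rfl, trivialization_symm_apply _ hq.1.1, fibreAff_apply F A _ hq.1.2]

theorem contMDiffAt_fibreAff_change {b : X → M} {v : X → F} {y : X} {x x' : M}
    (hb : ContMDiffAt IX 𝓘(ℝ, EM) ∞ b y) (hv : ContMDiffAt IX 𝓘(ℝ, F) ∞ v y)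
    (hx : b y ∈ (trivializationAt F A x).baseSet) (hx' : b y ∈ (trivializationAt F A x').baseSet) :
    ContMDiffAt IX 𝓘(ℝ, F) ∞ (fun z => fibreAff F A (trivializationAt F A x') (b z)
        ((fibreAff F A (trivializationAt F A x) (b z)).symm (v z))) y := by
  have hn : ((trivializationAt F A x).baseSet ∩ (trivializationAt F A x').baseSet) ×ˢ
      (univ : Set F) ∈ 𝓝 (b y, v y) :=
    (((trivializationAt F A x).open_baseSet.inter
      (trivializationAt F A x').open_baseSet).prod isOpen_univ).mem_nhds ⟨⟨hx, hx'⟩, mem_univ _⟩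
  exact ((contMDiffOn_fibreAff_change x x').contMDiffAt hn).comp y (hb.prodMk hv)

theorem contMDiffAt_fibreAff {x : M} {p : TotalSpace F A}
    (hp : p.1 ∈ (trivializationAt F A x).baseSet) :
    ContMDiffAt (𝓘(ℝ, EM).prod 𝓘(ℝ, F)) 𝓘(ℝ, F) ∞
      (fun q : TotalSpace F A => fibreAff F A (trivializationAt F A x) q.1 q.2) p := by
  have hid : ContMDiffAt (𝓘(ℝ, EM).prod 𝓘(ℝ, F)) (𝓘(ℝ, EM).prod 𝓘(ℝ, F)) ∞
      (id : TotalSpace F A → TotalSpace F A) p := contMDiffAt_id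
  rw [contMDiffAt_totalSpace] at hid
  refine (contMDiffAt_fibreAff_change hid.1 hid.2 (x := p.1)
    (mem_baseSet_trivializationAt F A p.1) hp).congr_of_eventuallyEq ?_
  filter_upwards [(FiberBundle.continuous_proj F A).continuousAt.eventually
    (eventually_mem_baseSet (F := F) (A := A) p.1)] with q hq
  change _ = fibreAff F A _ q.1 ((fibreAff F A _ q.1).symm (trivializationAt F A p.1 ⟨q.1, q.2⟩).2)
  rw [← fibreAff_apply F A _ hq, AffineEquiv.symm_apply_apply]

theorem contMDiffAt_fibreAff_symm {b : X → M} {v : X → F} {y : X} {x : M}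
    (hb : ContMDiffAt IX 𝓘(ℝ, EM) ∞ b y) (hv : ContMDiffAt IX 𝓘(ℝ, F) ∞ v y)
    (hx : b y ∈ (trivializationAt F A x).baseSet) :
    ContMDiffAt IX (𝓘(ℝ, EM).prod 𝓘(ℝ, F)) ∞
      (fun z => (⟨b z, (fibreAff F A (trivializationAt F A x) (b z)).symm (v z)⟩ :
        TotalSpace F A)) y := by
  rw [contMDiffAt_totalSpace]
  refine ⟨hb, (contMDiffAt_fibreAff_change hb hv hx
    (mem_baseSet_trivializationAt F A (b y))).congr_of_eventuallyEq ?_⟩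
  filter_upwards [hb.continuousAt.eventually
    (eventually_mem_baseSet (F := F) (A := A) (b y))] with z hz
  rw [fibreAff_apply F A _ hz]

variable [FiniteDimensional ℝ F]

theorem contMDiffAt_hullFibre_change {b : X → M} {w : X → ℝ × F} {y : X} {x x' : M}
    (hb : ContMDiffAt IX 𝓘(ℝ, EM) ∞ b y) (hw : ContMDiffAt IX 𝓘(ℝ, ℝ × F) ∞ w y)
    (hx : b y ∈ (trivializationAt F A x).baseSet) (hx' : b y ∈ (trivializationAt F A x').baseSet) :
    ContMDiffAt IX 𝓘(ℝ, ℝ × F) ∞ (fun z => hullFibre F A (trivializationAt F A x') (b z)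
        ((hullFibre F A (trivializationAt F A x) (b z)).symm (w z))) y := by
  have hs : ContMDiffAt IX 𝓘(ℝ, ℝ) ∞ (fun z => (w z).1) y :=
    (ContinuousLinearMap.fst ℝ ℝ F).contMDiff.contMDiffAt.comp y hw
  have hv : ContMDiffAt IX 𝓘(ℝ, F) ∞ (fun z => (w z).2) y :=
    (ContinuousLinearMap.snd ℝ ℝ F).contMDiff.contMDiffAt.comp y hw
  have hpoint := contMDiffAt_fibreAff_change (A := A) hb hv hx hx'
  have horigin := contMDiffAt_fibreAff_change (A := A) hb (contMDiffAt_const (c := (0 : F))) hx hx'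
  exact (hs.prodMk_space ((hs.smul horigin).add (hpoint.sub horigin))).congr_of_eventuallyEq
    (Filter.Eventually.of_forall fun z => hullCoord_comp_symm F _ _ (w z))

theorem contMDiffAt_hullFibre {x : M} {ψ : TotalSpace (ℝ × F) (Hull F A)}
    (hψ : ψ.1 ∈ (trivializationAt F A x).baseSet) :
    ContMDiffAt (𝓘(ℝ, EM).prod 𝓘(ℝ, ℝ × F)) 𝓘(ℝ, ℝ × F) ∞
      (fun η : TotalSpace (ℝ × F) (Hull F A) =>
        hullFibre F A (trivializationAt F A x) η.1 η.2) ψ := by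
  have hid : ContMDiffAt (𝓘(ℝ, EM).prod 𝓘(ℝ, ℝ × F)) (𝓘(ℝ, EM).prod 𝓘(ℝ, ℝ × F)) ∞
      (id : TotalSpace (ℝ × F) (Hull F A) → TotalSpace (ℝ × F) (Hull F A)) ψ := contMDiffAt_id
  rw [contMDiffAt_totalSpace] at hid
  refine (contMDiffAt_hullFibre_change hid.1 hid.2 (x := ψ.1)
    (mem_baseSet_trivializationAt F A ψ.1) hψ).congr_of_eventuallyEq
    (Filter.Eventually.of_forall fun η => ?_)
  exact (congrArg (hullFibre F A _ η.1) (LinearEquiv.symm_apply_apply _ _)).symm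

theorem contMDiffAt_hull_mk {ψ : X → TotalSpace (ℝ × F) (Hull F A)} {y : X}
    (hb : ContMDiffAt IX 𝓘(ℝ, EM) ∞ (fun z => (ψ z).1) y)
    (hψ : ContMDiffAt IX 𝓘(ℝ, ℝ × F) ∞
      (fun z => hullFibre F A (trivializationAt F A (ψ y).1) (ψ z).1 (ψ z).2) y) :
    ContMDiffAt IX (𝓘(ℝ, EM).prod 𝓘(ℝ, ℝ × F)) ∞ ψ y := by
  rw [contMDiffAt_totalSpace]
  exact ⟨hb, hψ⟩

theorem contMDiff_inclHull : ContMDiff (𝓘(ℝ, EM).prod 𝓘(ℝ, F)) (𝓘(ℝ, EM).prod 𝓘(ℝ, ℝ × F)) ∞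
    (inclHull F A) := by
  intro p
  refine contMDiffAt_hull_mk (contMDiffAt_proj A) ?_
  have h := contMDiffAt_fibreAff (EM := EM) (mem_baseSet_trivializationAt F A p.1)
  exact ((contMDiffAt_const (c := (1 : ℝ))).prodMk_space h).congr_of_eventuallyEq
    (Filter.Eventually.of_forall fun q => hullFibre_inclHull _ q)

/-- The inclusion of `A` into its vector hull followed by the homothety of ratio `t`; for `t ≠ 0`
these maps foliate the part of the hull where `iotaOne` does not vanish. -/
def scaledIncl (t : ℝ) (p : TotalSpace F A) : TotalSpace (ℝ × F) (Hull F A) :=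
  ⟨p.1, t • (inclHull F A p).2⟩

theorem contMDiff_scaledIncl (t : ℝ) : ContMDiff (𝓘(ℝ, EM).prod 𝓘(ℝ, F))
    (𝓘(ℝ, EM).prod 𝓘(ℝ, ℝ × F)) ∞ (scaledIncl (F := F) (A := A) t) := by
  intro p
  refine contMDiffAt_hull_mk (contMDiffAt_proj A) ?_
  have h := contMDiffAt_fibreAff (EM := EM) (mem_baseSet_trivializationAt F A p.1)
  have ht : ContMDiffAt (𝓘(ℝ, EM).prod 𝓘(ℝ, F)) 𝓘(ℝ, ℝ) ∞ (fun _ : TotalSpace F A => t) p :=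
    contMDiffAt_const
  refine ht.smul ((contMDiffAt_const (c := (1 : ℝ))).prodMk_space h)
    |>.congr_of_eventuallyEq (Filter.Eventually.of_forall fun q => ?_)
  exact (map_smul _ _ _).trans (congrArg (t • ·) (hullFibre_inclHull _ q))

theorem contMDiff_hull_line {x : M} (ψ η : Hull F A x) {r : ℝ → ℝ} {s : ℝ → ℝ}
    (hr : ContDiff ℝ ∞ r) (hs : ContDiff ℝ ∞ s) :
    ContMDiff 𝓘(ℝ, ℝ) (𝓘(ℝ, EM).prod 𝓘(ℝ, ℝ × F)) ∞
      (fun t : ℝ => (⟨x, r t • ψ + s t • η⟩ : TotalSpace (ℝ × F) (Hull F A))) := by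
  intro t
  refine contMDiffAt_hull_mk contMDiffAt_const ?_
  simp only [map_add, map_smul]
  exact ((hr.smul contDiff_const).add (hs.smul contDiff_const)).contMDiff.contMDiffAt

theorem AffineFunction.bar_eq (a : AffineFunction 𝓘(ℝ, EM) F A) (x : M)
    (ψ : TotalSpace (ℝ × F) (Hull F A)) : a.bar ψ =
      a.fn ⟨ψ.1, (fibreAff F A (trivializationAt F A x) ψ.1).symm
        (hullFibre F A (trivializationAt F A x) ψ.1 ψ.2).2⟩ +
      ((hullFibre F A (trivializationAt F A x) ψ.1 ψ.2).1 - 1) *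
        a.fn ⟨ψ.1, (fibreAff F A (trivializationAt F A x) ψ.1).symm 0⟩ :=
  Hull.eval_eq _ _ _

theorem AffineFunction.smoothFun_bar (a : AffineFunction 𝓘(ℝ, EM) F A) :
    SmoothFun (𝓘(ℝ, EM).prod 𝓘(ℝ, ℝ × F)) a.bar := by
  intro ψ
  have hx := mem_baseSet_trivializationAt F A ψ.1
  have hw := contMDiffAt_hullFibre (EM := EM) (ψ := ψ) hx
  have hscale : ContMDiffAt (𝓘(ℝ, EM).prod 𝓘(ℝ, ℝ × F)) 𝓘(ℝ, ℝ) ∞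
      (fun η : TotalSpace (ℝ × F) (Hull F A) =>
        (hullFibre F A (trivializationAt F A ψ.1) η.1 η.2).1) ψ :=
    (ContinuousLinearMap.fst ℝ ℝ F).contMDiff.contMDiffAt.comp ψ hw
  have hvec : ContMDiffAt (𝓘(ℝ, EM).prod 𝓘(ℝ, ℝ × F)) 𝓘(ℝ, F) ∞
      (fun η : TotalSpace (ℝ × F) (Hull F A) =>
        (hullFibre F A (trivializationAt F A ψ.1) η.1 η.2).2) ψ :=
    (ContinuousLinearMap.snd ℝ ℝ F).contMDiff.contMDiffAt.comp ψ hw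
  have hpoint := (a.smooth _).comp ψ
    (contMDiffAt_fibreAff_symm (A := A) (contMDiffAt_proj (Hull F A)) hvec hx)
  have horigin := (a.smooth _).comp ψ
    (contMDiffAt_fibreAff_symm (A := A) (contMDiffAt_proj (Hull F A))
      (contMDiffAt_const (c := (0 : F))) hx)
  have hsum := hpoint.add ((hscale.sub (contMDiffAt_const (c := (1 : ℝ)))).mul horigin)
  exact hsum.congr_of_eventuallyEq (.of_forall fun η => a.bar_eq ψ.1 η)

end Smoothness

end BundleCalculus

/-! ### Affine functions and coordinates on affine bundles and their hulls -/

section AffineFunctions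

variable {EM : Type*} [NormedAddCommGroup EM] [NormedSpace ℝ EM]
  {M : Type*} [TopologicalSpace M] [ChartedSpace EM M]
  {F : Type*} [NormedAddCommGroup F] [NormedSpace ℝ F]
  {V : M → Type*} [∀ x, AddCommGroup (V x)] [∀ x, Module ℝ (V x)]
  {A : M → Type*} [∀ x, AddTorsor (V x) (A x)]
  [TopologicalSpace (TotalSpace F A)] [∀ x, TopologicalSpace (A x)]
  [FiberBundle F A]

/-- The sum of affine functions. -/
def AffineFunction.add (a b : AffineFunction 𝓘(ℝ, EM) F A) : AffineFunction 𝓘(ℝ, EM) F A where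
  onFibre x := a.onFibre x + b.onFibre x
  smooth := a.smooth.add b.smooth

variable (EM F A) in
/-- The constant affine function `1`. -/
def AffineFunction.one : AffineFunction 𝓘(ℝ, EM) F A where
  onFibre x := AffineMap.const ℝ (A x) 1
  smooth := contMDiff_const

theorem smoothFun_comp_proj {f : M → ℝ} (hf : SmoothFun 𝓘(ℝ, EM) f) :
    SmoothFun (𝓘(ℝ, EM).prod 𝓘(ℝ, F)) (f ∘ π F A) :=
  ContMDiff.comp hf (contMDiff_proj A)

/-- The product of a function on the base and an affine function. -/
def AffineFunction.mulBase {f : M → ℝ} (hf : SmoothFun 𝓘(ℝ, EM) f)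
    (a : AffineFunction 𝓘(ℝ, EM) F A) : AffineFunction 𝓘(ℝ, EM) F A where
  onFibre x := f x • a.onFibre x
  smooth := (smoothFun_comp_proj hf).mul a.smooth

theorem AffineFunction.fn_add (a b : AffineFunction 𝓘(ℝ, EM) F A) :
    (a.add b).fn = a.fn + b.fn := rfl

theorem AffineFunction.fn_one : (AffineFunction.one EM F A).fn = 1 := rfl

theorem AffineFunction.fn_mulBase {f : M → ℝ} (hf : SmoothFun 𝓘(ℝ, EM) f)
    (a : AffineFunction 𝓘(ℝ, EM) F A) : (a.mulBase hf).fn = (f ∘ π F A) * a.fn := rfl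

theorem AffineFunction.bar_add (a b : AffineFunction 𝓘(ℝ, EM) F A) :
    (a.add b).bar = a.bar + b.bar := funext fun _ => Hull.eval_add_right _ _ _

theorem AffineFunction.bar_mulBase {f : M → ℝ} (hf : SmoothFun 𝓘(ℝ, EM) f)
    (a : AffineFunction 𝓘(ℝ, EM) F A) :
    (a.mulBase hf).bar = (f ∘ π (ℝ × F) (Hull F A)) * a.bar :=
  funext fun _ => Hull.eval_smul_right _ _ _

theorem AffineFunction.bar_one : (AffineFunction.one EM F A).bar = iotaOne F A := rfl

theorem AffineFunction.bar_congr {a b : AffineFunction 𝓘(ℝ, EM) F A} (h : a.fn = b.fn) :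
    a.bar = b.bar := by
  ext ψ
  have hfibre : a.onFibre ψ.1 = b.onFibre ψ.1 := AffineMap.ext fun p => congrFun h ⟨ψ.1, p⟩
  exact congrArg ψ.2.eval hfibre

theorem extChartAt_totalSpace_eventuallyEq {F : Type*} [NormedAddCommGroup F] [NormedSpace ℝ F]
    {A : M → Type*} [TopologicalSpace (TotalSpace F A)] [∀ x, TopologicalSpace (A x)]
    [FiberBundle F A] {p : TotalSpace F A} {x : M} (hx : p.1 = x) :
    ∀ᶠ q in 𝓝 p, extChartAt (𝓘(ℝ, EM).prod 𝓘(ℝ, F)) p q =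
      (extChartAt 𝓘(ℝ, EM) x q.1, (trivializationAt F A x q).2) := by
  subst hx
  filter_upwards [(FiberBundle.continuous_proj F A).continuousAt.eventually
    (eventually_mem_baseSet (F := F) (A := A) p.1)] with q hq
  rw [FiberBundle.extChartAt]
  refine Prod.ext ?_ rfl
  exact congrArg (extChartAt 𝓘(ℝ, EM) p.1) ((trivializationAt F A p.1).coe_fst' hq)

section Bump

variable [FiniteDimensional ℝ EM] [IsManifold 𝓘(ℝ, EM) ∞ M] [T2Space M]

theorem exists_smoothFun_bump {x : M} {U : Set M} (hU : U ∈ 𝓝 x) :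
    ∃ χ : M → ℝ, SmoothFun 𝓘(ℝ, EM) χ ∧ χ =ᶠ[𝓝 x] 1 ∧ tsupport χ ⊆ U := by
  obtain ⟨f, -, hf⟩ := (SmoothBumpFunction.nhds_basis_tsupport (I := 𝓘(ℝ, EM)) x).mem_iff.1 hU
  exact ⟨f, f.contMDiff, f.eventuallyEq_one, hf⟩

theorem exists_base_coord (x : M) (c : Dual ℝ EM) : ∃ f : M → ℝ, SmoothFun 𝓘(ℝ, EM) f ∧
    f =ᶠ[𝓝 x] fun y => c (extChartAt 𝓘(ℝ, EM) x y) := by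
  obtain ⟨χ, hχ, hχ1, hχs⟩ := exists_smoothFun_bump (EM := EM) (chart_source_mem_nhds EM x)
  refine ⟨fun y => χ y * c (extChartAt 𝓘(ℝ, EM) x y), ?_, ?_⟩
  · refine contMDiff_of_tsupport fun y hy => ?_
    have hy' : y ∈ (chartAt EM x).source := hχs (tsupport_mul_subset_left hy)
    exact (hχ y).mul ((LinearMap.toContinuousLinearMap c).contMDiff.contMDiffAt.comp y
      (contMDiffAt_extChartAt' hy'))
  · filter_upwards [hχ1] with y hy
    simp [hy]

theorem containsCoordinates_smooth :
    ContainsCoordinates 𝓘(ℝ, EM) {f : M → ℝ | SmoothFun 𝓘(ℝ, EM) f} :=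
  ⟨fun _ hf => hf, exists_base_coord⟩

theorem exists_affineFunction_eq_trivializedAffineMap [IsSmoothAffineBundle F A 𝓘(ℝ, EM)]
    [FiniteDimensional ℝ F] (x : M) (c : Dual ℝ (ℝ × F)) : ∃ a : AffineFunction 𝓘(ℝ, EM) F A,
      ∀ᶠ y in 𝓝 x, a.onFibre y = trivializedAffineMap (trivializationAt F A x) y c := by
  obtain ⟨χ, hχ, hχ1, hχs⟩ := exists_smoothFun_bump (EM := EM)
    (eventually_mem_baseSet (F := F) (A := A) x)
  refine ⟨⟨fun y => χ y • trivializedAffineMap (trivializationAt F A x) y c, fun p => ?_⟩, ?_⟩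
  · change ContMDiffAt _ _ _ (fun p : TotalSpace F A =>
      χ p.1 * trivializedAffineMap (trivializationAt F A x) p.1 c p.2) p
    by_cases hp : p.1 ∈ tsupport χ
    · refine (ContMDiffAt.comp p (hχ p.1) (contMDiffAt_proj A)).mul ?_
      simp only [trivializedAffineMap_apply]
      exact (LinearMap.toContinuousLinearMap c).contMDiff.contMDiffAt.comp p
        ((contMDiffAt_const (c := (1 : ℝ))).prodMk_space (contMDiffAt_fibreAff (hχs hp)))
    · refine (contMDiffAt_const (c := (0 : ℝ))).congr_of_eventuallyEq ?_
      filter_upwards [(FiberBundle.continuous_proj F A).continuousAt.eventually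
        (notMem_tsupport_iff_eventuallyEq.1 hp)] with q hq
      rw [hq, Pi.zero_apply, zero_mul]
  · filter_upwards [hχ1] with y hy
    rw [hy, Pi.one_apply, one_smul]

end Bump

variable [FiniteDimensional ℝ EM] [IsManifold 𝓘(ℝ, EM) ∞ M] [T2Space M]

/-- A function on the base that represents a covector at a point, in the preferred chart. -/
def baseCoord (x : M) (c : Dual ℝ EM) : M → ℝ := (exists_base_coord x c).choose

theorem smoothFun_baseCoord (x : M) (c : Dual ℝ EM) : SmoothFun 𝓘(ℝ, EM) (baseCoord x c) :=
  (exists_base_coord x c).choose_spec.1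

theorem baseCoord_eventuallyEq (x : M) (c : Dual ℝ EM) :
    baseCoord x c =ᶠ[𝓝 x] fun y => c (extChartAt 𝓘(ℝ, EM) x y) :=
  (exists_base_coord x c).choose_spec.2

variable [FiniteDimensional ℝ F] [IsSmoothAffineBundle F A 𝓘(ℝ, EM)]

/-- An affine function that represents an element of the dual of `ℝ × F` near a point of the base,
in the preferred trivialization. -/
def fibreCoord (x : M) (c : Dual ℝ (ℝ × F)) : AffineFunction 𝓘(ℝ, EM) F A :=
  (exists_affineFunction_eq_trivializedAffineMap x c).choose

theorem fibreCoord_eventually (x : M) (c : Dual ℝ (ℝ × F)) :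
    ∀ᶠ y in 𝓝 x, (fibreCoord (A := A) (EM := EM) x c).onFibre y =
      trivializedAffineMap (trivializationAt F A x) y c :=
  (exists_affineFunction_eq_trivializedAffineMap x c).choose_spec

theorem containsCoordinates_affine : ContainsCoordinates (𝓘(ℝ, EM).prod 𝓘(ℝ, F))
    (range (AffineFunction.fn (I := 𝓘(ℝ, EM)) (F := F) (E := A))) := by
  refine ⟨?_, fun p c => ?_⟩
  · rintro _ ⟨a, rfl⟩
    exact a.smooth
  · let c₁ : Dual ℝ EM := c ∘ₗ LinearMap.inl ℝ EM F
    let c₂ : Dual ℝ (ℝ × F) := c ∘ₗ LinearMap.inr ℝ EM F ∘ₗ LinearMap.snd ℝ ℝ F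
    refine ⟨_, ⟨((AffineFunction.one EM F A).mulBase (smoothFun_baseCoord p.1 c₁)).add
      (fibreCoord p.1 c₂), rfl⟩, ?_⟩
    have hπ := (FiberBundle.continuous_proj F A).continuousAt (x := p)
    filter_upwards [extChartAt_totalSpace_eventuallyEq (EM := EM) (p := p) rfl,
      hπ.eventually (fibreCoord_eventually (EM := EM) (A := A) p.1 c₂),
      hπ.eventually (baseCoord_eventuallyEq (EM := EM) p.1 c₁),
      hπ.eventually (eventually_mem_baseSet (F := F) (A := A) p.1)] with q hchart hfibre hbase hq
    rw [hchart, AffineFunction.fn_add, AffineFunction.fn_mulBase, AffineFunction.fn_one]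
    simp only [Pi.add_apply, Function.comp_apply, mul_one, hbase]
    rw [AffineFunction.fn, hfibre, trivializedAffineMap_apply, fibreAff_apply F A _ hq]
    change c (_, 0) + c (0, _) = _
    rw [← map_add]
    simp

/-- A function on the hull that represents a covector at a point, in the preferred chart. -/
def hullCoordFun (x : M) (c : Dual ℝ (EM × (ℝ × F))) : TotalSpace (ℝ × F) (Hull F A) → ℝ :=
  (fibreCoord (EM := EM) (A := A) x (c ∘ₗ LinearMap.inr ℝ EM (ℝ × F))).bar +
    baseCoord x (c ∘ₗ LinearMap.inl ℝ EM (ℝ × F)) ∘ π (ℝ × F) (Hull F A)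

theorem hullCoordFun_eventuallyEq {x : M} (c : Dual ℝ (EM × (ℝ × F)))
    {ψ : TotalSpace (ℝ × F) (Hull F A)} (hψ : ψ.1 = x) : hullCoordFun (A := A) x c =ᶠ[𝓝 ψ]
      fun η => c (extChartAt (𝓘(ℝ, EM).prod 𝓘(ℝ, ℝ × F)) ψ η) := by
  have hπ := (FiberBundle.continuous_proj (ℝ × F) (Hull F A)).continuousAt (x := ψ)
  subst hψ
  filter_upwards [extChartAt_totalSpace_eventuallyEq (EM := EM) (p := ψ) rfl,
    hπ.eventually (fibreCoord_eventually (EM := EM) (A := A) ψ.1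
      (c ∘ₗ LinearMap.inr ℝ EM (ℝ × F))),
    hπ.eventually (baseCoord_eventuallyEq (EM := EM) ψ.1 (c ∘ₗ LinearMap.inl ℝ EM (ℝ × F)))]
    with η hchart hfibre hbase
  rw [hchart, hullCoordFun]
  simp only [Pi.add_apply, Function.comp_apply, hbase]
  rw [AffineFunction.bar, hfibre, Hull.eval_trivializedAffineMap, trivializationAt_hull_apply]
  change c (0, _) + c (_, 0) = _
  rw [← map_add]
  simp

theorem containsCoordinates_hull : ContainsCoordinates (𝓘(ℝ, EM).prod 𝓘(ℝ, ℝ × F))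
    {G : TotalSpace (ℝ × F) (Hull F A) → ℝ | ∃ (a : AffineFunction 𝓘(ℝ, EM) F A) (f : M → ℝ),
      SmoothFun 𝓘(ℝ, EM) f ∧ G = a.bar + f ∘ π (ℝ × F) (Hull F A)} := by
  refine ⟨?_, fun ψ c => ⟨hullCoordFun ψ.1 c, ⟨_, _, smoothFun_baseCoord _ _, rfl⟩,
    hullCoordFun_eventuallyEq c rfl⟩⟩
  rintro _ ⟨a, f, hf, rfl⟩
  exact a.smoothFun_bar.add (smoothFun_comp_proj hf)

theorem containsCoordinates_hull_smooth : ContainsCoordinates (𝓘(ℝ, EM).prod 𝓘(ℝ, ℝ × F))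
    {G : TotalSpace (ℝ × F) (Hull F A) → ℝ | SmoothFun (𝓘(ℝ, EM).prod 𝓘(ℝ, ℝ × F)) G} :=
  containsCoordinates_hull.mono (fun _ hG => containsCoordinates_hull.smooth _ hG) fun _ hG => hG

end AffineFunctions

/-! ### The vector hull as a hull -/

section VectorHull

theorem apply_one_eq_deriv_zero_of_euler {h : ℝ → ℝ} (hd : Differentiable ℝ h)
    (he : ∀ s, s * deriv h s = h s) : h 1 = deriv h 0 := by
  have h_zero : h 0 = 0 := by rw [← he, zero_mul]
  have h_deriv : ∀ s ∈ Ioi (0 : ℝ), HasDerivAt (fun s => h s / s) 0 s := by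
    intro s hs
    refine ((hd s).hasDerivAt.div (hasDerivAt_id s) (ne_of_gt hs)).congr_deriv ?_
    simp only [id, mul_one]
    rw [mul_comm, he, sub_self, zero_div]
  have h_const : ∀ s ∈ Ioi (0 : ℝ), h s / s = h 1 := by
    intro s hs
    rw [← div_one (h 1)]
    exact isOpen_Ioi.is_const_of_deriv_eq_zero isPreconnected_Ioi
      (fun t ht => (h_deriv t ht).differentiableAt.differentiableWithinAt)
      (fun t ht => (h_deriv t ht).deriv) hs (mem_Ioi.2 one_pos)
  have h_slope := (hasDerivAt_iff_tendsto_slope_zero.1 (hd 0).hasDerivAt).mono_left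
    (nhdsGT_le_nhdsNE (0 : ℝ))
  refine tendsto_nhds_unique (tendsto_const_nhds.congr' ?_) h_slope
  filter_upwards [self_mem_nhdsWithin] with s hs
  rw [zero_add, h_zero, sub_zero, smul_eq_mul, ← h_const s hs, div_eq_inv_mul]

theorem eq_fderiv_zero_of_euler {W : Type*} [NormedAddCommGroup W] [NormedSpace ℝ W] {G : W → ℝ}
    (hG : Differentiable ℝ G) (he : ∀ w, fderiv ℝ G w w = G w) (w : W) :
    G w = fderiv ℝ G 0 w := by
  have h_ray : ∀ s : ℝ, HasDerivAt (fun s : ℝ => G (s • w)) (fderiv ℝ G (s • w) w) s := fun s => by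
    refine (hG (s • w)).hasFDerivAt.comp_hasDerivAt s ?_
    simpa using (hasDerivAt_id s).smul_const w
  have h_one := apply_one_eq_deriv_zero_of_euler (fun s => (h_ray s).differentiableAt)
    fun s => by rw [(h_ray s).deriv, ← smul_eq_mul, ← map_smul, he]
  rwa [(h_ray 0).deriv, one_smul, zero_smul] at h_one

variable {EM : Type*} [NormedAddCommGroup EM] [NormedSpace ℝ EM]
  {M : Type*} [TopologicalSpace M] [ChartedSpace EM M]
  {F : Type*} [NormedAddCommGroup F] [NormedSpace ℝ F] [FiniteDimensional ℝ F]
  {V : M → Type*} [∀ x, AddCommGroup (V x)] [∀ x, Module ℝ (V x)]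
  {A : M → Type*} [∀ x, AddTorsor (V x) (A x)]
  [TopologicalSpace (TotalSpace F A)] [∀ x, TopologicalSpace (A x)]
  [FiberBundle F A] [IsSmoothAffineBundle F A 𝓘(ℝ, EM)]

theorem contMDiff_hull_scaling (ψ : TotalSpace (ℝ × F) (Hull F A)) :
    ContMDiff 𝓘(ℝ, ℝ) (𝓘(ℝ, EM).prod 𝓘(ℝ, ℝ × F)) ∞
      (fun s : ℝ => (⟨ψ.1, s • ψ.2⟩ : TotalSpace (ℝ × F) (Hull F A))) := by
  have h := contMDiff_hull_line (EM := EM) ψ.2 0 (r := id) (s := fun _ => 0) contDiff_id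
    contDiff_const
  simpa only [smul_zero, add_zero, id] using h

theorem lieFun_liouville {G : TotalSpace (ℝ × F) (Hull F A) → ℝ}
    (hG : SmoothFun (𝓘(ℝ, EM).prod 𝓘(ℝ, ℝ × F)) G) (ψ : TotalSpace (ℝ × F) (Hull F A)) :
    lieFun (liouville 𝓘(ℝ, EM) F A) G ψ = deriv (fun s : ℝ => G ⟨ψ.1, s • ψ.2⟩) 1 := by
  have h_one : (fun s : ℝ => (⟨ψ.1, s • ψ.2⟩ : TotalSpace (ℝ × F) (Hull F A))) 1 = ψ := by
    simp only [one_smul]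
  have h_chain := mvfderiv_comp_apply_of_eq (1 : ℝ) (hG.mdifferentiableAt ψ)
    ((contMDiff_hull_scaling ψ 1).mdifferentiableAt (by simp)) h_one (1 : ℝ)
  refine h_chain.symm.trans ?_
  rw [mvfderiv, mfderiv_eq_fderiv]
  rfl

theorem lieFun_liouville_bar (a : AffineFunction 𝓘(ℝ, EM) F A) :
    lieFun (liouville 𝓘(ℝ, EM) F A) a.bar = a.bar := by
  ext ψ
  rw [lieFun_liouville a.smoothFun_bar]
  have h : (fun s : ℝ => a.bar ⟨ψ.1, s • ψ.2⟩) = fun s => s * a.bar ψ :=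
    funext fun s => Hull.eval_smul _ _ _
  rw [h, deriv_mul_const_field, deriv_id'', one_mul]

theorem lieFun_liouville_base {f : M → ℝ} (hf : SmoothFun 𝓘(ℝ, EM) f) :
    lieFun (liouville 𝓘(ℝ, EM) F A) (f ∘ π (ℝ × F) (Hull F A)) = 0 := by
  ext ψ
  rw [lieFun_liouville (smoothFun_comp_proj hf)]
  exact deriv_const (1 : ℝ) (f ψ.1)

theorem dif_bar_add_liouville (a : AffineFunction 𝓘(ℝ, EM) F A) {f : M → ℝ}
    (hf : SmoothFun 𝓘(ℝ, EM) f) (ψ : TotalSpace (ℝ × F) (Hull F A)) :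
    dif (𝓘(ℝ, EM).prod 𝓘(ℝ, ℝ × F)) (a.bar + f ∘ π (ℝ × F) (Hull F A)) ψ
      (liouville 𝓘(ℝ, EM) F A ψ) = a.bar ψ := by
  rw [← lieFun_apply, lieFun_add _ a.smoothFun_bar (smoothFun_comp_proj hf), lieFun_liouville_bar,
    lieFun_liouville_base hf, add_zero]

theorem dif_comp_mfderiv_scaledIncl (t : ℝ) (a : AffineFunction 𝓘(ℝ, EM) F A) {f : M → ℝ}
    (hf : SmoothFun 𝓘(ℝ, EM) f) (p : TotalSpace F A) :
    (dif (𝓘(ℝ, EM).prod 𝓘(ℝ, ℝ × F)) (a.bar + f ∘ π (ℝ × F) (Hull F A)) (scaledIncl t p)).comp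
        (mfderiv (𝓘(ℝ, EM).prod 𝓘(ℝ, F)) (𝓘(ℝ, EM).prod 𝓘(ℝ, ℝ × F))
          (scaledIncl t) p).toLinearMap =
      t • dif (𝓘(ℝ, EM).prod 𝓘(ℝ, F)) a.fn p +
        dif (𝓘(ℝ, EM).prod 𝓘(ℝ, F)) (f ∘ π F A) p := by
  have ha : SmoothFun (𝓘(ℝ, EM).prod 𝓘(ℝ, F)) a.fn := a.smooth
  have hta : SmoothFun (𝓘(ℝ, EM).prod 𝓘(ℝ, F)) (t • a.fn) := contMDiff_const.mul ha
  have hG : SmoothFun (𝓘(ℝ, EM).prod 𝓘(ℝ, ℝ × F)) (a.bar + f ∘ π (ℝ × F) (Hull F A)) :=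
    a.smoothFun_bar.add (smoothFun_comp_proj hf)
  rw [← dif_comp (hG.mdifferentiableAt _)
      ((contMDiff_scaledIncl t p).mdifferentiableAt (by simp)),
    ← dif_smul t (ha.mdifferentiableAt p),
    ← dif_add (hta.mdifferentiableAt p) ((smoothFun_comp_proj hf).mdifferentiableAt p)]
  rfl

theorem contDiff_comp_hullFibre_symm {G : TotalSpace (ℝ × F) (Hull F A) → ℝ}
    (hG : SmoothFun (𝓘(ℝ, EM).prod 𝓘(ℝ, ℝ × F)) G) (x : M) :
    ContDiff ℝ ∞ fun w : ℝ × F =>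
      G ⟨x, (hullFibre F A (trivializationAt F A x) x).symm w⟩ := by
  rw [← contMDiff_iff_contDiff]
  refine ContMDiff.comp hG fun w => contMDiffAt_hull_mk contMDiffAt_const ?_
  simp only [LinearEquiv.apply_symm_apply]
  exact contMDiffAt_id

theorem exists_dual_eq_on_fibre {G : TotalSpace (ℝ × F) (Hull F A) → ℝ}
    (hG : SmoothFun (𝓘(ℝ, EM).prod 𝓘(ℝ, ℝ × F)) G)
    (hΔ : lieFun (liouville 𝓘(ℝ, EM) F A) G = G) (x : M) :
    ∃ c : Dual ℝ (ℝ × F), ∀ ψ : Hull F A x,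
      G ⟨x, ψ⟩ = c (hullFibre F A (trivializationAt F A x) x ψ) := by
  have hGx := (contDiff_comp_hullFibre_symm hG x).differentiable (by simp)
  set e := hullFibre F A (trivializationAt F A x) x
  have h_euler : ∀ w, fderiv ℝ (fun w => G ⟨x, e.symm w⟩) w w = G ⟨x, e.symm w⟩ := fun w => by
    have h_ray : HasDerivAt (fun s : ℝ => G ⟨x, e.symm (s • w)⟩)
        (fderiv ℝ (fun w => G ⟨x, e.symm w⟩) w w) 1 := by
      refine HasFDerivAt.comp_hasDerivAt (f := fun s : ℝ => s • w) (1 : ℝ)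
        (by rw [one_smul]; exact (hGx w).hasFDerivAt) ?_
      simpa using (hasDerivAt_id (1 : ℝ)).smul_const w
    rw [← h_ray.deriv, ← congrFun hΔ ⟨x, e.symm w⟩, lieFun_liouville hG]
    simp only [map_smul]
  refine ⟨(fderiv ℝ (fun w => G ⟨x, e.symm w⟩) 0).toLinearMap, fun ψ => ?_⟩
  have h_lin := eq_fderiv_zero_of_euler hGx h_euler (e ψ)
  rwa [LinearEquiv.symm_apply_apply] at h_lin

theorem exists_bar_eq {G : TotalSpace (ℝ × F) (Hull F A) → ℝ}
    (hG : SmoothFun (𝓘(ℝ, EM).prod 𝓘(ℝ, ℝ × F)) G)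
    (hΔ : lieFun (liouville 𝓘(ℝ, EM) F A) G = G) :
    ∃ a : AffineFunction 𝓘(ℝ, EM) F A, G = a.bar := by
  choose c hc using exists_dual_eq_on_fibre hG hΔ
  have hfn : (fun p : TotalSpace F A =>
      trivializedAffineMap (trivializationAt F A p.1) p.1 (c p.1) p.2) = G ∘ inclHull F A := by
    ext p
    refine Eq.trans ?_ (hc p.1 (inclHull F A p).2).symm
    rw [trivializedAffineMap_apply, hullFibre_inclHull]
  refine ⟨⟨fun x => trivializedAffineMap (trivializationAt F A x) x (c x), ?_⟩, ?_⟩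
  · rw [hfn]
    exact ContMDiff.comp hG contMDiff_inclHull
  · ext ψ
    exact (hc ψ.1 ψ.2).trans (Hull.eval_trivializedAffineMap _ _ _).symm

theorem dense_iotaOne_ne_zero : Dense {ψ | iotaOne F A ψ ≠ 0} := by
  intro ψ
  by_cases hψ : iotaOne F A ψ = 0
  · obtain ⟨p⟩ : Nonempty (A ψ.1) := inferInstance
    let η : Hull F A ψ.1 := (inclHull F A ⟨ψ.1, p⟩).2
    have hc := (contMDiff_hull_line (EM := EM) ψ.2 η (r := fun _ => 1)
      (s := id) contDiff_const contDiff_id).continuous.tendsto 0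
    simp only [id, one_smul, zero_smul, add_zero] at hc
    refine mem_closure_of_tendsto (hc.mono_left (nhdsWithin_le_nhds (s := {0}ᶜ))) ?_
    filter_upwards [self_mem_nhdsWithin] with s hs
    have h_line : iotaOne F A ⟨ψ.1, ψ.2 + s • η⟩ = s :=
      calc iotaOne F A ⟨ψ.1, ψ.2 + s • η⟩ = iotaOne F A ψ + s * 1 := rfl
        _ = s := by rw [hψ, zero_add, mul_one]
    change iotaOne F A ⟨ψ.1, ψ.2 + s • η⟩ ≠ 0
    rwa [h_line]
  · exact subset_closure hψ

variable [FiniteDimensional ℝ EM] [IsManifold 𝓘(ℝ, EM) ∞ M] [T2Space M]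

theorem exists_dif_bar_eq {ψ : TotalSpace (ℝ × F) (Hull F A)} (hψ : iotaOne F A ψ ≠ 0)
    (c : Cotangent (𝓘(ℝ, EM).prod 𝓘(ℝ, ℝ × F)) ψ) : ∃ a : AffineFunction 𝓘(ℝ, EM) F A,
      dif (𝓘(ℝ, EM).prod 𝓘(ℝ, ℝ × F)) a.bar ψ = c := by
  obtain ⟨_, ⟨a, f, hf, rfl⟩, rfl⟩ := containsCoordinates_hull.exists_dif_eq ψ c
  set f' : M → ℝ := fun y => (iotaOne F A ψ)⁻¹ * (f y - f ψ.1) with hf'_def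
  have hf' : SmoothFun 𝓘(ℝ, EM) f' := contMDiff_const.mul (hf.sub contMDiff_const)
  have hfπ := smoothFun_comp_proj (F := ℝ × F) (A := Hull F A) hf
  have hf'π := smoothFun_comp_proj (F := ℝ × F) (A := Hull F A) hf'
  have h_one := (AffineFunction.one EM F A).smoothFun_bar
  have h_dif : dif (𝓘(ℝ, EM).prod 𝓘(ℝ, ℝ × F)) (f' ∘ π (ℝ × F) (Hull F A)) ψ =
      (iotaOne F A ψ)⁻¹ • dif (𝓘(ℝ, EM).prod 𝓘(ℝ, ℝ × F)) (f ∘ π (ℝ × F) (Hull F A)) ψ := by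
    have h_eq : f' ∘ π (ℝ × F) (Hull F A) =
        (iotaOne F A ψ)⁻¹ • (f ∘ π (ℝ × F) (Hull F A) - fun _ => f ψ.1) := rfl
    have h_sub : SmoothFun (𝓘(ℝ, EM).prod 𝓘(ℝ, ℝ × F))
        (f ∘ π (ℝ × F) (Hull F A) - fun _ => f ψ.1) := hfπ.sub contMDiff_const
    rw [h_eq, dif_smul _ (h_sub.mdifferentiableAt ψ),
      dif_sub (hfπ.mdifferentiableAt ψ) (SmoothFun.mdifferentiableAt contMDiff_const ψ), dif_const,
      sub_zero]
  refine ⟨a.add ((AffineFunction.one EM F A).mulBase hf'), ?_⟩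
  rw [AffineFunction.bar_add, AffineFunction.bar_mulBase,
    dif_add (a.smoothFun_bar.mdifferentiableAt ψ)
      (SmoothFun.mdifferentiableAt (hf'π.mul h_one) ψ),
    dif_add (a.smoothFun_bar.mdifferentiableAt ψ) (hfπ.mdifferentiableAt ψ),
    dif_mul (hf'π.mdifferentiableAt ψ) (h_one.mdifferentiableAt ψ), h_dif]
  simp only [hf'_def, Function.comp_apply, sub_self, mul_zero, zero_smul, zero_add, smul_smul]
  rw [AffineFunction.bar_one, mul_inv_cancel₀ hψ, one_smul]

theorem isHull_vectorHull :
    IsHull (𝓘(ℝ, EM).prod 𝓘(ℝ, F)) (𝓘(ℝ, EM).prod 𝓘(ℝ, ℝ × F)) (inclHull F A)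
      (liouville 𝓘(ℝ, EM) F A) (AffineFunction.one EM F A) AffineFunction.fn
      AffineFunction.bar where
  smooth_incl := contMDiff_inclHull
  smooth_bar a := a.smoothFun_bar
  smooth_liouville := containsCoordinates_hull.smoothVectorField <| by
    rintro _ ⟨a, f, hf, rfl⟩
    rw [lieFun_add _ a.smoothFun_bar (smoothFun_comp_proj hf), lieFun_liouville_bar,
      lieFun_liouville_base hf, add_zero]
    exact a.smoothFun_bar
  lie_bar := lieFun_liouville_bar
  bar_comp _ := rfl
  fn_one := rfl
  ext_bar _ _ := AffineFunction.bar_congr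
  exists_add a b := ⟨a.add b, a.fn_add b, a.bar_add b⟩
  coords := containsCoordinates_affine
  coords' := containsCoordinates_hull_smooth
  dense := dense_iotaOne_ne_zero (EM := EM)
  span _ hψ := exists_dif_bar_eq hψ
  finrank_eq := by
    simp only [finrank_prod, finrank_self]
    ring

end VectorHull

section DenseExtension

variable {EN : Type*} [NormedAddCommGroup EN] [NormedSpace ℝ EN] [FiniteDimensional ℝ EN]
  {HN : Type*} [TopologicalSpace HN] {I : ModelWithCorners ℝ EN HN} [I.Boundaryless]
  {N : Type*} [TopologicalSpace N] [ChartedSpace HN N]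

theorem exists_altBilin_basis {ι W : Type*} [Finite ι] [AddCommGroup W] [Module ℝ W]
    (b : Basis ι ℝ W) {m : ι → ι → ℝ} (hm : ∀ i j, m i j = -m j i) :
    ∃ Θ : W [⋀^Fin 2]→ₗ[ℝ] ℝ, ∀ i j, altBilin Θ (b i) (b j) = m i j := by
  classical
  have := Fintype.ofFinite ι
  let wedgeCoord (k l : ι) : W [⋀^Fin 2]→ₗ[ℝ] ℝ :=
    Matrix.detRowAlternating.compLinearMap (LinearMap.pi ![b.coord k, b.coord l])
  have h_wedge : ∀ k l i j, wedgeCoord k l ![b i, b j] =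
      (if i = k then 1 else 0) * (if j = l then 1 else 0) -
        (if i = l then 1 else 0) * (if j = k then 1 else 0) := fun k l i j => by
    refine (Matrix.det_fin_two _).trans ?_
    simp [Finsupp.single_apply]
  refine ⟨(2⁻¹ : ℝ) • ∑ k, ∑ l, m k l • wedgeCoord k l, fun i j => ?_⟩
  have h_sum : ∑ k, ∑ l, m k l * wedgeCoord k l ![b i, b j] = m i j - m j i := by
    simp only [h_wedge, mul_sub, Finset.sum_sub_distrib]
    simp
  have h_apply : (∑ k, ∑ l, m k l • wedgeCoord k l) ![b i, b j] =
      ∑ k, ∑ l, m k l * wedgeCoord k l ![b i, b j] := by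
    let evalPair : (W [⋀^Fin 2]→ₗ[ℝ] ℝ) →ₗ[ℝ] ℝ :=
      { toFun Θ := Θ ![b i, b j], map_add' _ _ := rfl, map_smul' _ _ := rfl }
    exact (map_sum evalPair _ _).trans (Finset.sum_congr rfl fun k _ => map_sum evalPair _ _)
  rw [altBilin_apply, AlternatingMap.smul_apply, h_apply, h_sum, smul_eq_mul]
  linarith [hm i j]

theorem altBilin_sum_smul_sum_smul {ι κ W : Type*} [Fintype ι] [Fintype κ] [AddCommGroup W]
    [Module ℝ W] (Θ : W [⋀^Fin 2]→ₗ[ℝ] ℝ) (k : ι → ℝ) (x : ι → W) (l : κ → ℝ) (y : κ → W) :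
    altBilin Θ (∑ i, k i • x i) (∑ j, l j • y j) =
      ∑ i, ∑ j, k i * (l j * altBilin Θ (x i) (y j)) := by
  simp only [map_sum, map_smul, LinearMap.sum_apply, LinearMap.smul_apply, smul_eq_mul,
    Finset.mul_sum]
  rw [Finset.sum_comm]
  exact Finset.sum_congr rfl fun i _ => Finset.sum_congr rfl fun j _ => by ring

theorem eq_of_eventually_of_dense {X Y : Type*} [TopologicalSpace X] [TopologicalSpace Y]
    [T2Space Y] {D : Set X} (hD : Dense D) {p : X} {u v : X → Y} (hu : ContinuousAt u p)
    (hv : ContinuousAt v p) (h : ∀ᶠ q in 𝓝 p, q ∈ D → u q = v q) : u p = v p :=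
  tendsto_nhds_unique_of_frequently_eq hu hv
    (((mem_closure_iff_frequently.1 (hD p)).and_eventually h).mono fun _ hq => hq.2 hq.1)

theorem exists_continuousAt_coeff_dif {p : N} {φ : N → EN} (hφ : ContMDiff I 𝓘(ℝ, EN) ∞ φ)
    (hφp : φ =ᶠ[𝓝 p] extChartAt I p) {f : N → ℝ} (hf : SmoothFun I f) :
    ∃ k : Fin (finrank ℝ EN) → N → ℝ, (∀ i, ContinuousAt (k i) p) ∧ ∀ᶠ q in 𝓝 p,
      dif I f q = ∑ i, k i q • dif I ((finBasis ℝ EN).coord i ∘ φ) q := by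
  obtain ⟨H, hH, hfH⟩ := dif_eventuallyEq_fderiv_comp_mfderiv hφ hφp hf
  have hH' : ContinuousAt (fderiv ℝ H) (φ p) :=
    (hH.fderiv_right (m := ∞) (by simp)).continuousAt
  refine ⟨fun i q => fderiv ℝ H (φ q) (finBasis ℝ EN i),
    fun i => (hH'.comp (hφ p).continuousAt).clm_apply continuousAt_const, ?_⟩
  filter_upwards [hfH] with q hq
  ext v
  rw [hq, ← (finBasis ℝ EN).sum_repr (mfderiv I 𝓘(ℝ, EN) φ q v), map_sum]
  simp only [LinearMap.sum_apply, LinearMap.smul_apply, map_smul, smul_eq_mul,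
    dif_dual_comp ((hφ q).mdifferentiableAt (by simp))]
  exact Finset.sum_congr rfl fun i _ => mul_comm _ _

variable {ι : Type*} {fn : ι → N → ℝ} {B : ι → ι → N → ℝ} {D : Set N}

/-- The existence of `Θ` is a closed condition on `p`: in terms of coordinates among the `fn i`, it
says that the `B i j` expand in the same way as the differentials of `fn i` and `fn j`. -/
theorem ContainsCoordinates.exists_bivector_of_dense (hS : ContainsCoordinates I (range fn))
    (hB : ∀ i j, Continuous (B i j)) (hD : Dense D)
    (hΘ : ∀ p ∈ D, ∃ Θ : Bivector I p, ∀ i j,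
      altBilin Θ (dif I (fn i) p) (dif I (fn j) p) = B i j p) (p : N) :
    ∃ Θ : Bivector I p, ∀ i j, altBilin Θ (dif I (fn i) p) (dif I (fn j) p) = B i j p := by
  obtain ⟨φ, hφ, hφp, hφS⟩ := hS.exists_smooth_chart p
  choose x hx using hφS
  have hB_swap : ∀ i j, B i j p = -B j i p := fun i j =>
    eq_of_eventually_of_dense hD (hB i j).continuousAt (hB j i).continuousAt.neg <|
      Filter.Eventually.of_forall fun q hq => by
        obtain ⟨Θ, hΘ⟩ := hΘ q hq
        rw [Pi.neg_apply, ← hΘ, ← hΘ, altBilin_swap]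
  have h_dif : ∀ i, dif I (fn (x i)) p = (finBasis ℝ EN).dualBasis i := fun i => by
    rw [Basis.coe_dualBasis]
    exact hS.dif_eq (hφp.mono fun q hq => by rw [hx, Function.comp_apply, hq])
  obtain ⟨Θ, hΘp⟩ : ∃ Θ : Bivector I p, ∀ i j,
      altBilin Θ (dif I (fn (x i)) p) (dif I (fn (x j)) p) = B (x i) (x j) p := by
    simp only [h_dif]
    exact exists_altBilin_basis _ fun i j => hB_swap (x i) (x j)
  refine ⟨Θ, fun a b => ?_⟩
  obtain ⟨k, hk, hak⟩ := exists_continuousAt_coeff_dif hφ hφp (hS.smooth _ ⟨a, rfl⟩)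
  obtain ⟨l, hl, hbl⟩ := exists_continuousAt_coeff_dif hφ hφp (hS.smooth _ ⟨b, rfl⟩)
  simp only [← hx] at hak hbl
  have hB_expand : B a b p = ∑ i, ∑ j, k i p * (l j p * B (x i) (x j) p) := by
    refine eq_of_eventually_of_dense hD (hB a b).continuousAt
      (v := fun q => ∑ i, ∑ j, k i q * (l j q * B (x i) (x j) q))
      (tendsto_finsetSum _ fun i _ => tendsto_finsetSum _ fun j _ =>
        (hk i).mul ((hl j).mul (hB _ _).continuousAt)) ?_
    filter_upwards [hak, hbl] with q haq hbq hq
    obtain ⟨Θ, hΘ⟩ := hΘ q hq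
    simp only [← hΘ, haq, hbq, altBilin_sum_smul_sum_smul]
  rw [hak.self_of_nhds, hbl.self_of_nhds, altBilin_sum_smul_sum_smul, hB_expand]
  simp only [hΘp]

theorem ContainsCoordinates.exists_smoothBivectorField (hS : ContainsCoordinates I (range fn))
    (hB : ∀ i j, SmoothFun I (B i j)) (hD : Dense D)
    (hΘ : ∀ p ∈ D, ∃ Θ : Bivector I p, ∀ i j,
      altBilin Θ (dif I (fn i) p) (dif I (fn j) p) = B i j p) :
    ∃ Λ : ∀ p : N, Bivector I p, SmoothBivectorField I Λ ∧
      ∀ i j, pairing Λ (fn i) (fn j) = B i j := by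
  choose Λ hΛ using hS.exists_bivector_of_dense (fun i j => (hB i j).continuous) hD hΘ
  have h_pairing : ∀ i j, pairing Λ (fn i) (fn j) = B i j := fun i j => funext fun p => hΛ p i j
  refine ⟨Λ, hS.smoothBivectorField ?_, h_pairing⟩
  rintro _ ⟨i, rfl⟩ _ ⟨j, rfl⟩
  rw [h_pairing]
  exact hB i j

end DenseExtension

/-! ### The linearization of an affine Jacobi structure -/

section FibrePoints

variable {M : Type*} [TopologicalSpace M]
  (F : Type*) [NormedAddCommGroup F] [NormedSpace ℝ F]
  {V : M → Type*} [∀ x, AddCommGroup (V x)] [∀ x, Module ℝ (V x)]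
  (A : M → Type*) [∀ x, AddTorsor (V x) (A x)]
  [TopologicalSpace (TotalSpace F A)] [∀ x, TopologicalSpace (A x)]
  [FiberBundle F A] [IsAffineBundle F A]

/-- The point of the fibre over `x` whose coordinates in the preferred trivialization at `x` are
`v`; it parametrizes the fibre by its model space. -/
def fibrePoint (x : M) (v : F) : TotalSpace F A :=
  ⟨x, (fibreAff F A (trivializationAt F A x) x).symm v⟩

variable {F A}

theorem exists_fibrePoint_eq (p : TotalSpace F A) : ∃ v, p = fibrePoint F A p.1 v :=
  ⟨fibreAff F A (trivializationAt F A p.1) p.1 p.2, by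
    rw [fibrePoint, AffineEquiv.symm_apply_apply]⟩

theorem AffineFunction.exists_fibrePoint {EM H : Type*} [NormedAddCommGroup EM] [NormedSpace ℝ EM]
    [TopologicalSpace H] {I : ModelWithCorners ℝ EM H} [ChartedSpace H M]
    (a : AffineFunction I F A) (x : M) :
    ∃ (ℓ : Dual ℝ F) (r : ℝ), ∀ v, a.fn (fibrePoint F A x v) = ℓ v + r := by
  let aff : F →ᵃ[ℝ] ℝ :=
    (a.onFibre x).comp (fibreAff F A (trivializationAt F A x) x).symm.toAffineMap
  exact ⟨aff.linear, aff 0, congrFun aff.decomp⟩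

variable [FiniteDimensional ℝ F]

theorem exists_eq_smul_inclHull (ψ : TotalSpace (ℝ × F) (Hull F A)) (hψ : iotaOne F A ψ ≠ 0) :
    ∃ p : TotalSpace F A, ψ = ⟨p.1, iotaOne F A ψ • (inclHull F A p).2⟩ := by
  obtain ⟨x, ψ⟩ := ψ
  let e := hullFibre F A (trivializationAt F A x) x
  have h_fst : (e ψ).1 = iotaOne F A ⟨x, ψ⟩ := hullFibre_fst (trivializationAt F A x) ψ
  let v : F := (iotaOne F A ⟨x, ψ⟩)⁻¹ • (e ψ).2
  have h_incl : e (inclHull F A (fibrePoint F A x v)).2 = (1, v) :=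
    (hullFibre_inclHull _ (fibrePoint F A x v)).trans
      (congrArg _ (AffineEquiv.apply_symm_apply _ v))
  refine ⟨fibrePoint F A x v, congrArg (TotalSpace.mk x) (e.injective ?_)⟩
  refine Eq.trans ?_ (map_smul e _ _).symm
  rw [h_incl]
  ext1
  · rw [h_fst, Prod.smul_fst, smul_eq_mul, mul_one]
  · rw [Prod.smul_snd, smul_inv_smul₀ hψ]

end FibrePoints

section Anchor

variable {EM : Type*} [NormedAddCommGroup EM] [NormedSpace ℝ EM]
  {M : Type*} [TopologicalSpace M] [ChartedSpace EM M]
  {F : Type*} [NormedAddCommGroup F] [NormedSpace ℝ F]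
  {V : M → Type*} [∀ x, AddCommGroup (V x)] [∀ x, Module ℝ (V x)]
  {A : M → Type*} [∀ x, AddTorsor (V x) (A x)]
  [TopologicalSpace (TotalSpace F A)] [∀ x, TopologicalSpace (A x)] [FiberBundle F A]

/-- The anchor `ρ(a)(f) = Λ(da, df) + a E(f)` of a Jacobi structure, as a function on the affine
bundle. The Leibniz rule of the Jacobi bracket of an affine structure is governed by it. -/
def anchorFun (J : JacobiStructure (𝓘(ℝ, EM).prod 𝓘(ℝ, F)) (TotalSpace F A))
    (a : TotalSpace F A → ℝ) (f : M → ℝ) : TotalSpace F A → ℝ :=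
  pairing J.Λ a (f ∘ π F A) + a * lieFun J.E (f ∘ π F A)

variable {J : JacobiStructure (𝓘(ℝ, EM).prod 𝓘(ℝ, F)) (TotalSpace F A)} {f : M → ℝ}

theorem smoothFun_anchorFun (J : JacobiStructure (𝓘(ℝ, EM).prod 𝓘(ℝ, F)) (TotalSpace F A))
    (a : AffineFunction 𝓘(ℝ, EM) F A) (hf : SmoothFun 𝓘(ℝ, EM) f) :
    SmoothFun (𝓘(ℝ, EM).prod 𝓘(ℝ, F)) (anchorFun J a.fn f) :=
  (J.smoothΛ _ _ a.smooth (smoothFun_comp_proj hf)).add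
    (a.smooth.mul (J.smoothE _ (smoothFun_comp_proj hf)))

theorem bracket_mulBase (a b : AffineFunction 𝓘(ℝ, EM) F A) (hf : SmoothFun 𝓘(ℝ, EM) f) :
    J.bracket a.fn (b.mulBase hf).fn =
      (f ∘ π F A) * J.bracket a.fn b.fn + b.fn * anchorFun J a.fn f := by
  have hfs := smoothFun_comp_proj (F := F) (A := A) hf
  have hb : SmoothFun (𝓘(ℝ, EM).prod 𝓘(ℝ, F)) b.fn := b.smooth
  rw [JacobiStructure.bracket_eq, JacobiStructure.bracket_eq, AffineFunction.fn_mulBase, anchorFun,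
    pairing_mul_right _ _ hfs hb, lieFun_mul _ hfs hb]
  ring

theorem anchorFun_mulBase (a : AffineFunction 𝓘(ℝ, EM) F A) (hf : SmoothFun 𝓘(ℝ, EM) f)
    (g : M → ℝ) : anchorFun J (a.mulBase hf).fn g =
      (f ∘ π F A) * anchorFun J a.fn g + a.fn * pairing J.Λ (f ∘ π F A) (g ∘ π F A) := by
  have ha : SmoothFun (𝓘(ℝ, EM).prod 𝓘(ℝ, F)) a.fn := a.smooth
  rw [AffineFunction.fn_mulBase, anchorFun, anchorFun,
    pairing_mul_left _ (smoothFun_comp_proj hf) ha]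
  ring

variable [IsAffineBundle F A]

/-- The anchor of an affine Jacobi structure, as a function on the base: `anchorFun` is constant on
the fibres, and we take its value at the origin of the preferred trivialization. -/
def anchorBase (J : JacobiStructure (𝓘(ℝ, EM).prod 𝓘(ℝ, F)) (TotalSpace F A))
    (a : TotalSpace F A → ℝ) (f : M → ℝ) (x : M) : ℝ := anchorFun J a f (fibrePoint F A x 0)

theorem anchorBase_zero (a : TotalSpace F A → ℝ) : anchorBase J a (fun _ => 0) = 0 := by
  ext x
  have h_comp : (fun _ : M => (0 : ℝ)) ∘ π F A = fun _ => 0 := rfl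
  rw [anchorBase, anchorFun, h_comp, pairing_const_right, lieFun_const, mul_zero, add_zero]
  rfl

end Anchor

section Linearization

variable {EM : Type*} [NormedAddCommGroup EM] [NormedSpace ℝ EM] [FiniteDimensional ℝ EM]
  {M : Type*} [TopologicalSpace M] [ChartedSpace EM M] [IsManifold 𝓘(ℝ, EM) ∞ M] [T2Space M]
  {F : Type*} [NormedAddCommGroup F] [NormedSpace ℝ F] [FiniteDimensional ℝ F]
  {V : M → Type*} [∀ x, AddCommGroup (V x)] [∀ x, Module ℝ (V x)]
  {A : M → Type*} [∀ x, AddTorsor (V x) (A x)]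
  [TopologicalSpace (TotalSpace F A)] [∀ x, TopologicalSpace (A x)]
  [FiberBundle F A] [IsSmoothAffineBundle F A 𝓘(ℝ, EM)]

theorem fibreCoord_fibrePoint (x : M) (c : Dual ℝ (ℝ × F)) (v : F) :
    (fibreCoord (EM := EM) (A := A) x c).fn (fibrePoint F A x v) = c (1, v) :=
  (DFunLike.congr_fun (fibreCoord_eventually x c).self_of_nhds _).trans <|
    (trivializedAffineMap_apply _ x c _).trans
      (congrArg (fun w => c (1, w)) (AffineEquiv.apply_symm_apply _ v))

theorem eq_fibrePoint_zero_of_mul_affine {r : TotalSpace F A → ℝ}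
    (hr : ∀ b : AffineFunction 𝓘(ℝ, EM) F A, ∃ c : AffineFunction 𝓘(ℝ, EM) F A, b.fn * r = c.fn)
    (x : M) (v : F) : r (fibrePoint F A x v) = r (fibrePoint F A x 0) := by
  obtain ⟨c, hc⟩ := hr (AffineFunction.one EM F A)
  rw [AffineFunction.fn_one, one_mul] at hc
  obtain ⟨ℓ, s, hℓ⟩ := c.exists_fibrePoint x
  have hrv : ∀ v, r (fibrePoint F A x v) = ℓ v + s := fun v => by rw [hc, hℓ]
  -- On the fibre, the product of `r` with the coordinate `ℓ` is quadratic unless `ℓ v = 0`.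
  obtain ⟨d, hd⟩ := hr (fibreCoord (EM := EM) x (ℓ ∘ₗ LinearMap.snd ℝ ℝ F))
  obtain ⟨m, t, hm⟩ := d.exists_fibrePoint x
  have h_prod : ∀ v, ℓ v * (ℓ v + s) = m v + t := fun v => by
    rw [← hm, ← hd, Pi.mul_apply, fibreCoord_fibrePoint, hrv]
    rfl
  have h_pos := h_prod v
  have h_neg := h_prod (-v)
  have h_zero := h_prod 0
  simp only [map_neg, map_zero] at h_neg h_zero
  have hv : ℓ v = 0 := mul_self_eq_zero.1 (by linarith)
  rw [hrv, hrv, hv, map_zero]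

variable {J : JacobiStructure (𝓘(ℝ, EM).prod 𝓘(ℝ, F)) (TotalSpace F A)} {f g : M → ℝ}

theorem anchorFun_fibrePoint (hJ : IsAffineJacobi J) (a : AffineFunction 𝓘(ℝ, EM) F A)
    (hf : SmoothFun 𝓘(ℝ, EM) f) (x : M) (v : F) :
    anchorFun J a.fn f (fibrePoint F A x v) = anchorBase J a.fn f x := by
  refine eq_fibrePoint_zero_of_mul_affine (EM := EM) (fun b => ?_) x v
  obtain ⟨c, hc⟩ := hJ a (b.mulBase hf)
  obtain ⟨d, hd⟩ := hJ a b
  have hneg : SmoothFun 𝓘(ℝ, EM) (-f) := hf.neg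
  refine ⟨c.add (d.mulBase hneg), ?_⟩
  rw [AffineFunction.fn_add, AffineFunction.fn_mulBase, ← hc, ← hd, bracket_mulBase]
  have : (-f) ∘ π F A = -(f ∘ π F A) := rfl
  rw [this]
  ring

theorem anchorFun_eq (hJ : IsAffineJacobi J) (a : AffineFunction 𝓘(ℝ, EM) F A)
    (hf : SmoothFun 𝓘(ℝ, EM) f) (p : TotalSpace F A) :
    anchorFun J a.fn f p = anchorBase J a.fn f p.1 := by
  obtain ⟨v, hv⟩ := exists_fibrePoint_eq p
  rw [hv]
  exact anchorFun_fibrePoint hJ a hf p.1 v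

theorem smoothFun_anchorBase (hJ : IsAffineJacobi J) (a : AffineFunction 𝓘(ℝ, EM) F A)
    (hf : SmoothFun 𝓘(ℝ, EM) f) : SmoothFun 𝓘(ℝ, EM) (anchorBase J a.fn f) := by
  intro x
  have h_section : anchorBase J a.fn f = fun y => anchorFun J a.fn f
      ⟨y, (fibreAff F A (trivializationAt F A x) y).symm 0⟩ :=
    funext fun y => (anchorFun_eq hJ a hf ⟨y, _⟩).symm
  rw [h_section]
  exact (smoothFun_anchorFun J a hf _).comp x (contMDiffAt_fibreAff_symm contMDiffAt_id
    contMDiffAt_const (mem_baseSet_trivializationAt F A x))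

theorem mul_pairing_comp_proj_fibrePoint (hJ : IsAffineJacobi J) (a : AffineFunction 𝓘(ℝ, EM) F A)
    (hf : SmoothFun 𝓘(ℝ, EM) f) (hg : SmoothFun 𝓘(ℝ, EM) g) (x : M) (v : F) :
    a.fn (fibrePoint F A x v) * pairing J.Λ (f ∘ π F A) (g ∘ π F A) (fibrePoint F A x v) =
      a.fn (fibrePoint F A x 0) * pairing J.Λ (f ∘ π F A) (g ∘ π F A) (fibrePoint F A x 0) := by
  have h_anchor : ∀ v, f x * anchorBase J a.fn g x + a.fn (fibrePoint F A x v) *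
      pairing J.Λ (f ∘ π F A) (g ∘ π F A) (fibrePoint F A x v) =
        anchorBase J (a.mulBase hf).fn g x := fun v => by
    rw [← anchorFun_fibrePoint hJ a hg x v, ← anchorFun_fibrePoint hJ (a.mulBase hf) hg x v,
      anchorFun_mulBase]
    rfl
  exact add_left_cancel ((h_anchor v).trans (h_anchor 0).symm)

/-- The pairing of two basic functions is basic, and so is its product with any affine function;
on a fibre of positive dimension this leaves only `0`. -/
theorem pairing_comp_proj_comp_proj (hJ : IsAffineJacobi J) (hF : 0 < finrank ℝ F)
    (hf : SmoothFun 𝓘(ℝ, EM) f) (hg : SmoothFun 𝓘(ℝ, EM) g) :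
    pairing J.Λ (f ∘ π F A) (g ∘ π F A) = 0 := by
  have h_const : ∀ x v, pairing J.Λ (f ∘ π F A) (g ∘ π F A) (fibrePoint F A x v) =
      pairing J.Λ (f ∘ π F A) (g ∘ π F A) (fibrePoint F A x 0) := fun x v => by
    simpa only [AffineFunction.fn_one, Pi.one_apply, one_mul] using
      mul_pairing_comp_proj_fibrePoint hJ (AffineFunction.one EM F A) hf hg x v
  have := nontrivial_of_finrank_pos hF
  obtain ⟨w, hw⟩ := exists_ne (0 : F)
  obtain ⟨ℓ, hℓ⟩ : ∃ ℓ : Dual ℝ F, ℓ w ≠ 0 :=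
    not_forall.1 fun h => hw ((forall_dual_apply_eq_zero_iff ℝ w).1 h)
  have h_coord : ∀ x v, (fibreCoord (EM := EM) (A := A) x (ℓ ∘ₗ LinearMap.snd ℝ ℝ F)).fn
      (fibrePoint F A x v) = ℓ v := fun x v => fibreCoord_fibrePoint x _ v
  ext p
  obtain ⟨v, hv⟩ := exists_fibrePoint_eq p
  have h_mul := mul_pairing_comp_proj_fibrePoint hJ
    (fibreCoord (EM := EM) p.1 (ℓ ∘ₗ LinearMap.snd ℝ ℝ F)) hf hg p.1 w
  rw [h_coord, h_coord, map_zero, zero_mul, h_const] at h_mul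
  rw [hv, h_const]
  exact (mul_eq_zero.1 h_mul).resolve_left hℓ

/-- The linearization is given by `t⁻¹ (Λ + Δ ∧ E)` on the image of `scaledIncl t`. -/
theorem exists_bivector_of_iotaOne_ne_zero (hJ : IsAffineJacobi J) (hF : 0 < finrank ℝ F)
    (ψ : TotalSpace (ℝ × F) (Hull F A)) (hψ : iotaOne F A ψ ≠ 0) :
    ∃ Θ : Bivector (𝓘(ℝ, EM).prod 𝓘(ℝ, ℝ × F)) ψ,
      ∀ (a b c : AffineFunction 𝓘(ℝ, EM) F A) (f g : M → ℝ), SmoothFun 𝓘(ℝ, EM) f →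
        SmoothFun 𝓘(ℝ, EM) g → J.bracket a.fn b.fn = c.fn →
        altBilin Θ (dif _ (a.bar + f ∘ π (ℝ × F) (Hull F A)) ψ)
          (dif _ (b.bar + g ∘ π (ℝ × F) (Hull F A)) ψ) =
        c.bar ψ + anchorBase J a.fn g ψ.1 - anchorBase J b.fn f ψ.1 := by
  obtain ⟨p, hp⟩ := exists_eq_smul_inclHull ψ hψ
  generalize iotaOne F A ψ = t at hp hψ
  obtain rfl : ψ = scaledIncl t p := hp
  let dS := mfderiv (𝓘(ℝ, EM).prod 𝓘(ℝ, F)) (𝓘(ℝ, EM).prod 𝓘(ℝ, ℝ × F)) (scaledIncl t) p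
  let Θ : Bivector (𝓘(ℝ, EM).prod 𝓘(ℝ, ℝ × F)) (scaledIncl t p) :=
    pushBivector _ (𝓘(ℝ, EM).prod 𝓘(ℝ, ℝ × F)) (scaledIncl t) p (J.Λ p) +
      wedge _ (liouville 𝓘(ℝ, EM) F A (scaledIncl t p)) (dS (J.E p))
  refine ⟨t⁻¹ • Θ, fun a b c f g hf hg hc => ?_⟩
  have hE : ∀ (a : AffineFunction 𝓘(ℝ, EM) F A) {f : M → ℝ}, SmoothFun 𝓘(ℝ, EM) f →
      dif (𝓘(ℝ, EM).prod 𝓘(ℝ, ℝ × F)) (a.bar + f ∘ π (ℝ × F) (Hull F A)) (scaledIncl t p)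
        (dS (J.E p)) = t * lieFun J.E a.fn p + lieFun J.E (f ∘ π F A) p := fun a f hf =>
    LinearMap.congr_fun (dif_comp_mfderiv_scaledIncl t a hf p) (J.E p)
  have h_bar : ∀ a : AffineFunction 𝓘(ℝ, EM) F A, a.bar (scaledIncl t p) = t * a.fn p :=
    fun a => rfl
  have h_basic := congrFun (pairing_comp_proj_comp_proj hJ hF hf hg) p
  have h_smul : ∀ α β, altBilin (t⁻¹ • Θ) α β = t⁻¹ * altBilin Θ α β := fun α β => rfl
  have h_add : ∀ (Θ₁ Θ₂ : Bivector (𝓘(ℝ, EM).prod 𝓘(ℝ, ℝ × F)) (scaledIncl t p)) (α β),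
      altBilin (Θ₁ + Θ₂) α β = altBilin Θ₁ α β + altBilin Θ₂ α β := fun Θ₁ Θ₂ α β => rfl
  rw [h_smul, inv_mul_eq_iff_eq_mul₀ hψ, h_add, altBilin_pushBivector, altBilin_wedge,
    dif_comp_mfderiv_scaledIncl t a hf, dif_comp_mfderiv_scaledIncl t b hg,
    dif_bar_add_liouville a hf, dif_bar_add_liouville b hg, hE a hf, hE b hg, h_bar, h_bar, h_bar,
    ← hc, JacobiStructure.bracket_eq, scaledIncl, ← anchorFun_eq hJ a hg p,
    ← anchorFun_eq hJ b hf p]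
  simp only [map_add, map_smul, LinearMap.add_apply, LinearMap.smul_apply, smul_eq_mul,
    ← pairing_apply, anchorFun, Pi.add_apply, Pi.sub_apply, Pi.mul_apply]
  rw [h_basic, pairing_swap J.Λ (f ∘ π F A) b.fn]
  simp only [Pi.neg_apply, Pi.zero_apply]
  ring

theorem exists_isLinearization_bar (hJ : IsAffineJacobi J) (hF : 0 < finrank ℝ F) :
    ∃ Λ : ∀ ψ : TotalSpace (ℝ × F) (Hull F A), Bivector (𝓘(ℝ, EM).prod 𝓘(ℝ, ℝ × F)) ψ,
      SmoothBivectorField (𝓘(ℝ, EM).prod 𝓘(ℝ, ℝ × F)) Λ ∧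
        IsLinearization (AffineFunction.fn (I := 𝓘(ℝ, EM))) AffineFunction.bar J Λ := by
  choose c hc using hJ
  let hullFun (s : AffineFunction 𝓘(ℝ, EM) F A × {f : M → ℝ // SmoothFun 𝓘(ℝ, EM) f}) :
    TotalSpace (ℝ × F) (Hull F A) → ℝ := s.1.bar + s.2.1 ∘ π (ℝ × F) (Hull F A)
  have hS : ContainsCoordinates (𝓘(ℝ, EM).prod 𝓘(ℝ, ℝ × F)) (range hullFun) := by
    refine containsCoordinates_hull.mono ?_ ?_
    · rintro _ ⟨a, f, hf, rfl⟩
      exact ⟨⟨a, f, hf⟩, rfl⟩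
    · rintro _ ⟨⟨a, f, hf⟩, rfl⟩
      exact a.smoothFun_bar.add (smoothFun_comp_proj hf)
  obtain ⟨Λ, hΛ, h_pairing⟩ := hS.exists_smoothBivectorField
    (B := fun s s' => (c s.1 s'.1).bar + anchorBase J s.1.fn s'.2.1 ∘ π (ℝ × F) (Hull F A) -
      anchorBase J s'.1.fn s.2.1 ∘ π (ℝ × F) (Hull F A))
    (fun s s' => ((c s.1 s'.1).smoothFun_bar.add
        (smoothFun_comp_proj (smoothFun_anchorBase (fun a b => ⟨_, hc a b⟩) s.1 s'.2.2))).sub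
      (smoothFun_comp_proj (smoothFun_anchorBase (fun a b => ⟨_, hc a b⟩) s'.1 s.2.2)))
    (dense_iotaOne_ne_zero (EM := EM)) (fun ψ hψ => by
      obtain ⟨Θ, hΘ⟩ := exists_bivector_of_iotaOne_ne_zero (fun a b => ⟨_, hc a b⟩) hF ψ hψ
      exact ⟨Θ, fun s s' => hΘ s.1 s'.1 _ _ _ s.2.2 s'.2.2 (hc _ _)⟩)
  refine ⟨Λ, hΛ, fun a b => ⟨c a b, ?_, (hc a b).symm⟩⟩
  have h_bar := h_pairing (a, ⟨fun _ => 0, contMDiff_const⟩) (b, ⟨fun _ => 0, contMDiff_const⟩)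
  have h_zero : ∀ a : AffineFunction 𝓘(ℝ, EM) F A,
      a.bar + (fun _ => 0) ∘ π (ℝ × F) (Hull F A) = a.bar := fun a => funext fun _ => add_zero _
  simp only [hullFun, h_zero, anchorBase_zero] at h_bar
  exact h_bar.trans (funext fun ψ => by simp)

theorem isHomogeneous_hull_iff
    {Λ : ∀ ψ : TotalSpace (ℝ × F) (Hull F A), Bivector (𝓘(ℝ, EM).prod 𝓘(ℝ, ℝ × F)) ψ}
    (hΛ : SmoothBivectorField (𝓘(ℝ, EM).prod 𝓘(ℝ, ℝ × F)) Λ) :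
    IsHomogeneous (liouville 𝓘(ℝ, EM) F A) Λ ↔
      IsLinearFor (AffineFunction.bar (I := 𝓘(ℝ, EM)) (F := F) (E := A)) Λ := by
  refine ⟨fun h a b => ?_, fun h => isHull_vectorHull.isHomogeneous hΛ h⟩
  refine exists_bar_eq (hΛ _ _ a.smoothFun_bar b.smoothFun_bar) ?_
  have h_lie := h a.bar b.bar a.smoothFun_bar b.smoothFun_bar
  rw [lieBivector, lieFun_liouville_bar, lieFun_liouville_bar] at h_lie
  linear_combination h_lie

variable (EM M F A) in
theorem exists_equiv_affineJacobi_homogeneousPoisson (hF : 0 < finrank ℝ F) :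
    ∃ Φ : AffineJacobi 𝓘(ℝ, EM) F A ≃ HomogeneousPoisson 𝓘(ℝ, EM) F A,
      (∀ J P, P = Φ J ↔ ∀ (a b : AffineFunction 𝓘(ℝ, EM) F A) (p : TotalSpace F A),
        J.1.bracket a.fn b.fn p = P.1.bracket a.bar b.bar (inclHull F A p)) ∧
      ∀ J, ∃ K : JacobiStructure (𝓘(ℝ, EM).prod 𝓘(ℝ, ℝ × F)) (TotalSpace (ℝ × F) (Hull F A)),
        K.E = hamOne (Φ J).1.Λ ∧
        (K.Λ = fun ψ => (Φ J).1.Λ ψ - wedge _ (liouville 𝓘(ℝ, EM) F A ψ) (K.E ψ)) ∧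
        IsRelated (inclHull F A) J.1 K := by
  have h := isHull_vectorHull (EM := EM) (F := F) (A := A)
  let Ψ := h.linearizationEquiv fun J hJ => exists_isLinearization_bar hJ hF
  let toHomogeneous :
      {P : PoissonStructure (𝓘(ℝ, EM).prod 𝓘(ℝ, ℝ × F)) (TotalSpace (ℝ × F) (Hull F A)) //
        IsLinearFor (AffineFunction.bar (I := 𝓘(ℝ, EM)) (F := F) (E := A)) P.Λ} ≃
        HomogeneousPoisson 𝓘(ℝ, EM) F A :=
    Equiv.subtypeEquivRight fun P => (isHomogeneous_hull_iff P.smoothΛ).symm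
  refine ⟨Equiv.trans Ψ toHomogeneous, fun J P => ?_,
    fun J => ⟨h.hullJacobi (Ψ J).1 (Ψ J).2, rfl, rfl, h.isRelated_linearizationEquiv J⟩⟩
  exact toHomogeneous.symm_apply_eq.symm.trans (h.eq_linearizationEquiv_iff J _)

end Linearization

/-! ### Jacobi structures and diffeomorphisms -/

theorem compLinearMap_dualMap_compLinearMap_dualMap {W W' : Type*} [AddCommGroup W] [Module ℝ W]
    [AddCommGroup W'] [Module ℝ W'] {L : W →ₗ[ℝ] W'} {R : W' →ₗ[ℝ] W} (h : R ∘ₗ L = LinearMap.id)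
    (Λ : Dual ℝ W [⋀^Fin 2]→ₗ[ℝ] ℝ) :
    (Λ.compLinearMap L.dualMap).compLinearMap R.dualMap = Λ := by
  rw [AlternatingMap.compLinearMap_assoc, LinearMap.dualMap_comp_dualMap, h, LinearMap.dualMap_id,
    AlternatingMap.compLinearMap_id]

section Diffeomorphisms

variable {EN : Type*} [NormedAddCommGroup EN] [NormedSpace ℝ EN]
  {HN : Type*} [TopologicalSpace HN] {I : ModelWithCorners ℝ EN HN}
  {N : Type*} [TopologicalSpace N] [ChartedSpace HN N]
  {EN' : Type*} [NormedAddCommGroup EN'] [NormedSpace ℝ EN']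
  {HN' : Type*} [TopologicalSpace HN'] {I' : ModelWithCorners ℝ EN' HN'}
  {N' : Type*} [TopologicalSpace N'] [ChartedSpace HN' N']
  (Ψ : N ≃ₘ⟮I, I'⟯ N')

theorem mfderiv_symm_comp_mfderiv (x : N) :
    (mfderiv I' I Ψ.symm (Ψ x)).comp (mfderiv I I' Ψ x) = ContinuousLinearMap.id ℝ EN := by
  have h_id : Ψ.symm ∘ Ψ = id := funext Ψ.symm_apply_apply
  have h_comp := mfderiv_comp x ((Ψ.symm.contMDiff (Ψ x)).mdifferentiableAt (by simp))
    ((Ψ.contMDiff x).mdifferentiableAt (by simp))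
  rw [h_id, mfderiv_id] at h_comp
  exact h_comp.symm

theorem mfderiv_comp_mfderiv_symm (x : N) :
    (mfderiv I I' Ψ x).comp (mfderiv I' I Ψ.symm (Ψ x)) = ContinuousLinearMap.id ℝ EN' := by
  let D : N → (EN →L[ℝ] EN') := fun x => mfderiv I I' Ψ x
  have hx : D (Ψ.symm (Ψ x)) = D x := congrArg D (Ψ.symm_apply_apply x)
  exact (congrArg (fun T : EN →L[ℝ] EN' => T.comp (mfderiv I' I Ψ.symm (Ψ x) : EN' →L[ℝ] EN))
    hx).symm.trans (mfderiv_symm_comp_mfderiv Ψ.symm (Ψ x))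

variable {Ψ} in
theorem IsRelated.symm {J : JacobiStructure I N} {K : JacobiStructure I' N'}
    (h : IsRelated Ψ J K) : IsRelated Ψ.symm K J := by
  intro y
  obtain ⟨x, rfl⟩ : ∃ x, Ψ x = y := Ψ.surjective y
  have hd := mfderiv_symm_comp_mfderiv Ψ x
  have hx := Ψ.symm_apply_apply x
  let E : N → EN := J.E
  let Λ : N → (Dual ℝ EN [⋀^Fin 2]→ₗ[ℝ] ℝ) := J.Λ
  rw [(h x).1, (h x).2]
  exact ⟨(congrArg E hx).trans (DFunLike.congr_fun hd (E x)).symm, (congrArg Λ hx).trans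
    (compLinearMap_dualMap_compLinearMap_dualMap (congrArg (fun T => T.toLinearMap) hd) _).symm⟩

theorem IsRelated.eq_of_surjective {φ : N → N'} (hφ : Function.Surjective φ)
    {J : JacobiStructure I N} {K K' : JacobiStructure I' N'} (hK : IsRelated φ J K)
    (hK' : IsRelated φ J K') : K = K' := by
  refine JacobiStructure.ext (funext fun y => ?_) (funext fun y => ?_) <;>
    obtain ⟨x, rfl⟩ := hφ y
  · rw [(hK x).2, (hK' x).2]
  · rw [(hK x).1, (hK' x).1]

theorem relatedVectorFields_mfderiv_symm (X : ∀ x : N', TangentSpace I' x) :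
    RelatedVectorFields (I := I) Ψ (fun x => mfderiv I' I Ψ.symm (Ψ x) (X (Ψ x))) X :=
  fun x => (DFunLike.congr_fun (mfderiv_comp_mfderiv_symm Ψ x) (X (Ψ x))).symm

theorem relatedBivectorFields_mfderiv_symm (Λ : ∀ x : N', Bivector I' x) :
    RelatedBivectorFields (I := I) Ψ (fun x => (Λ (Ψ x)).compLinearMap
      (mfderiv I' I Ψ.symm (Ψ x)).toLinearMap.dualMap) Λ :=
  fun x => (compLinearMap_dualMap_compLinearMap_dualMap
    (congrArg (fun T => T.toLinearMap) (mfderiv_comp_mfderiv_symm Ψ x)) _).symm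

section Equivalence

variable [I.Boundaryless] [FiniteDimensional ℝ EN]

/-- The Jacobi structure related to `K` by a diffeomorphism `Ψ`, with the tensors of `K` transported
by the tangent maps of `Ψ.symm`. -/
def JacobiStructure.pullback (hS : ContainsCoordinates I {f : N → ℝ | SmoothFun I f})
    (K : JacobiStructure I' N') : JacobiStructure I N :=
  .ofRelated (hS.mono (fun f hf => ⟨f ∘ Ψ.symm, hf.comp Ψ.symm.contMDiff, by ext; simp⟩)
      (by rintro _ ⟨f, hf, rfl⟩; exact ContMDiff.comp hf Ψ.contMDiff))
    Ψ.contMDiff K (relatedVectorFields_mfderiv_symm Ψ K.E)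
    (relatedBivectorFields_mfderiv_symm Ψ K.Λ)

theorem isRelated_pullback (hS : ContainsCoordinates I {f : N → ℝ | SmoothFun I f})
    (K : JacobiStructure I' N') : IsRelated Ψ (K.pullback Ψ hS) K :=
  fun x => ⟨relatedVectorFields_mfderiv_symm Ψ K.E x,
    relatedBivectorFields_mfderiv_symm Ψ K.Λ x⟩

variable [I'.Boundaryless] [FiniteDimensional ℝ EN']

/-- A diffeomorphism identifies the Jacobi structures on its source and its target. -/
def jacobiEquiv (hS : ContainsCoordinates I {f : N → ℝ | SmoothFun I f})
    (hS' : ContainsCoordinates I' {f : N' → ℝ | SmoothFun I' f}) :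
    JacobiStructure I N ≃ JacobiStructure I' N' where
  toFun J := J.pullback Ψ.symm hS'
  invFun K := K.pullback Ψ hS
  left_inv J := (isRelated_pullback Ψ hS _).symm.eq_of_surjective Ψ.symm.surjective
    (isRelated_pullback Ψ.symm hS' J)
  right_inv K := (isRelated_pullback Ψ.symm hS' _).symm.eq_of_surjective Ψ.surjective
    (isRelated_pullback Ψ hS K)

theorem isRelated_iff_eq_jacobiEquiv (hS : ContainsCoordinates I {f : N → ℝ | SmoothFun I f})
    (hS' : ContainsCoordinates I' {f : N' → ℝ | SmoothFun I' f}) {J : JacobiStructure I N}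
    {K : JacobiStructure I' N'} : IsRelated Ψ J K ↔ K = jacobiEquiv Ψ hS hS' J := by
  have hJ : IsRelated Ψ J (jacobiEquiv Ψ hS hS' J) := (isRelated_pullback Ψ.symm hS' J).symm
  exact ⟨fun h => h.eq_of_surjective Ψ.surjective hJ, fun h => h ▸ hJ⟩

end Equivalence

end Diffeomorphisms

/-! ### Linear Poisson tensors on the product with `ℝ ∖ {0}` -/

section ProductNonzero

theorem tCoord_ne_zero {M : Type*} (q : M × NonzeroReal) : tCoord q ≠ 0 := q.2.2

theorem tMul_eq {M : Type*} (f : M → ℝ) : tMul f = tCoord * f ∘ Prod.fst := rfl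

variable {EM : Type*} [NormedAddCommGroup EM] [NormedSpace ℝ EM]
  {M : Type*} [TopologicalSpace M] [ChartedSpace EM M]

theorem smooth_tCoord : SmoothFun (𝓘(ℝ, EM).prod 𝓘(ℝ, ℝ)) (tCoord (M := M)) :=
  (contMDiff_subtype_val (U := NonzeroReal)).comp contMDiff_snd

theorem smooth_comp_fst {f : M → ℝ} (hf : SmoothFun 𝓘(ℝ, EM) f) :
    SmoothFun (𝓘(ℝ, EM).prod 𝓘(ℝ, ℝ)) (f ∘ Prod.fst : M × NonzeroReal → ℝ) :=
  hf.comp contMDiff_fst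

theorem smooth_tMul {f : M → ℝ} (hf : SmoothFun 𝓘(ℝ, EM) f) :
    SmoothFun (𝓘(ℝ, EM).prod 𝓘(ℝ, ℝ)) (tMul f) := smooth_tCoord.mul (smooth_comp_fst hf)

theorem contMDiff_slice_fst (t : NonzeroReal) :
    ContMDiff 𝓘(ℝ, EM) (𝓘(ℝ, EM).prod 𝓘(ℝ, ℝ)) ∞ (fun x : M => (x, t)) :=
  contMDiff_id.prodMk contMDiff_const

theorem contMDiff_slice_snd (x : M) :
    ContMDiff 𝓘(ℝ, ℝ) (𝓘(ℝ, EM).prod 𝓘(ℝ, ℝ)) ∞ (fun t : NonzeroReal => (x, t)) :=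
  contMDiff_const.prodMk contMDiff_id

section Lifts

variable {G G' : M × NonzeroReal → ℝ}

theorem lieFun_liftVectorField (X : ∀ x : M, TangentSpace 𝓘(ℝ, EM) x)
    (hG : SmoothFun (𝓘(ℝ, EM).prod 𝓘(ℝ, ℝ)) G) (q : M × NonzeroReal) :
    lieFun (liftVectorField 𝓘(ℝ, EM) X) G q = lieFun X (fun x => G (x, q.2)) q.1 :=
  (dif_comp_apply (φ := fun x : M => (x, q.2)) (x := q.1) (hG.mdifferentiableAt q)
    ((contMDiff_slice_fst q.2 q.1).mdifferentiableAt (by simp)) (X q.1)).symm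

theorem pairing_liftBivectorField (Λ : ∀ x : M, Bivector 𝓘(ℝ, EM) x)
    (hG : SmoothFun (𝓘(ℝ, EM).prod 𝓘(ℝ, ℝ)) G) (hG' : SmoothFun (𝓘(ℝ, EM).prod 𝓘(ℝ, ℝ)) G')
    (q : M × NonzeroReal) :
    pairing (liftBivectorField 𝓘(ℝ, EM) Λ) G G' q =
      pairing Λ (fun x => G (x, q.2)) (fun x => G' (x, q.2)) q.1 := by
  have h_slice := (contMDiff_slice_fst (EM := EM) q.2 q.1).mdifferentiableAt (by simp)
  refine (altBilin_pushBivector (φ := fun x : M => (x, q.2)) q.1 (Λ q.1) _ _).trans ?_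
  exact congrArg₂ (fun α β => altBilin (Λ q.1) α β)
    (dif_comp (hG.mdifferentiableAt q) h_slice).symm
    (dif_comp (hG'.mdifferentiableAt q) h_slice).symm

theorem lieFun_partialT_apply (hG : SmoothFun (𝓘(ℝ, EM).prod 𝓘(ℝ, ℝ)) G) (q : M × NonzeroReal) :
    lieFun (partialT 𝓘(ℝ, EM)) G q =
      dif 𝓘(ℝ, ℝ) (fun t : NonzeroReal => G (q.1, t)) q.2 (1 : ℝ) :=
  (dif_comp_apply (φ := fun t : NonzeroReal => (q.1, t)) (x := q.2) (hG.mdifferentiableAt q)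
    ((contMDiff_slice_snd q.1 q.2).mdifferentiableAt (by simp)) (1 : ℝ)).symm

end Lifts

theorem lieFun_partialT_comp_fst {f : M → ℝ} (hf : SmoothFun 𝓘(ℝ, EM) f) :
    lieFun (partialT 𝓘(ℝ, EM)) (f ∘ Prod.fst : M × NonzeroReal → ℝ) = 0 := by
  ext q
  rw [lieFun_partialT_apply (smooth_comp_fst hf)]
  exact DFunLike.congr_fun (dif_const (I := 𝓘(ℝ, ℝ)) (f q.1) q.2) (1 : ℝ)

theorem dif_nonzeroReal_val (t : NonzeroReal) :
    dif 𝓘(ℝ, ℝ) (fun s : NonzeroReal => (s : ℝ)) t = LinearMap.id := by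
  have h_val : MDifferentiableAt 𝓘(ℝ, ℝ) 𝓘(ℝ, ℝ) (fun s : NonzeroReal => (s : ℝ)) t :=
    (contMDiff_subtype_val (U := NonzeroReal) t).mdifferentiableAt (n := ∞) (by simp)
  ext
  refine (dif_dual_comp h_val LinearMap.id _).trans ?_
  rw [mfderiv_of_eventuallyEq_extChartAt h_val (.of_forall fun _ => rfl)]
  rfl

theorem lieFun_partialT_tCoord : lieFun (partialT 𝓘(ℝ, EM)) (tCoord (M := M)) = 1 := by
  ext q
  rw [lieFun_partialT_apply smooth_tCoord]
  exact DFunLike.congr_fun (dif_nonzeroReal_val q.2) (1 : ℝ)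

theorem lieFun_partialT_tMul {f : M → ℝ} (hf : SmoothFun 𝓘(ℝ, EM) f) :
    lieFun (partialT 𝓘(ℝ, EM)) (tMul f) = f ∘ Prod.fst := by
  rw [tMul_eq, lieFun_mul _ smooth_tCoord (smooth_comp_fst hf), lieFun_partialT_comp_fst hf,
    lieFun_partialT_tCoord, mul_zero, zero_add, mul_one]

theorem dif_tMul_slice {f : M → ℝ} (hf : SmoothFun 𝓘(ℝ, EM) f) (q : M × NonzeroReal) :
    dif 𝓘(ℝ, EM) (fun x => tMul f (x, q.2)) q.1 = tCoord q • dif 𝓘(ℝ, EM) f q.1 :=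
  dif_smul (tCoord q) (hf.mdifferentiableAt q.1)

/-- The function `f + r t` on `M × (ℝ ∖ {0})`. Functions of this form contain coordinates, and
`∂/∂t` and the lifted tensors are easily evaluated on them. -/
def addMulT (f : M → ℝ) (r : ℝ) : M × NonzeroReal → ℝ := f ∘ Prod.fst + r • tCoord

section AddMulT

variable {f : M → ℝ}

theorem smooth_addMulT (hf : SmoothFun 𝓘(ℝ, EM) f) (r : ℝ) :
    SmoothFun (𝓘(ℝ, EM).prod 𝓘(ℝ, ℝ)) (addMulT f r) :=
  (smooth_comp_fst hf).add (contMDiff_const.mul smooth_tCoord)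

theorem dif_addMulT (hf : SmoothFun 𝓘(ℝ, EM) f) (r : ℝ) (q : M × NonzeroReal) :
    dif (𝓘(ℝ, EM).prod 𝓘(ℝ, ℝ)) (addMulT f r) q =
      dif _ (f ∘ Prod.fst : M × NonzeroReal → ℝ) q + r • dif _ tCoord q := by
  have h_tCoord := (smooth_tCoord (EM := EM)).mdifferentiableAt q
  rw [addMulT, dif_add ((smooth_comp_fst hf).mdifferentiableAt q) (h_tCoord.const_smul r),
    dif_smul r h_tCoord]

theorem lieFun_partialT_addMulT (hf : SmoothFun 𝓘(ℝ, EM) f) (r : ℝ) :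
    lieFun (partialT 𝓘(ℝ, EM)) (addMulT f r) = fun _ => r := by
  ext q
  rw [lieFun_apply, dif_addMulT hf, LinearMap.add_apply, LinearMap.smul_apply, ← lieFun_apply,
    ← lieFun_apply, lieFun_partialT_comp_fst hf, lieFun_partialT_tCoord, Pi.zero_apply, zero_add]
  exact mul_one r

theorem dif_addMulT_slice (hf : SmoothFun 𝓘(ℝ, EM) f) (r : ℝ) (q : M × NonzeroReal) :
    dif 𝓘(ℝ, EM) (fun x => addMulT f r (x, q.2)) q.1 = dif 𝓘(ℝ, EM) f q.1 := by
  have h_slice : (fun x => addMulT f r (x, q.2)) = f + fun _ => r * (q.2 : ℝ) := rfl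
  rw [h_slice, dif_add (hf.mdifferentiableAt _) mdifferentiableAt_const, dif_const, add_zero]

end AddMulT

/-- The Euler vector field `t ∂/∂t` of `M × (ℝ ∖ {0})`. -/
def eulerT (EM : Type*) [NormedAddCommGroup EM] [NormedSpace ℝ EM] {M : Type*} [TopologicalSpace M]
    [ChartedSpace EM M] (q : M × NonzeroReal) : TangentSpace (𝓘(ℝ, EM).prod 𝓘(ℝ, ℝ)) q :=
  tCoord q • partialT 𝓘(ℝ, EM) q

theorem lieFun_eulerT (G : M × NonzeroReal → ℝ) :
    lieFun (eulerT EM) G = tCoord * lieFun (partialT 𝓘(ℝ, EM)) G :=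
  funext fun _ => map_smul _ _ _

/-- The Poissonization `t⁻¹ Λ + ∂/∂t ∧ E` of a Jacobi structure `(Λ, E)`, as a bivector field on
`M × (ℝ ∖ {0})`. -/
def poissonizationBivector (K : JacobiStructure 𝓘(ℝ, EM) M) (q : M × NonzeroReal) :
    Bivector (𝓘(ℝ, EM).prod 𝓘(ℝ, ℝ)) q :=
  (tCoord q)⁻¹ • liftBivectorField 𝓘(ℝ, EM) K.Λ q +
    wedge _ (partialT 𝓘(ℝ, EM) q) (liftVectorField 𝓘(ℝ, EM) K.E q)

theorem pairing_poissonizationBivector (K : JacobiStructure 𝓘(ℝ, EM) M)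
    {G G' : M × NonzeroReal → ℝ} (hG : SmoothFun (𝓘(ℝ, EM).prod 𝓘(ℝ, ℝ)) G)
    (hG' : SmoothFun (𝓘(ℝ, EM).prod 𝓘(ℝ, ℝ)) G') (q : M × NonzeroReal) :
    pairing (poissonizationBivector K) G G' q =
      (tCoord q)⁻¹ * pairing K.Λ (fun x => G (x, q.2)) (fun x => G' (x, q.2)) q.1 +
      (lieFun (partialT 𝓘(ℝ, EM)) G q * lieFun K.E (fun x => G' (x, q.2)) q.1 -
        lieFun K.E (fun x => G (x, q.2)) q.1 * lieFun (partialT 𝓘(ℝ, EM)) G' q) := by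
  rw [← pairing_liftBivectorField K.Λ hG hG' q, ← lieFun_liftVectorField K.E hG q,
    ← lieFun_liftVectorField K.E hG' q]
  simp only [lieFun_apply]
  exact congrArg ((tCoord q)⁻¹ * pairing (liftBivectorField 𝓘(ℝ, EM) K.Λ) G G' q + ·)
    (altBilin_wedge (partialT 𝓘(ℝ, EM) q) (liftVectorField 𝓘(ℝ, EM) K.E q) _ _)

theorem pairing_poissonizationBivector_tMul (K : JacobiStructure 𝓘(ℝ, EM) M) {f g : M → ℝ}
    (hf : SmoothFun 𝓘(ℝ, EM) f) (hg : SmoothFun 𝓘(ℝ, EM) g) :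
    pairing (poissonizationBivector K) (tMul f) (tMul g) = tMul (K.bracket f g) := by
  ext q
  have ht := tCoord_ne_zero q
  rw [pairing_poissonizationBivector K (smooth_tMul hf) (smooth_tMul hg), lieFun_partialT_tMul hf,
    lieFun_partialT_tMul hg, pairing_apply, lieFun_apply, lieFun_apply, dif_tMul_slice hf,
    dif_tMul_slice hg, tMul, K.bracket_eq]
  simp only [Pi.sub_apply, Pi.add_apply, Pi.mul_apply, Function.comp_apply, pairing_apply,
    lieFun_apply, map_smul, LinearMap.smul_apply, smul_eq_mul]
  field_simp
  ring

theorem pairing_poissonizationBivector_addMulT (K : JacobiStructure 𝓘(ℝ, EM) M) {f g : M → ℝ}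
    (hf : SmoothFun 𝓘(ℝ, EM) f) (hg : SmoothFun 𝓘(ℝ, EM) g) (r s : ℝ) :
    pairing (poissonizationBivector K) (addMulT f r) (addMulT g s) =
      (fun q => (tCoord q)⁻¹) * pairing K.Λ f g ∘ Prod.fst +
        (r • lieFun K.E g ∘ Prod.fst - s • lieFun K.E f ∘ Prod.fst) := by
  ext q
  rw [pairing_poissonizationBivector K (smooth_addMulT hf r) (smooth_addMulT hg s),
    lieFun_partialT_addMulT hf, lieFun_partialT_addMulT hg, pairing_apply, lieFun_apply,
    lieFun_apply, dif_addMulT_slice hf, dif_addMulT_slice hg]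
  simp only [Pi.add_apply, Pi.mul_apply, Pi.sub_apply, Pi.smul_apply, Function.comp_apply,
    pairing_apply, lieFun_apply, smul_eq_mul]
  ring

theorem exists_dif_tMul_eq_dif_addMulT {f : M → ℝ} (hf : SmoothFun 𝓘(ℝ, EM) f) (r : ℝ)
    (q : M × NonzeroReal) : ∃ g : M → ℝ, SmoothFun 𝓘(ℝ, EM) g ∧
      dif (𝓘(ℝ, EM).prod 𝓘(ℝ, ℝ)) (tMul g) q = dif _ (addMulT f r) q := by
  have hcf := (smooth_comp_fst hf).mdifferentiableAt q
  let g : M → ℝ := (tCoord q)⁻¹ • f + fun _ => r - (tCoord q)⁻¹ * f q.1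
  have hg : SmoothFun 𝓘(ℝ, EM) g := (contMDiff_const.mul hf).add contMDiff_const
  have hgq : g q.1 = r := add_sub_cancel ((tCoord q)⁻¹ * f q.1) r
  have hg_comp : (g ∘ Prod.fst : M × NonzeroReal → ℝ) =
    (tCoord q)⁻¹ • f ∘ Prod.fst + fun _ => r - (tCoord q)⁻¹ * f q.1 := rfl
  refine ⟨g, hg, ?_⟩
  rw [dif_addMulT hf, tMul_eq, dif_mul (smooth_tCoord.mdifferentiableAt q)
    ((smooth_comp_fst hg).mdifferentiableAt q), Function.comp_apply, hgq, hg_comp,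
    dif_add (hcf.const_smul _) mdifferentiableAt_const, dif_const, add_zero, dif_smul _ hcf,
    smul_smul, mul_inv_cancel₀ (tCoord_ne_zero q), one_smul]

theorem isLinearization_poissonizationBivector (K : JacobiStructure 𝓘(ℝ, EM) M) :
    IsLinearization (fun f : {f : M → ℝ // SmoothFun 𝓘(ℝ, EM) f} => f.1) (fun f => tMul f.1) K
      (poissonizationBivector K) := fun f g =>
  ⟨⟨_, K.smooth_bracket f.2 g.2⟩, pairing_poissonizationBivector_tMul K f.2 g.2, rfl⟩

theorem isLinearFor_iff_isLinearBivector
    {Λ : ∀ q : M × NonzeroReal, Bivector (𝓘(ℝ, EM).prod 𝓘(ℝ, ℝ)) q} :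
    IsLinearFor (fun f : {f : M → ℝ // SmoothFun 𝓘(ℝ, EM) f} => tMul f.1) Λ ↔
      IsLinearBivector Λ := by
  simp only [IsLinearFor, IsLinearBivector, Subtype.forall, Subtype.exists, exists_prop]
  exact ⟨fun h f g hf hg => h f hf g hg, fun h f hf g hg => h f g hf hg⟩

theorem pairing_tMul_eq_tMul_iff
    {Λ : ∀ q : M × NonzeroReal, Bivector (𝓘(ℝ, EM).prod 𝓘(ℝ, ℝ)) q} (hΛ : IsLinearBivector Λ)
    {f g k : M → ℝ} (hf : SmoothFun 𝓘(ℝ, EM) f) (hg : SmoothFun 𝓘(ℝ, EM) g) :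
    pairing Λ (tMul f) (tMul g) = tMul k ↔
      ∀ x, k x = pairing Λ (tMul f) (tMul g) (x, ⟨1, one_ne_zero⟩) := by
  obtain ⟨l, -, hl⟩ := hΛ f g hf hg
  have h_one : ∀ (k : M → ℝ) (x : M), tMul k (x, ⟨1, one_ne_zero⟩) = k x := fun _ _ => one_mul _
  refine ⟨fun h x => by rw [h, h_one], fun h => ?_⟩
  have hkl : k = l := funext fun x => by rw [h, hl, h_one]
  rw [hl, hkl]

variable [IsManifold 𝓘(ℝ, EM) ∞ M] [T2Space M] [FiniteDimensional ℝ EM]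

theorem containsCoordinates_addMulT : ContainsCoordinates (𝓘(ℝ, EM).prod 𝓘(ℝ, ℝ))
    {G : M × NonzeroReal → ℝ | ∃ (f : M → ℝ) (r : ℝ), SmoothFun 𝓘(ℝ, EM) f ∧ G = addMulT f r} where
  smooth := by
    rintro _ ⟨f, r, hf, rfl⟩
    exact smooth_addMulT hf r
  exists_coord p c := by
    refine ⟨_, ⟨baseCoord p.1 (c ∘ₗ LinearMap.inl ℝ EM ℝ), c (0, 1), smoothFun_baseCoord _ _, rfl⟩,
      ?_⟩
    filter_upwards [continuous_fst.continuousAt.eventually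
      (baseCoord_eventuallyEq p.1 (c ∘ₗ LinearMap.inl ℝ EM ℝ))] with q hq
    have h_chart : extChartAt (𝓘(ℝ, EM).prod 𝓘(ℝ, ℝ)) p q =
        (extChartAt 𝓘(ℝ, EM) p.1 q.1, 0) + tCoord q • ((0, 1) : EM × ℝ) := by
      rw [extChartAt_prod, Prod.smul_mk, smul_zero, Prod.mk_add_mk, add_zero, zero_add,
        smul_eq_mul, mul_one]
      rfl
    rw [addMulT, Pi.add_apply, Function.comp_apply, hq, Pi.smul_apply, smul_eq_mul, h_chart,
      map_add, map_smul, smul_eq_mul, mul_comm (tCoord q)]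
    rfl

variable (EM M) in
theorem isHull_product : IsHull 𝓘(ℝ, EM) (𝓘(ℝ, EM).prod 𝓘(ℝ, ℝ))
    (fun x : M => (x, (⟨1, one_ne_zero⟩ : NonzeroReal))) (eulerT EM)
    (⟨1, contMDiff_const⟩ : {f : M → ℝ // SmoothFun 𝓘(ℝ, EM) f}) (fun f => f.1)
    (fun f => tMul f.1) where
  smooth_incl := contMDiff_slice_fst _
  smooth_bar f := smooth_tMul f.2
  smooth_liouville := containsCoordinates_addMulT.smoothVectorField <| by
    rintro _ ⟨f, r, hf, rfl⟩
    rw [lieFun_eulerT, lieFun_partialT_addMulT hf]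
    exact smooth_tCoord.mul contMDiff_const
  lie_bar f := by rw [lieFun_eulerT, lieFun_partialT_tMul f.2, tMul_eq]
  bar_comp f := funext fun _ => one_mul _
  fn_one := rfl
  ext_bar f g h := congrArg tMul h
  exists_add f g := ⟨⟨f.1 + g.1, f.2.add g.2⟩, rfl, funext fun _ => mul_add _ _ _⟩
  coords := by
    rw [Subtype.range_coe_subtype]
    exact containsCoordinates_smooth
  coords' := containsCoordinates_addMulT.mono containsCoordinates_addMulT.smooth fun _ h => h
  dense := by
    convert dense_univ
    exact eq_univ_of_forall fun q => by simpa [tMul] using tCoord_ne_zero q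
  span q _ c := by
    obtain ⟨_, ⟨f, r, hf, rfl⟩, hc⟩ := containsCoordinates_addMulT.exists_dif_eq q c
    obtain ⟨g, hg, hgf⟩ := exists_dif_tMul_eq_dif_addMulT hf r q
    exact ⟨⟨g, hg⟩, hgf.trans hc⟩
  finrank_eq := by rw [finrank_prod, finrank_self]

theorem smooth_poissonizationBivector (K : JacobiStructure 𝓘(ℝ, EM) M) :
    SmoothBivectorField (𝓘(ℝ, EM).prod 𝓘(ℝ, ℝ)) (poissonizationBivector K) := by
  refine containsCoordinates_addMulT.smoothBivectorField ?_
  rintro _ ⟨f, r, hf, rfl⟩ _ ⟨g, s, hg, rfl⟩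
  rw [pairing_poissonizationBivector_addMulT K hf hg]
  exact ((smooth_tCoord.inv₀ tCoord_ne_zero).mul (smooth_comp_fst (K.smoothΛ f g hf hg))).add
    ((contMDiff_const.mul (smooth_comp_fst (K.smoothE g hg))).sub
      (contMDiff_const.mul (smooth_comp_fst (K.smoothE f hf))))

variable (EM M) in
/-- Poissonization, as a correspondence between Jacobi structures on `M` and linear Poisson tensors
on `M × (ℝ ∖ {0})`. -/
def jacobiLinearPoissonEquiv : JacobiStructure 𝓘(ℝ, EM) M ≃ LinearPoisson 𝓘(ℝ, EM) M :=
  (Equiv.subtypeUnivEquiv fun K f g => ⟨⟨_, K.smooth_bracket f.2 g.2⟩, rfl⟩).symm.trans <|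
    ((isHull_product EM M).linearizationEquiv fun K _ => ⟨poissonizationBivector K,
      smooth_poissonizationBivector K, isLinearization_poissonizationBivector K⟩).trans <|
    Equiv.subtypeEquivRight fun _ => isLinearFor_iff_isLinearBivector

theorem eq_jacobiLinearPoissonEquiv_iff (K : JacobiStructure 𝓘(ℝ, EM) M)
    (P : LinearPoisson 𝓘(ℝ, EM) M) :
    P = jacobiLinearPoissonEquiv EM M K ↔ ∀ f g : M → ℝ, SmoothFun 𝓘(ℝ, EM) f →
      SmoothFun 𝓘(ℝ, EM) g → P.1.bracket (tMul f) (tMul g) = tMul (K.bracket f g) := by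
  have h_eq := (isHull_product EM M).eq_linearizationEquiv_iff
    (hex := fun K _ => ⟨poissonizationBivector K, smooth_poissonizationBivector K,
      isLinearization_poissonizationBivector K⟩)
    ⟨K, fun f g => ⟨⟨_, K.smooth_bracket f.2 g.2⟩, rfl⟩⟩
    ⟨P.1, isLinearFor_iff_isLinearBivector.2 P.2⟩
  rw [Subtype.ext_iff] at h_eq ⊢
  refine h_eq.trans ?_
  simp only [Subtype.forall]
  exact ⟨fun h f g hf hg => (pairing_tMul_eq_tMul_iff P.2 hf hg).2 (h f hf g hg),
    fun h f hf g hg => (pairing_tMul_eq_tMul_iff P.2 hf hg).1 (h f g hf hg)⟩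

theorem jacobiLinearPoissonEquiv_Λ (K : JacobiStructure 𝓘(ℝ, EM) M) :
    (jacobiLinearPoissonEquiv EM M K).1.Λ = poissonizationBivector K := by
  refine (isHull_product EM M).bivector_ext (jacobiLinearPoissonEquiv EM M K).1.smoothΛ
    (smooth_poissonizationBivector K) fun f g => ?_
  rw [pairing_poissonizationBivector_tMul K f.2 g.2]
  exact (eq_jacobiLinearPoissonEquiv_iff K _).1 rfl f.1 g.1 f.2 g.2

end ProductNonzero

/-! ### Affine bundles of rank zero -/

section RankZeroBundles

variable {M : Type*} [TopologicalSpace M]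
  {F : Type*} [NormedAddCommGroup F] [NormedSpace ℝ F]
  {V : M → Type*} [∀ x, AddCommGroup (V x)] [∀ x, Module ℝ (V x)]
  {A : M → Type*} [∀ x, AddTorsor (V x) (A x)]
  [TopologicalSpace (TotalSpace F A)] [∀ x, TopologicalSpace (A x)] [FiberBundle F A]

theorem fibrePoint_zero_of_subsingleton [IsAffineBundle F A] [Subsingleton F]
    (p : TotalSpace F A) : fibrePoint F A p.1 0 = p := by
  obtain ⟨v, hv⟩ := exists_fibrePoint_eq p
  rw [Subsingleton.elim 0 v]
  exact hv.symm

variable {EM : Type*} [NormedAddCommGroup EM] [NormedSpace ℝ EM] [ChartedSpace EM M]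
  [IsSmoothAffineBundle F A 𝓘(ℝ, EM)]

theorem contMDiff_fibrePoint_zero [Subsingleton F] :
    ContMDiff 𝓘(ℝ, EM) (𝓘(ℝ, EM).prod 𝓘(ℝ, F)) ∞ (fun x => fibrePoint F A x 0) := by
  intro x
  have h_eq : (fun y => fibrePoint F A y 0) = fun y =>
      ⟨y, (fibreAff F A (trivializationAt F A x) y).symm 0⟩ :=
    funext fun y => fibrePoint_zero_of_subsingleton ⟨y, _⟩
  rw [h_eq]
  exact contMDiffAt_fibreAff_symm contMDiffAt_id contMDiffAt_const
    (mem_baseSet_trivializationAt F A x)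

variable (A EM) in
/-- The projection of an affine bundle with zero-dimensional fibre, as a diffeomorphism. -/
def projDiffeomorph [Subsingleton F] :
    TotalSpace F A ≃ₘ⟮𝓘(ℝ, EM).prod 𝓘(ℝ, F), 𝓘(ℝ, EM)⟯ M where
  toFun := π F A
  invFun x := fibrePoint F A x 0
  left_inv := fibrePoint_zero_of_subsingleton
  right_inv _ := rfl
  contMDiff_toFun := contMDiff_proj A
  contMDiff_invFun := contMDiff_fibrePoint_zero

theorem isAffineJacobi_of_subsingleton [Subsingleton F]
    (J : JacobiStructure (𝓘(ℝ, EM).prod 𝓘(ℝ, F)) (TotalSpace F A)) : IsAffineJacobi J :=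
  fun a b => ⟨⟨fun x => AffineMap.const ℝ (A x) (J.bracket a.fn b.fn (fibrePoint F A x 0)),
      ((J.smooth_bracket a.smooth b.smooth).comp contMDiff_fibrePoint_zero).comp
        (contMDiff_proj A)⟩,
    funext fun p => congrArg (J.bracket a.fn b.fn) (fibrePoint_zero_of_subsingleton p).symm⟩

variable [FiniteDimensional ℝ EM] [IsManifold 𝓘(ℝ, EM) ∞ M] [T2Space M] [FiniteDimensional ℝ F]

variable (EM M F A) in
theorem exists_equiv_affineJacobi_linearPoisson (hF : finrank ℝ F = 0) :
    (∀ J : AffineJacobi 𝓘(ℝ, EM) F A, ∃! K : JacobiStructure 𝓘(ℝ, EM) M,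
      IsRelated (π F A) J.1 K) ∧
    ∃ Φ : AffineJacobi 𝓘(ℝ, EM) F A ≃ LinearPoisson 𝓘(ℝ, EM) M,
      ∀ (J : AffineJacobi 𝓘(ℝ, EM) F A) (K : JacobiStructure 𝓘(ℝ, EM) M),
        IsRelated (π F A) J.1 K →
        (∀ P, P = Φ J ↔ ∀ f g : M → ℝ, SmoothFun 𝓘(ℝ, EM) f → SmoothFun 𝓘(ℝ, EM) g →
          P.1.bracket (tMul f) (tMul g) = tMul (K.bracket f g)) ∧
        (Φ J).1.Λ = poissonizationBivector K := by
  have : Subsingleton F := finrank_zero_iff.1 hF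
  let Ψ : JacobiStructure (𝓘(ℝ, EM).prod 𝓘(ℝ, F)) (TotalSpace F A) ≃ JacobiStructure 𝓘(ℝ, EM) M :=
    jacobiEquiv (projDiffeomorph A EM)
      (containsCoordinates_affine.mono containsCoordinates_affine.smooth fun _ h => h)
      containsCoordinates_smooth
  have hΨ : ∀ J K, IsRelated (π F A) J K ↔ K = Ψ J := fun _ _ =>
    isRelated_iff_eq_jacobiEquiv (projDiffeomorph A EM) _ _
  refine ⟨fun J => ⟨Ψ J.1, (hΨ _ _).2 rfl, fun K => (hΨ _ _).1⟩,
    (Equiv.subtypeUnivEquiv isAffineJacobi_of_subsingleton).trans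
      (Ψ.trans (jacobiLinearPoissonEquiv EM M)), fun J K hJK => ?_⟩
  obtain rfl := (hΨ _ _).1 hJK
  exact ⟨eq_jacobiLinearPoissonEquiv_iff (Ψ J.1), jacobiLinearPoissonEquiv_Λ (Ψ J.1)⟩

end RankZeroBundles

end

theorem corollary3p9_general
    {EM : Type*} [NormedAddCommGroup EM] [NormedSpace ℝ EM] [FiniteDimensional ℝ EM]
    {M : Type*} [TopologicalSpace M] [ChartedSpace EM M] [IsManifold 𝓘(ℝ, EM) ∞ M]
    [T2Space M]
    {F : Type*} [NormedAddCommGroup F] [NormedSpace ℝ F] [FiniteDimensional ℝ F]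
    {V : M → Type*} [∀ x, AddCommGroup (V x)] [∀ x, Module ℝ (V x)]
    {A : M → Type*} [∀ x, AddTorsor (V x) (A x)]
    [TopologicalSpace (TotalSpace F A)] [∀ x, TopologicalSpace (A x)]
    [FiberBundle F A] [IsSmoothAffineBundle F A 𝓘(ℝ, EM)] :
    (0 < Module.finrank ℝ F →
      ∃ Φ : AffineJacobi 𝓘(ℝ, EM) F A ≃ HomogeneousPoisson 𝓘(ℝ, EM) F A,
        (∀ J P, P = Φ J ↔ ∀ (a b : AffineFunction 𝓘(ℝ, EM) F A) (p : TotalSpace F A),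
          J.1.bracket a.fn b.fn p = P.1.bracket a.bar b.bar (inclHull F A p)) ∧
        ∀ J, ∃ K : JacobiStructure (𝓘(ℝ, EM).prod 𝓘(ℝ, ℝ × F)) (TotalSpace (ℝ × F) (Hull F A)),
          K.E = hamOne (Φ J).1.Λ ∧
          (K.Λ = fun ψ => (Φ J).1.Λ ψ - wedge _ (liouville 𝓘(ℝ, EM) F A ψ) (K.E ψ)) ∧
          IsRelated (inclHull F A) J.1 K) ∧
    (Module.finrank ℝ F = 0 →
      (∀ J : AffineJacobi 𝓘(ℝ, EM) F A, ∃! K : JacobiStructure 𝓘(ℝ, EM) M,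
        IsRelated (π F A) J.1 K) ∧
      ∃ Φ : AffineJacobi 𝓘(ℝ, EM) F A ≃ LinearPoisson 𝓘(ℝ, EM) M,
        ∀ (J : AffineJacobi 𝓘(ℝ, EM) F A) (K : JacobiStructure 𝓘(ℝ, EM) M),
          IsRelated (π F A) J.1 K →
          (∀ P, P = Φ J ↔ ∀ f g : M → ℝ, SmoothFun 𝓘(ℝ, EM) f → SmoothFun 𝓘(ℝ, EM) g →
            P.1.bracket (tMul f) (tMul g) = tMul (K.bracket f g)) ∧
          (Φ J).1.Λ = fun q => (tCoord q)⁻¹ • liftBivectorField 𝓘(ℝ, EM) K.Λ q +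
            wedge _ (partialT 𝓘(ℝ, EM) q) (liftVectorField 𝓘(ℝ, EM) K.E q)) :=
  ⟨exists_equiv_affineJacobi_homogeneousPoisson EM M F A,
    exists_equiv_affineJacobi_linearPoisson M F A EM⟩

theorem corollary3p9
    {EM : Type*} [NormedAddCommGroup EM] [NormedSpace ℝ EM] [FiniteDimensional ℝ EM]
    {M : Type*} [TopologicalSpace M] [ChartedSpace EM M] [IsManifold 𝓘(ℝ, EM) ∞ M]
    [T2Space M] [SecondCountableTopology M]
    {F : Type*} [NormedAddCommGroup F] [NormedSpace ℝ F] [FiniteDimensional ℝ F]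
    {V : M → Type*} [∀ x, AddCommGroup (V x)] [∀ x, Module ℝ (V x)]
    {A : M → Type*} [∀ x, AddTorsor (V x) (A x)]
    [TopologicalSpace (TotalSpace F A)] [∀ x, TopologicalSpace (A x)]
    [FiberBundle F A] [IsSmoothAffineBundle F A 𝓘(ℝ, EM)] :
    (0 < Module.finrank ℝ F →
      ∃ Φ : AffineJacobi 𝓘(ℝ, EM) F A ≃ HomogeneousPoisson 𝓘(ℝ, EM) F A,
        (∀ J P, P = Φ J ↔ ∀ (a b : AffineFunction 𝓘(ℝ, EM) F A) (p : TotalSpace F A),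
          J.1.bracket a.fn b.fn p = P.1.bracket a.bar b.bar (inclHull F A p)) ∧
        ∀ J, ∃ K : JacobiStructure (𝓘(ℝ, EM).prod 𝓘(ℝ, ℝ × F)) (TotalSpace (ℝ × F) (Hull F A)),
          K.E = hamOne (Φ J).1.Λ ∧
          (K.Λ = fun ψ => (Φ J).1.Λ ψ - wedge _ (liouville 𝓘(ℝ, EM) F A ψ) (K.E ψ)) ∧
          IsRelated (inclHull F A) J.1 K) ∧
    (Module.finrank ℝ F = 0 →
      (∀ J : AffineJacobi 𝓘(ℝ, EM) F A, ∃! K : JacobiStructure 𝓘(ℝ, EM) M,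
        IsRelated (π F A) J.1 K) ∧
      ∃ Φ : AffineJacobi 𝓘(ℝ, EM) F A ≃ LinearPoisson 𝓘(ℝ, EM) M,
        ∀ (J : AffineJacobi 𝓘(ℝ, EM) F A) (K : JacobiStructure 𝓘(ℝ, EM) M),
          IsRelated (π F A) J.1 K →
          (∀ P, P = Φ J ↔ ∀ f g : M → ℝ, SmoothFun 𝓘(ℝ, EM) f → SmoothFun 𝓘(ℝ, EM) g →
            P.1.bracket (tMul f) (tMul g) = tMul (K.bracket f g)) ∧
          (Φ J).1.Λ = fun q => (tCoord q)⁻¹ • liftBivectorField 𝓘(ℝ, EM) K.Λ q +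
            wedge _ (partialT 𝓘(ℝ, EM) q) (liftVectorField 𝓘(ℝ, EM) K.E q)) :=
  corollary3p9_general
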